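/- Let $(M,g)$ be a smooth Riemannian manifold with Levi-Civita connection $\nabla$, and let $\phi$ be a generalized calibration of degree $k$ on $M$: a smooth $k$-form, not necessarily closed, with $\phi(\xi)\le 1$ for every oriented tangent $k$-plane $\xi$ (where $\phi(\xi)=\phi(v_1,\dots,v_k)$ for an oriented orthonormal basis $v_1,\dots,v_k$ of $\xi$). Let $X$ be an oriented smooth $k$-manifold without boundary, and let $F_t:X\to M$, $|t|<\varepsilon$, be maps depending smoothly on $(t,x)$, such that $F_0$ is an immersion (for example the inclusion of a submanifold) which is calibrated by $\phi$, i.e. $\phi(T_xX)=1$ for all $x\in X$, and such that $V=\partial_tF_t|_{t=0}$ is normal to $X$. Let $d\mathrm{vol}(t)$ be the Riemannian volume form of the induced metric $F_t^*g$, put $\phi(t)=F_t^*\phi$, and write $\phi(t)=\lambda(t)\,d\mathrm{vol}(t)$, the function $\lambda(t)$ being uniquely determined at every point at which $F_t$ is an immersion. Let $D\subseteq X$ be a measurable set with compact closure (for instance $D=X$ if $X$ is compact), and let $$E(t)=\int_D d\mathrm{vol}(t)-\int_D\phi(t)$$ be the energy $\mathrm{Vol}-\int\phi$ of the part of $X(t)=F_t(X)$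 over $D$. Then $\frac{d}{dt}\lambda(t)\big|_{t=0}=0$ at every point of $X$, the function $E$ is differentiable near $t=0$ and twice differentiable at $t=0$, and $$\frac{d^2}{dt^2}E(t)\Big|_{t=0}=\int_D\Big(\|\nabla^\perp V\|^2\,d\mathrm{vol}(0)-\nabla_V\nabla_V\phi-i_{\nabla^\perp V}\,i_{\nabla^\perp V}\phi-2\,i_{\nabla^\perp V}\nabla_V\phi\Big),$$ where all integrals converge and the last three forms are restricted to $X$. Here $\nabla^\perp V$ is the covariant derivative of $V$ in the normal bundle of $X$, and $\|\nabla^\perp V\|^2=\sum_j|\nabla^\perp_{e_j}V|^2$ for an orthonormal basis $e_j$ of $T_xX$. For a linear endomorphism $A$ of a tangent space of $M$, $(i_A\alpha)(v_1,\dots,v_k)=\sum_j\alpha(v_1,\dots,Av_j,\dots,v_k)$, and $\nabla^\perp V$ is regarded as the endomorphism that sends $u\in T_xX$ to $\nabla^\perp_uV$ and vanishes on normal vectors. Finally, $\nabla_V\phi$ and $\nabla_V\nabla_V\phi$ at $x$ are the first and second covariant derivatives at $t=0$ of $\phi$ along a smooth curve $\gamma_x$ with $\gamma_x(0)=F_0(x)$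 and $\gamma_x'(0)=V(x)$; the formula holds for every choice of these curves, in particular for $\gamma_x(t)=F_t(x)$ and for the integral curves of any extension of $V$ to a vector field on $M$. -/

import Mathlib

open Set Filter MeasureTheory
open scoped Manifold ContDiff Topology

noncomputable section

namespace GenCal

/-! ## Differential forms, metrics, and their expressions in charts

All manifolds are modelled on Euclidean space; `n` is the dimension of the ambient manifold `M` and
`k` the degree of the form as well as the dimension of the submanifold. -/

/-- A (not necessarily continuous) differential form of degree `k` on an `n`-manifold `M`. -/
abbrev KForm (n k : ℕ) (M : Type*) [TopologicalSpace M]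
    [ChartedSpace (EuclideanSpace ℝ (Fin n)) M] :=
  ∀ m : M, TangentSpace (𝓡 n) m [⋀^Fin k]→L[ℝ] ℝ

/-- A smooth Riemannian metric on an `n`-manifold `M`. -/
abbrev Metric (n : ℕ) (M : Type*) [TopologicalSpace M]
    [ChartedSpace (EuclideanSpace ℝ (Fin n)) M] [IsManifold (𝓡 n) ∞ M] :=
  Bundle.ContMDiffRiemannianMetric (𝓡 n) ∞ (EuclideanSpace ℝ (Fin n))
    (fun m : M => TangentSpace (𝓡 n) m)

/-- The coordinate frame `e_1, …, e_k` of `ℝ^k`. -/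
def coordFrame (k : ℕ) (j : Fin k) : EuclideanSpace ℝ (Fin k) := EuclideanSpace.single j 1

/-- The bilinear form `(u, v) ↦ B(S u, T v)`. -/
def pullBilin {U U' W : Type*} [AddCommGroup U] [Module ℝ U] [TopologicalSpace U]
    [AddCommGroup U'] [Module ℝ U'] [TopologicalSpace U']
    [AddCommGroup W] [Module ℝ W] [TopologicalSpace W]
    (B : W →L[ℝ] W →L[ℝ] ℝ) (S : U →L[ℝ] W) (T : U' →L[ℝ] W) : U →L[ℝ] U' →L[ℝ] ℝ :=
  ContinuousLinearMap.precomp ℝ T ∘L B ∘L S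

section Charts

variable {n k : ℕ} {M : Type*} [TopologicalSpace M] [ChartedSpace (EuclideanSpace ℝ (Fin n)) M]

/-- The differential at the coordinate point `y` of the inverse of the chart around `c`. -/
def chartInvDeriv (c : M) (y : EuclideanSpace ℝ (Fin n)) :
    EuclideanSpace ℝ (Fin n) →L[ℝ] TangentSpace (𝓡 n) ((extChartAt (𝓡 n) c).symm y) :=
  mfderiv 𝓘(ℝ, EuclideanSpace ℝ (Fin n)) (𝓡 n) (extChartAt (𝓡 n) c).symm y

/-- The differential at the point `m` of the chart around `c`. -/
def chartDeriv (c m : M) : TangentSpace (𝓡 n) m →L[ℝ] EuclideanSpace ℝ (Fin n) :=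
  mfderiv (𝓡 n) 𝓘(ℝ, EuclideanSpace ℝ (Fin n)) (extChartAt (𝓡 n) c) m

/-- The inverse of `chartDeriv m m`, the differential of the inverse of the chart around `m`. -/
def chartInvDerivAt (m : M) : EuclideanSpace ℝ (Fin n) →L[ℝ] TangentSpace (𝓡 n) m :=
  mfderiv 𝓘(ℝ, EuclideanSpace ℝ (Fin n)) (𝓡 n) (extChartAt (𝓡 n) m).symm (extChartAt (𝓡 n) m m)

/-- The differential of a vector valued function. -/
def vecDeriv (N : ℕ) (h : M → EuclideanSpace ℝ (Fin N)) (m : M) :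
    TangentSpace (𝓡 n) m →L[ℝ] EuclideanSpace ℝ (Fin N) :=
  mfderiv (𝓡 n) 𝓘(ℝ, EuclideanSpace ℝ (Fin N)) h m

/-- The expression of a form in the chart around `c`: its pullback under the inverse chart. -/
def chartForm (η : KForm n k M) (c : M) (y : EuclideanSpace ℝ (Fin n)) :
    EuclideanSpace ℝ (Fin n) [⋀^Fin k]→L[ℝ] ℝ :=
  (η ((extChartAt (𝓡 n) c).symm y)).compContinuousLinearMap (chartInvDeriv c y)

/-- A form is smooth if its expression in every chart is smooth. -/
def IsSmoothForm (η : KForm n k M) : Prop :=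
  ∀ c : M, ContDiffOn ℝ ∞ (chartForm η c) (extChartAt (𝓡 n) c).target

/-- An orientation of a manifold, represented by a nowhere vanishing smooth form of top degree:
a frame `v` of a tangent space is positively oriented when the form is positive on `v`. -/
def IsOrientation (o : KForm n n M) : Prop :=
  IsSmoothForm o ∧ ∀ m, o m ≠ 0

variable [IsManifold (𝓡 n) ∞ M]

/-- The metric tensor `g_{ij}(y)` in the chart around `c`. -/
def chartMetric (g : Metric n M) (c : M) (y : EuclideanSpace ℝ (Fin n)) :
    EuclideanSpace ℝ (Fin n) →L[ℝ] EuclideanSpace ℝ (Fin n) →L[ℝ] ℝ :=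
  pullBilin (g.inner ((extChartAt (𝓡 n) c).symm y)) (chartInvDeriv c y) (chartInvDeriv c y)

/-- The Christoffel symbols `Γ(u, ·)` of the Levi-Civita connection of `g` in the chart around `c`,
at the coordinate point `y`. They are given by
`2 g(Γ(u, v), w) = (∂_u g)(v, w) + (∂_v g)(u, w) - (∂_w g)(u, v)`. -/
def christoffel (g : Metric n M) (c : M) (y u : EuclideanSpace ℝ (Fin n)) :
    EuclideanSpace ℝ (Fin n) →L[ℝ] EuclideanSpace ℝ (Fin n) :=
  (chartMetric g c y).inverse ∘L
    ((1 / 2 : ℝ) • (fderiv ℝ (chartMetric g c) y u + (fderiv ℝ (chartMetric g c) y).flip u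
      - ((fderiv ℝ (chartMetric g c) y).flip u).flip))

end Charts

/-! ## The operation `i_A` on forms -/

section Insertion

variable {k : ℕ} {W : Type*} [AddCommGroup W] [Module ℝ W] [TopologicalSpace W]

theorem update_id_apply (A : W →L[ℝ] W) (v : Fin k → W) (j : Fin k) :
    (fun i => (Function.update (fun _ => ContinuousLinearMap.id ℝ W) j A i) (v i))
      = Function.update v j (A (v j)) := by
  funext i
  by_cases h : i = j
  · subst h; simp
  · simp [h]

/-- The interior product `i_A α` of an alternating form with a vector valued one-form `A`, that is
`(i_A α)(v_1, …, v_k) = ∑ j, α(v_1, …, A v_j, …, v_k)`. -/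
def insertion (A : W →L[ℝ] W) (α : W [⋀^Fin k]→L[ℝ] ℝ) : W [⋀^Fin k]→L[ℝ] ℝ where
  toContinuousMultilinearMap :=
    ∑ j : Fin k, α.toContinuousMultilinearMap.compContinuousLinearMap
      (Function.update (fun _ => ContinuousLinearMap.id ℝ W) j A)
  map_eq_zero_of_eq' := by
    intro v a b hab hne
    change (∑ j : Fin k, α.toContinuousMultilinearMap.compContinuousLinearMap
      (Function.update (fun _ => ContinuousLinearMap.id ℝ W) j A)) v = 0
    simp only [sum_apply, ContinuousMultilinearMap.compContinuousLinearMap_apply,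
      update_id_apply, ContinuousAlternatingMap.coe_toContinuousMultilinearMap]
    rw [← Finset.add_sum_erase _ _ (Finset.mem_univ a),
      ← Finset.add_sum_erase _ _ (Finset.mem_erase.2 ⟨hne.symm, Finset.mem_univ b⟩),
      Finset.sum_eq_zero, add_zero]
    · have hsw : Function.update v b (A (v b))
          = (Function.update v a (A (v a))) ∘ Equiv.swap a b := by
        funext i
        by_cases hia : i = a
        · subst hia; simp [hne, hne.symm, hab]
        · by_cases hib : i = b
          · subst hib; simp [hab]
          · simp [hia, hib, Equiv.swap_apply_of_ne_of_ne hia hib]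
      rw [hsw]
      have := α.toAlternatingMap.map_swap (Function.update v a (A (v a))) hne
      simp only [ContinuousAlternatingMap.coe_toAlternatingMap] at this
      rw [this, add_neg_cancel]
    · intro j hj
      simp only [Finset.mem_erase, Finset.mem_univ, and_true] at hj
      exact α.map_eq_zero_of_eq _ (i := a) (j := b)
        (by simp [Ne.symm hj.1, Ne.symm hj.2, hab]) hne

theorem insertion_apply (A : W →L[ℝ] W) (α : W [⋀^Fin k]→L[ℝ] ℝ) (v : Fin k → W) :
    insertion A α v = ∑ j, α (Function.update v j (A (v j))) := by
  change (∑ j : Fin k, α.toContinuousMultilinearMap.compContinuousLinearMap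
      (Function.update (fun _ => ContinuousLinearMap.id ℝ W) j A)) v = _
  simp [update_id_apply]

end Insertion

/-! ## Covariant derivatives of forms along curves -/

section CovariantDerivative

variable {n k : ℕ} {M : Type*} [TopologicalSpace M] [ChartedSpace (EuclideanSpace ℝ (Fin n)) M]
  [IsManifold (𝓡 n) ∞ M]

/-- The Levi-Civita covariant derivative `D/dt` of a form `α(t)` along a curve `y(t)`, both
expressed in the chart around `c`:
`(Dα/dt)(v_1, …, v_k) = α'(v_1, …, v_k) - ∑ j, α(v_1, …, Γ(y', v_j), …, v_k)`. -/
def covDerivAlong (g : Metric n M) (c : M) (y : ℝ → EuclideanSpace ℝ (Fin n))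
    (α : ℝ → EuclideanSpace ℝ (Fin n) [⋀^Fin k]→L[ℝ] ℝ) (t : ℝ) :
    EuclideanSpace ℝ (Fin n) [⋀^Fin k]→L[ℝ] ℝ :=
  deriv α t - insertion (christoffel g c (y t) (deriv y t)) (α t)

/-- For a curve `γ` with `γ 0 = m` and initial velocity `V`, the form `∇_V φ` at `m`:
the covariant derivative `D/dt` at `t = 0` of `φ` along `γ`. -/
def nablaForm (g : Metric n M) (φ : KForm n k M) (m : M) (γ : ℝ → M) :
    TangentSpace (𝓡 n) m [⋀^Fin k]→L[ℝ] ℝ :=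
  (covDerivAlong g m (fun t => extChartAt (𝓡 n) m (γ t))
    (fun t => chartForm φ m (extChartAt (𝓡 n) m (γ t))) 0).compContinuousLinearMap
      (chartDeriv m m)

/-- For a curve `γ` with `γ 0 = m` and velocity `V(t)`, the form `∇_V ∇_V φ` at `m`:
the second covariant derivative `(D/dt)(D/dt)` at `t = 0` of `φ` along `γ`. -/
def nablaNablaForm (g : Metric n M) (φ : KForm n k M) (m : M) (γ : ℝ → M) :
    TangentSpace (𝓡 n) m [⋀^Fin k]→L[ℝ] ℝ :=
  (covDerivAlong g m (fun t => extChartAt (𝓡 n) m (γ t))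
    (covDerivAlong g m (fun t => extChartAt (𝓡 n) m (γ t))
      (fun t => chartForm φ m (extChartAt (𝓡 n) m (γ t)))) 0).compContinuousLinearMap
      (chartDeriv m m)

end CovariantDerivative

/-! ## Geometry of a map `f : X → M` from an oriented `k`-manifold -/

section Submanifold

variable {n k : ℕ} {M : Type*} [TopologicalSpace M] [ChartedSpace (EuclideanSpace ℝ (Fin n)) M]
  {X : Type*} [TopologicalSpace X] [ChartedSpace (EuclideanSpace ℝ (Fin k)) X]

/-- The pullback `f^* φ`. -/
def pullback (φ : KForm n k M) (f : X → M) : KForm k k X := fun x =>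
  (φ (f x)).compContinuousLinearMap (mfderiv (𝓡 k) (𝓡 n) f x)

variable [IsManifold (𝓡 n) ∞ M]

/-- The induced metric `f^* g` on `T_x X`. -/
def inducedMetric (g : Metric n M) (f : X → M) (x : X) :
    TangentSpace (𝓡 k) x →L[ℝ] TangentSpace (𝓡 k) x →L[ℝ] ℝ :=
  pullBilin (g.inner (f x)) (mfderiv (𝓡 k) (𝓡 n) f x) (mfderiv (𝓡 k) (𝓡 n) f x)

/-- The volume form of the induced metric `h = f^* g` for the orientation `o`: the nonnegative
multiple of `o` which is `± √(det h(e_i, e_j))` on a frame `e`. -/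
def volForm (g : Metric n M) (o : KForm k k X) (f : X → M) : KForm k k X := fun x =>
  (Real.sqrt (Matrix.of fun i j => inducedMetric g f x (coordFrame k i) (coordFrame k j)).det
    / |o x (coordFrame k)|) • o x

/-- The function `λ` with `f^* φ = λ dvol`. -/
def ratio (g : Metric n M) (φ : KForm n k M) (o : KForm k k X) (f : X → M) (x : X) : ℝ :=
  pullback φ f x (coordFrame k) / volForm g o f x (coordFrame k)

/-- A generalized calibration of degree `k`: a smooth `k`-form, not necessarily closed, with
`φ(ξ) ≤ 1` for every oriented tangent `k`-plane `ξ`. The value `φ(ξ)` is that of `φ` on an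
orthonormal basis of the plane, with the sign `±` according to the orientation of `ξ`; both
orientations of the plane are allowed, hence the absolute value. -/
def IsGeneralizedCalibration (g : Metric n M) (φ : KForm n k M) : Prop :=
  IsSmoothForm φ ∧ ∀ (m : M) (v : Fin k → TangentSpace (𝓡 n) m),
    (∀ i j, g.inner m (v i) (v j) = if i = j then 1 else 0) → |φ m v| ≤ 1

/-- The submanifold `f : X → M`, with orientation `o`, is calibrated by `φ`: `φ(T_x X) = 1` for the
oriented plane `T_x X`, that is, `φ` takes the value `1` on the positively oriented, and `-1` on the
negatively oriented orthonormal bases of `T_x X`. -/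
def IsCalibrated (g : Metric n M) (φ : KForm n k M) (o : KForm k k X) (f : X → M) : Prop :=
  ∀ (x : X) (u : Fin k → TangentSpace (𝓡 k) x),
    (∀ i j, inducedMetric g f x (u i) (u j) = if i = j then 1 else 0) →
      pullback φ f x u = Real.sign (o x u)

/-- For a vector field `V` along `f`, the linear map `u ↦ ∇_u V`, `T_x X → T_{f x} M`, for the
Levi-Civita connection of `g`; in the chart around `f x` it is `u ↦ ∂_u V + Γ(V, df(u))`. -/
def nablaVec (g : Metric n M) (f : X → M) (V : ∀ x, TangentSpace (𝓡 n) (f x)) (x : X) :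
    TangentSpace (𝓡 k) x →L[ℝ] TangentSpace (𝓡 n) (f x) :=
  chartInvDerivAt (f x) ∘L
    (vecDeriv n (fun x' => chartDeriv (f x) (f x') (V x')) x
      + christoffel g (f x) (extChartAt (𝓡 n) (f x) (f x)) (chartDeriv (f x) (f x) (V x)) ∘L
        chartDeriv (f x) (f x) ∘L mfderiv (𝓡 k) (𝓡 n) f x)

/-- For an immersion `f`, the map `T_{f x} M → T_x X` sending `w` to the vector `u` such that
`df(u)` is the orthogonal projection of `w` to `df(T_x X)`; it is determined by
`h(u, u') = g(w, df(u'))` for all `u'`, where `h` is the induced metric. -/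
def tangentPart (g : Metric n M) (f : X → M) (x : X) :
    TangentSpace (𝓡 n) (f x) →L[ℝ] TangentSpace (𝓡 k) x :=
  (inducedMetric g f x).inverse ∘L
    (pullBilin (g.inner (f x)) (.id ℝ _) (mfderiv (𝓡 k) (𝓡 n) f x))

/-- The orthogonal projection of `T_{f x} M` to the normal space of `f` at `x`. -/
def normalProj (g : Metric n M) (f : X → M) (x : X) :
    TangentSpace (𝓡 n) (f x) →L[ℝ] TangentSpace (𝓡 n) (f x) :=
  .id ℝ _ - (mfderiv (𝓡 k) (𝓡 n) f x) ∘L (tangentPart g f x)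

/-- `∇^⊥ V` at `x`, the linear map `u ↦ (∇_u V)^⊥` from `T_x X` to the normal space. -/
def nablaPerp (g : Metric n M) (f : X → M) (V : ∀ x, TangentSpace (𝓡 n) (f x)) (x : X) :
    TangentSpace (𝓡 k) x →L[ℝ] TangentSpace (𝓡 n) (f x) :=
  normalProj (k := k) g f x ∘L nablaVec (k := k) g f V x

/-- `‖∇^⊥ V‖² = ∑ j, |∇^⊥_{e_j} V|²` for an orthonormal basis `e_j` of `T_x X`. It is the trace of
the endomorphism `B^* B` of `T_x X`, where `B = ∇^⊥ V` and `h(B^* B u, u') = g(B u, B u')`. -/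
def nablaPerpNormSq (g : Metric n M) (f : X → M) (V : ∀ x, TangentSpace (𝓡 n) (f x)) (x : X) : ℝ :=
  LinearMap.trace ℝ (TangentSpace (𝓡 k) x)
    ((inducedMetric g f x).inverse ∘L
      (pullBilin (g.inner (f x)) (nablaPerp (k := k) g f V x) (nablaPerp (k := k) g f V x)) :
      TangentSpace (𝓡 k) x →L[ℝ] TangentSpace (𝓡 k) x)

/-- `∇^⊥ V` as a vector valued one-form on `T_{f x} M`, with value `∇^⊥_u V` on `df(u)` and `0` on
normal vectors. -/
def nablaPerpEnd (g : Metric n M) (f : X → M) (V : ∀ x, TangentSpace (𝓡 n) (f x)) (x : X) :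
    TangentSpace (𝓡 n) (f x) →L[ℝ] TangentSpace (𝓡 n) (f x) :=
  nablaPerp (k := k) g f V x ∘L tangentPart g f x

/-- The `k`-form
`‖∇^⊥V‖² dvol - ∇_V ∇_V φ - i_{∇^⊥V} i_{∇^⊥V} φ - 2 i_{∇^⊥V} ∇_V φ` on `X`.
The derivatives `∇_V` of `φ` at `f x` are taken along the curve `γ x`, which passes through `f x` with
velocity `V x` at time `0`. -/
def secondVariationForm (g : Metric n M) (φ : KForm n k M) (o : KForm k k X) (f : X → M)
    (V : ∀ x, TangentSpace (𝓡 n) (f x)) (γ : X → ℝ → M) : KForm k k X := fun x =>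
  nablaPerpNormSq (k := k) g f V x • volForm g o f x
    - (nablaNablaForm g φ (f x) (γ x)
        + insertion (nablaPerpEnd (k := k) g f V x) (insertion (nablaPerpEnd (k := k) g f V x) (φ (f x)))
        + (2 : ℝ) • insertion (nablaPerpEnd (k := k) g f V x)
            (nablaForm g φ (f x) (γ x))).compContinuousLinearMap
      (mfderiv (𝓡 k) (𝓡 n) f x)

/-- The velocity `∂F/∂t` at `t = 0` of a one-parameter family of maps. -/
def velocity (F : ℝ → X → M) (x : X) : TangentSpace (𝓡 n) (F 0 x) :=
  mfderiv 𝓘(ℝ, ℝ) (𝓡 n) (fun t => F t x) 0 (1 : ℝ)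

end Submanifold

/-! ## Integration of top degree forms -/

section Integration

variable {k : ℕ} {X : Type*} [TopologicalSpace X] [ChartedSpace (EuclideanSpace ℝ (Fin k)) X]
  [IsManifold (𝓡 k) ∞ X] [T2Space X] [SigmaCompactSpace X]

variable (k X) in
/-- A smooth partition of unity subordinate to the charts of `X`. -/
def partition : SmoothPartitionOfUnity X (𝓡 k) X univ :=
  (SmoothPartitionOfUnity.exists_isSubordinate_chartAt_source (𝓡 k) X).choose

/-- The coefficient of `ρ_c η` in the chart around `c`, with the sign of this chart relative to the
orientation `o`. -/
def chartIntegrand (o η : KForm k k X) (c : X) (y : EuclideanSpace ℝ (Fin k)) : ℝ :=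
  partition k X c ((extChartAt (𝓡 k) c).symm y) *
    (Real.sign (chartForm o c y (coordFrame k)) * chartForm η c y (coordFrame k))

/-- The part of `D ⊆ X` in the chart around `c`. -/
def chartDomain (D : Set X) (c : X) : Set (EuclideanSpace ℝ (Fin k)) :=
  (extChartAt (𝓡 k) c).target ∩ (extChartAt (𝓡 k) c).symm ⁻¹' D

/-- The integral of the top degree form `η` over `D ⊆ X`, for the orientation `o` of `X`. -/
def formIntegral (o η : KForm k k X) (D : Set X) : ℝ :=
  ∑ᶠ c : X, ∫ y in chartDomain D c, chartIntegrand o η c y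

/-- The integral of `η` over `D` is a finite sum of convergent integrals. -/
def FormIntegrableOn (o η : KForm k k X) (D : Set X) : Prop :=
  {c : X | ∃ x ∈ D, partition k X c x ≠ 0}.Finite ∧
    ∀ c : X, IntegrableOn (chartIntegrand o η c) (chartDomain D c)

/-- The energy `E = Vol - ∫ φ` of the part over `D` of the submanifold `f : X → M`. -/
def energy {n : ℕ} {M : Type*} [TopologicalSpace M] [ChartedSpace (EuclideanSpace ℝ (Fin n)) M]
    [IsManifold (𝓡 n) ∞ M] (g : Metric n M) (φ : KForm n k M) (o : KForm k k X) (D : Set X)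
    (f : X → M) : ℝ :=
  formIntegral o (volForm g o f) D - formIntegral o (pullback φ f) D

end Integration

end GenCal

end

open Set Filter MeasureTheory
open scoped Manifold ContDiff Topology

noncomputable section

namespace GenCal

/-! ## Gram matrices and comass -/

section GramMatrix

variable {k : ℕ} {W : Type*} [AddCommGroup W] [Module ℝ W]

/-! Read in a chart, the energy density is a function of a point `y` and a frame `v` of `k` vectors:
`defect`, the volume of the frame minus `σ φ_y(v)`, where `σ = ±1` is the orientation sign. The
comass bound makes it nonnegative for all frames, and it vanishes on the tangent frames of a
calibrated submanifold. Hence these frames are minima of `defect`: the gradient vanishes there and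
the Hessian is positive semidefinite. The vanishing gradient already gives `λ'(0) = 0`, since `1 -
λ` is the defect divided by the volume of the frame.

For the second derivative, a vanishing gradient means that only the velocity of the curve `(y(t),
v(t))` matters, not its acceleration. Moreover `defect` is homogeneous under changes of frame inside
a fixed plane (`defect_matrix`), so it stays zero when the frame moves within its span. Such motions
are null for the Hessian, and a null vector of a semidefinite form lies in its kernel. So the
velocity may be changed by tangential terms (`deriv_deriv_comp_eq_of_null`), and `dF_t(e_j)` may be
replaced by any frame with the same velocity modulo tangential vectors, along any curve with
velocity `V`.

The replacement is a model frame `w` with `w(0) = v`, `Dw/dt(0) = A v` and `D²w/dt²(0) = 0`, where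
`A = ∇^⊥V` (`exists_model_frame`). As `A v` is normal, the Gram matrix of `w` has zero first
derivative and second derivative `2 h(A v_i, A v_j)`, so the second derivative of the volume is
`‖∇^⊥V‖²` times the volume (`deriv_deriv_sqrt_det`). Two applications of the Leibniz rule to `φ(w)`
give `∇_V∇_Vφ + i_A i_A φ + 2 i_A ∇_Vφ` (`deriv_deriv_form_of_model`). The link with the family is
the equality of mixed derivatives: the covariant time derivative of `dF_t(e_j)` is `∇_{e_j}V`
(`nablaVec_chartFrame`).

The global statement follows with a partition of unity and differentiation under the integral over
compact sets in charts. -/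

theorem alternatingMap_apply_matrix (α : W [⋀^Fin k]→ₗ[ℝ] ℝ) (S : Matrix (Fin k) (Fin k) ℝ)
    (v : Fin k → W) : α (fun i => ∑ j, S i j • v j) = S.det * α v := by
  have h := (α.compLinearMap (Fintype.linearCombination ℝ v)).eq_smul_basis_det
    (Pi.basisFun ℝ (Fin k))
  have h1 := congrArg (fun β => β (fun i => S i)) h
  have h2 : (α.compLinearMap (Fintype.linearCombination ℝ v)) (Pi.basisFun ℝ (Fin k)) = α v := by
    simp [AlternatingMap.compLinearMap_apply]
  simp only [AlternatingMap.smul_apply, h2, Pi.basisFun_det_apply, smul_eq_mul] at h1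
  rw [mul_comm, show S.det = (Matrix.of fun i => S i).det from rfl, ← h1]
  rfl

variable [TopologicalSpace W]

/-- The Gram matrix of a frame. -/
def gram (B : W →L[ℝ] W →L[ℝ] ℝ) (v : Fin k → W) : Matrix (Fin k) (Fin k) ℝ :=
  Matrix.of fun i j => B (v i) (v j)

theorem gram_apply (B : W →L[ℝ] W →L[ℝ] ℝ) (v : Fin k → W) (i j : Fin k) :
    gram B v i j = B (v i) (v j) := rfl

theorem gram_matrix (B : W →L[ℝ] W →L[ℝ] ℝ) (S : Matrix (Fin k) (Fin k) ℝ) (v : Fin k → W) :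
    gram B (fun i => ∑ j, S i j • v j) = S * gram B v * S.transpose := by
  ext i j
  simp only [gram_apply, map_sum, map_smul, sum_apply, smul_apply, Matrix.mul_apply,
    Matrix.transpose_apply, smul_eq_mul, Finset.sum_mul]
  refine Finset.sum_congr rfl fun a _ => ?_
  rw [Finset.mul_sum]
  refine Finset.sum_congr rfl fun b _ => ?_
  ring

theorem dotProduct_gram_mulVec (B : W →L[ℝ] W →L[ℝ] ℝ) (v : Fin k → W) (x : Fin k → ℝ) :
    x ⬝ᵥ (gram B v).mulVec x = B (∑ i, x i • v i) (∑ i, x i • v i) := by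
  simp only [dotProduct, Matrix.mulVec, gram_apply, map_sum, map_smul, sum_apply, smul_apply,
    smul_eq_mul, Finset.mul_sum]
  rw [Finset.sum_comm]
  refine Finset.sum_congr rfl fun a _ => Finset.sum_congr rfl fun b _ => ?_
  ring

variable {B : W →L[ℝ] W →L[ℝ] ℝ}

theorem gram_isHermitian (hs : ∀ u v, B u v = B v u) (v : Fin k → W) :
    (gram B v).IsHermitian := by
  ext i j
  simp [gram_apply, hs (v i) (v j)]

theorem gram_posDef (hs : ∀ u v, B u v = B v u) (hp : ∀ u, u ≠ 0 → 0 < B u u) {v : Fin k → W}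
    (hv : LinearIndependent ℝ v) : (gram B v).PosDef := by
  refine .of_dotProduct_mulVec_pos (gram_isHermitian hs v) fun x hx => ?_
  rw [star_trivial, dotProduct_gram_mulVec]
  refine hp _ fun h0 => hx ?_
  funext i
  exact Fintype.linearIndependent_iff.1 hv x h0 i

-- The witness is the inverse of the positive square root of `G`. Its determinant is explicit and
-- positive, so passing to the orthonormal frame preserves orientation.
open scoped MatrixOrder in
theorem exists_orthonormalizing {G : Matrix (Fin k) (Fin k) ℝ} (hG : G.PosDef) :
    ∃ S : Matrix (Fin k) (Fin k) ℝ, S * G * S.transpose = 1 ∧ S.det = (Real.sqrt G.det)⁻¹ := by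
  set R := CFC.sqrt G with hR
  have hRR : R * R = G := CFC.sqrt_mul_sqrt_self G hG.posSemidef.nonneg
  have hRdet : R.det = Real.sqrt G.det := by
    rw [hR, hG.posSemidef.det_sqrt]
    simp
  have hRu : IsUnit R.det := by
    rw [hRdet]
    exact (Real.sqrt_pos.2 hG.det_pos).ne'.isUnit
  have hRT : R.transpose = R := by
    have := (Matrix.nonneg_iff_posSemidef.1 (CFC.sqrt_nonneg G)).isHermitian
    simpa [Matrix.IsHermitian, Matrix.conjTranspose_eq_transpose_of_trivial] using this
  refine ⟨R⁻¹, ?_, ?_⟩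
  · rw [Matrix.transpose_nonsing_inv, hRT, ← hRR, ← mul_assoc, Matrix.nonsing_inv_mul _ hRu,
      one_mul, Matrix.mul_nonsing_inv _ hRu]
  · rw [Matrix.det_nonsing_inv, hRdet, Ring.inverse_eq_inv']

/-- A single `u` serves all alternating forms at once, so that the calibration and the orientation
form can be compared on the same frame. -/
theorem exists_orthonormal_frame (hs : ∀ u v, B u v = B v u) (hp : ∀ u, u ≠ 0 → 0 < B u u)
    {v : Fin k → W} (hv : LinearIndependent ℝ v) :
    ∃ u : Fin k → W, (∀ i j, B (u i) (u j) = if i = j then 1 else 0) ∧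
      ∀ α : W [⋀^Fin k]→ₗ[ℝ] ℝ, α v = Real.sqrt (gram B v).det * α u := by
  have hG := gram_posDef hs hp hv
  obtain ⟨S, hS, hd⟩ := exists_orthonormalizing hG
  refine ⟨fun i => ∑ j, S i j • v j, fun i j => ?_, fun α => ?_⟩
  · have h := congrFun (congrFun (gram_matrix B S v) i) j
    rw [hS, Matrix.one_apply] at h
    exact h
  · rw [alternatingMap_apply_matrix, hd, mul_inv_cancel_left₀]
    exact (Real.sqrt_pos.2 hG.det_pos).ne'

/-- For independent `v` both sides scale by the same factor relative to an orthonormal frame; for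
dependent `v` the left side is zero. -/
theorem abs_le_sqrt_det_gram (hs : ∀ u v, B u v = B v u) (hp : ∀ u, u ≠ 0 → 0 < B u u)
    (α : W [⋀^Fin k]→ₗ[ℝ] ℝ)
    (hα : ∀ u : Fin k → W, (∀ i j, B (u i) (u j) = if i = j then 1 else 0) → |α u| ≤ 1)
    (v : Fin k → W) : |α v| ≤ Real.sqrt (gram B v).det := by
  by_cases hv : LinearIndependent ℝ v
  · obtain ⟨u, hu, h⟩ := exists_orthonormal_frame hs hp hv
    rw [h α, abs_mul, abs_of_nonneg (Real.sqrt_nonneg _)]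
    exact mul_le_of_le_one_right (Real.sqrt_nonneg _) (hα u hu)
  · rw [α.map_linearDependent v hv]
    simp

end GramMatrix

/-! ## Derivatives of determinants -/

section DetCalculus

variable {k : ℕ}

theorem contDiffAt_det {W : Type*} [NormedAddCommGroup W] [NormedSpace ℝ W] {m : WithTop ℕ∞}
    {G : W → Matrix (Fin k) (Fin k) ℝ} {p : W}
    (h : ∀ i j, ContDiffAt ℝ m (fun q => G q i j) p) : ContDiffAt ℝ m (fun q => (G q).det) p := by
  simp only [Matrix.det_apply, Units.smul_def, zsmul_eq_mul]
  exact ContDiffAt.sum fun σ _ => contDiffAt_const.mul (contDiffAt_prod fun i _ => h _ _)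

theorem continuousAt_adjugate {W : Type*} [TopologicalSpace W]
    {G : W → Matrix (Fin k) (Fin k) ℝ} {p : W}
    (h : ∀ i j, ContinuousAt (fun q => G q i j) p) (i j : Fin k) :
    ContinuousAt (fun q => (G q).adjugate i j) p := by
  have hG : ContinuousAt G p := continuousAt_pi.2 fun i => continuousAt_pi.2 fun j => h i j
  have hc : Continuous fun A : Matrix (Fin k) (Fin k) ℝ => A.adjugate i j :=
    (continuous_id.matrix_adjugate).matrix_elem i j
  exact ContinuousAt.comp (g := fun A : Matrix (Fin k) (Fin k) ℝ => A.adjugate i j)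
    hc.continuousAt hG

/-- Jacobi's formula. The Leibniz rule on the permutation expansion, regrouped by the differentiated
column, is a sum of determinants with one column replaced by its derivative; Cramer's rule turns it
into the trace. -/
theorem hasDerivAt_det {G : ℝ → Matrix (Fin k) (Fin k) ℝ} {G' : Matrix (Fin k) (Fin k) ℝ} {t : ℝ}
    (h : ∀ i j, HasDerivAt (fun s => G s i j) (G' i j) t) :
    HasDerivAt (fun s => (G s).det) ((G t).adjugate * G').trace t := by
  simp only [Matrix.det_apply, Units.smul_def, zsmul_eq_mul]
  have h1 : ∀ σ : Equiv.Perm (Fin k), HasDerivAt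
      (fun s => ((Equiv.Perm.sign σ : ℤ) : ℝ) * ∏ i, G s (σ i) i)
      (((Equiv.Perm.sign σ : ℤ) : ℝ) *
        ∑ i, (∏ j ∈ Finset.univ.erase i, G t (σ j) j) • G' (σ i) i) t := fun σ =>
    (HasDerivAt.fun_finsetProd fun i _ => h (σ i) i).const_mul _
  refine (HasDerivAt.fun_sum fun σ _ => h1 σ).congr_deriv ?_
  have h2 : ((G t).adjugate * G').trace
      = ∑ i, ((G t).updateCol i (fun a => G' a i)).det := by
    refine Finset.sum_congr rfl fun i _ => ?_
    rw [← Matrix.cramer_apply, Matrix.cramer_eq_adjugate_mulVec]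
    rfl
  rw [h2]
  simp only [Matrix.det_apply, Units.smul_def, zsmul_eq_mul]
  rw [Finset.sum_comm]
  refine Finset.sum_congr rfl fun σ _ => ?_
  rw [Finset.mul_sum]
  refine Finset.sum_congr rfl fun i _ => ?_
  rw [← Finset.prod_erase_mul Finset.univ _ (Finset.mem_univ i), smul_eq_mul,
    Matrix.updateCol_self]
  congr 2
  refine Finset.prod_congr rfl fun j hj => ?_
  rw [Matrix.updateCol_ne (Finset.ne_of_mem_erase hj)]

/-- Since `b` vanishes at `t`, the slope of the product is `a` times the slope of `b`. Continuity of
`a` is therefore enough, and the adjugate below never has to be differentiated. -/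
theorem hasDerivAt_mul_of_eq_zero {a b : ℝ → ℝ} {b' t : ℝ} (ha : ContinuousAt a t)
    (hb : HasDerivAt b b' t) (h0 : b t = 0) : HasDerivAt (fun s => a s * b s) (a t * b') t := by
  rw [hasDerivAt_iff_tendsto_slope] at hb ⊢
  have h : slope (fun s => a s * b s) t = fun s => a s * slope b t s := by
    funext s
    simp only [slope_def_field, h0]
    ring
  rw [h]
  exact (ha.tendsto.mono_left nhdsWithin_le_nhds).mul hb

/-- By Jacobi's formula the first derivative is linear in `G'` with continuous coefficients. As `G'`
vanishes at `t₀`, only the terms in `G''` survive a second differentiation. -/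
theorem deriv_deriv_sqrt_det {G G' : ℝ → Matrix (Fin k) (Fin k) ℝ} {G'' : Matrix (Fin k) (Fin k) ℝ}
    {t₀ : ℝ} (h : ∀ᶠ t in 𝓝 t₀, ∀ i j, HasDerivAt (fun s => G s i j) (G' t i j) t)
    (h0 : ∀ i j, G' t₀ i j = 0) (h2 : ∀ i j, HasDerivAt (fun t => G' t i j) (G'' i j) t₀)
    (hpos : 0 < (G t₀).det) :
    deriv (deriv fun t => Real.sqrt (G t).det) t₀
      = 1 / 2 * Real.sqrt (G t₀).det * ((G t₀)⁻¹ * G'').trace := by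
  have hcont : ∀ i j, ContinuousAt (fun s => G s i j) t₀ := fun i j =>
    (h.self_of_nhds i j).continuousAt
  have hdet : ContinuousAt (fun s => (G s).det) t₀ := (hasDerivAt_det h.self_of_nhds).continuousAt
  have h1 : deriv (fun t => Real.sqrt (G t).det) =ᶠ[𝓝 t₀] fun t =>
      ∑ i, ∑ j, ((G t).adjugate i j / (2 * Real.sqrt (G t).det)) * G' t j i := by
    filter_upwards [h, hdet.eventually (lt_mem_nhds hpos)] with t ht htpos
    rw [((hasDerivAt_det ht).sqrt htpos.ne').deriv]
    simp only [Matrix.trace, Matrix.diag, Matrix.mul_apply, Finset.sum_div]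
    exact Finset.sum_congr rfl fun i _ => Finset.sum_congr rfl fun j _ => by ring
  rw [h1.deriv_eq]
  have hs : Real.sqrt (G t₀).det ≠ 0 := (Real.sqrt_pos.2 hpos).ne'
  have h3 := HasDerivAt.fun_sum (u := Finset.univ) fun i _ => HasDerivAt.fun_sum (u := Finset.univ)
    fun j _ => hasDerivAt_mul_of_eq_zero
      (a := fun t => (G t).adjugate i j / (2 * Real.sqrt (G t).det)) (b := fun t => G' t j i)
      ((continuousAt_adjugate hcont i j).div
        (continuousAt_const.mul (Real.continuous_sqrt.continuousAt.comp hdet))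
        (mul_ne_zero two_ne_zero hs)) (h2 j i) (h0 j i)
  rw [h3.deriv, Matrix.inv_def, Ring.inverse_eq_inv']
  simp only [Matrix.trace, Matrix.diag, Matrix.mul_apply, Matrix.smul_apply, smul_eq_mul,
    Finset.mul_sum]
  refine Finset.sum_congr rfl fun i _ => Finset.sum_congr rfl fun j _ => ?_
  have hsq : (G t₀).det = Real.sqrt (G t₀).det * Real.sqrt (G t₀).det :=
    (Real.mul_self_sqrt hpos.le).symm
  generalize Real.sqrt (G t₀).det = r at *
  rw [hsq]
  field_simp

end DetCalculus

/-! ## Hessians at minima -/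

section Hessian

variable {W : Type*} [NormedAddCommGroup W] [NormedSpace ℝ W]

/-- The acceleration of the curve enters the second-order chain rule only through the gradient,
which vanishes. -/
theorem deriv_deriv_comp_of_fderiv_eq_zero {Φ : W → ℝ} {c : ℝ → W}
    (hΦ : ContDiffAt ℝ 2 Φ (c 0)) (hc : ContDiffAt ℝ 2 c 0) (h0 : fderiv ℝ Φ (c 0) = 0) :
    deriv (deriv fun t => Φ (c t)) 0
      = fderiv ℝ (fderiv ℝ Φ) (c 0) (deriv c 0) (deriv c 0) := by
  have e1 : ∀ᶠ t in 𝓝 (0 : ℝ), DifferentiableAt ℝ c t :=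
    (hc.eventually (by simp)).mono fun t ht => ht.differentiableAt (by simp)
  have e2 : ∀ᶠ t in 𝓝 (0 : ℝ), DifferentiableAt ℝ Φ (c t) :=
    hc.continuousAt.eventually
      ((hΦ.eventually (by simp)).mono fun t ht => ht.differentiableAt (by simp))
  have h1 : deriv (fun t => Φ (c t)) =ᶠ[𝓝 0] fun t => fderiv ℝ Φ (c t) (deriv c t) := by
    filter_upwards [e1, e2] with t h1 h2
    exact (h2.hasFDerivAt.comp_hasDerivAt t h1.hasDerivAt).deriv
  rw [h1.deriv_eq]
  have h2 : DifferentiableAt ℝ (fderiv ℝ Φ) (c 0) :=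
    (hΦ.fderiv_right (m := 1) (by norm_num)).differentiableAt (by simp)
  have h3 : DifferentiableAt ℝ (deriv c) 0 := by
    have := (hc.fderiv_right (m := 1) (by norm_num)).differentiableAt (by simp)
    exact this.clm_apply (differentiableAt_const (1 : ℝ))
  have h4 := (h2.hasFDerivAt.comp_hasDerivAt (0 : ℝ) e1.self_of_nhds.hasDerivAt).clm_apply
    h3.hasDerivAt
  have h5 := h4.deriv
  simp only [Function.comp_def, h0, zero_apply, add_zero] at h5
  exact h5

/-- A negative second derivative would make the point a local maximum as well, hence `f` locally
constant with second derivative zero. -/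
theorem deriv_deriv_nonneg_of_isLocalMin {f : ℝ → ℝ} {t : ℝ} (h : IsLocalMin f t)
    (hc : ContinuousAt f t) : 0 ≤ deriv (deriv f) t := by
  by_contra! hneg
  have hmax := isLocalMax_of_deriv_deriv_neg hneg h.deriv_eq_zero hc
  have hconst : f =ᶠ[𝓝 t] fun _ => f t := by
    filter_upwards [h, hmax] with s h1 h2 using le_antisymm h2 h1
  have h1 : deriv f =ᶠ[𝓝 t] fun _ => 0 := by
    filter_upwards [hconst.deriv] with s hs
    simpa using hs
  rw [h1.deriv_eq] at hneg
  simp at hneg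

theorem fderiv_fderiv_nonneg_of_isLocalMin {Φ : W → ℝ} {p : W} (hΦ : ContDiffAt ℝ 2 Φ p)
    (hmin : IsLocalMin Φ p) (ξ : W) : 0 ≤ fderiv ℝ (fderiv ℝ Φ) p ξ ξ := by
  have hc : ContDiff ℝ 2 fun t : ℝ => p + t • ξ := by fun_prop
  have hd : deriv (fun t : ℝ => p + t • ξ) 0 = ξ := by
    have : HasDerivAt (fun t : ℝ => p + t • ξ) ((1 : ℝ) • ξ) 0 :=
      ((hasDerivAt_id (0 : ℝ)).smul_const ξ).const_add p
    rw [this.deriv, one_smul]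
  have h1 := deriv_deriv_comp_of_fderiv_eq_zero (Φ := Φ) (c := fun t : ℝ => p + t • ξ)
    (by simpa using hΦ) hc.contDiffAt (by simpa using hmin.fderiv_eq_zero)
  rw [hd] at h1
  simp only [zero_smul, add_zero] at h1
  rw [← h1]
  have hcont : ContinuousAt (fun t : ℝ => p + t • ξ) 0 := hc.continuous.continuousAt
  have htend : Tendsto (fun t : ℝ => p + t • ξ) (𝓝 0) (𝓝 p) := by
    simpa [ContinuousAt] using hcont
  refine deriv_deriv_nonneg_of_isLocalMin ?_ ?_
  · have := htend.eventually hmin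
    simpa [IsLocalMin, IsMinFilter] using this
  · exact ContinuousAt.comp (g := Φ) (by simpa using hΦ.continuousAt) hcont

/-- At a local minimum the second derivative along a curve does not change when the velocity
changes by a null direction of the Hessian. -/
theorem deriv_deriv_comp_eq_of_null {Φ : W → ℝ} {p : W} (hΦ : ContDiffAt ℝ 2 Φ p)
    (hmin : IsLocalMin Φ p) {c₁ c₂ c₃ : ℝ → W} (h₁ : ContDiffAt ℝ 2 c₁ 0)
    (h₂ : ContDiffAt ℝ 2 c₂ 0) (h₃ : ContDiffAt ℝ 2 c₃ 0) (p₁ : c₁ 0 = p) (p₂ : c₂ 0 = p)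
    (p₃ : c₃ 0 = p) (hd : deriv c₁ 0 = deriv c₂ 0 + deriv c₃ 0)
    (hconst : ∀ᶠ t in 𝓝 0, Φ (c₃ t) = Φ p) :
    deriv (deriv fun t => Φ (c₁ t)) 0 = deriv (deriv fun t => Φ (c₂ t)) 0 := by
  have hf := hmin.fderiv_eq_zero
  have hsymm : IsSymmSndFDerivAt ℝ Φ p := hΦ.isSymmSndFDerivAt (by simp)
  have e₃ := deriv_deriv_comp_of_fderiv_eq_zero (p₃ ▸ hΦ) h₃ (p₃ ▸ hf)
  rw [deriv_deriv_comp_of_fderiv_eq_zero (p₁ ▸ hΦ) h₁ (p₁ ▸ hf),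
    deriv_deriv_comp_of_fderiv_eq_zero (p₂ ▸ hΦ) h₂ (p₂ ▸ hf), p₁, p₂, hd]
  -- `Φ` is constant along `c₃`, so the Hessian vanishes on its velocity `τ`.
  have hz : deriv (deriv fun t => Φ (c₃ t)) 0 = 0 := by
    have h1 : deriv (fun t => Φ (c₃ t)) =ᶠ[𝓝 0] fun _ => 0 := by
      have : (fun t => Φ (c₃ t)) =ᶠ[𝓝 0] fun _ => Φ p := hconst
      filter_upwards [this.deriv] with s hs
      simpa using hs
    rw [h1.deriv_eq]
    simp
  rw [hz, p₃] at e₃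
  set H := fderiv ℝ (fderiv ℝ Φ) p
  set ξ := deriv c₂ 0
  set τ := deriv c₃ 0
  have hpsd := fderiv_fderiv_nonneg_of_isLocalMin hΦ hmin
  have hcross : H ξ τ = 0 := by
    by_contra hne
    -- If the mixed term were nonzero, this `s` would give the Hessian the value `-1` on `ξ + s τ`,
    -- because `H τ τ = 0`.
    obtain ⟨s, hs⟩ : ∃ s : ℝ, s * H ξ τ = -(H ξ ξ + 1) / 2 :=
      ⟨-(H ξ ξ + 1) / 2 / H ξ τ, div_mul_cancel₀ _ hne⟩
    have h1 := hpsd (ξ + s • τ)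
    have h2 : H τ ξ = H ξ τ := hsymm.eq τ ξ
    simp only [map_add, map_smul, add_apply, smul_apply, smul_eq_mul] at h1
    change 0 ≤ H ξ ξ + _ * H τ ξ + _ * (H ξ τ + _ * H τ τ) at h1
    rw [h2, ← e₃, mul_add, hs] at h1
    linarith
  have h2 : H τ ξ = H ξ τ := hsymm.eq τ ξ
  simp only [map_add, add_apply]
  rw [h2, ← e₃, hcross]
  ring

end Hessian

/-! ## Calculus of alternating forms and bilinear forms on a vector space -/

section FormCalculus

variable {k : ℕ} {E : Type*} [NormedAddCommGroup E] [NormedSpace ℝ E]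

/-- `i_A α` is the derivative at the identity, in the direction `A`, of the pullback of `α` by an
endomorphism. This exhibits it as a continuous bilinear expression, hence differentiable in both
arguments. -/
theorem insertion_eq_fderivComp (A : E →L[ℝ] E) (α : E [⋀^Fin k]→L[ℝ] ℝ) :
    insertion A α = ContinuousAlternatingMap.fderivCompContinuousLinearMapCLM ℝ
      (ContinuousLinearMap.id ℝ E) α A := by
  ext v
  rw [insertion_apply, ContinuousAlternatingMap.fderivCompContinuousLinearMapCLM_apply,
    ContinuousAlternatingMap.fderivCompContinuousLinearMap_apply]
  refine Finset.sum_congr rfl fun j _ => ?_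
  rw [update_id_apply]

theorem differentiableAt_insertion {Γ : ℝ → E →L[ℝ] E} {α : ℝ → E [⋀^Fin k]→L[ℝ] ℝ} {t : ℝ}
    (hΓ : DifferentiableAt ℝ Γ t) (hα : DifferentiableAt ℝ α t) :
    DifferentiableAt ℝ (fun s => insertion (Γ s) (α s)) t := by
  simp only [insertion_eq_fderivComp]
  exact (((ContinuousAlternatingMap.fderivCompContinuousLinearMapCLM ℝ
    (ContinuousLinearMap.id ℝ E)).differentiableAt).comp t hα).clm_apply hΓ

/-- Leibniz rule for a covariant derivative. Any endomorphism `Γ` may serve as connection, since its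
contributions to the form and to the vectors cancel. -/
theorem hasDerivAt_form_apply {α : ℝ → E [⋀^Fin k]→L[ℝ] ℝ} {α' : E [⋀^Fin k]→L[ℝ] ℝ}
    {w : ℝ → Fin k → E} {w' : Fin k → E} {t : ℝ} (hα : HasDerivAt α α' t)
    (hw : ∀ j, HasDerivAt (fun s => w s j) (w' j) t) (Γ : E →L[ℝ] E) :
    HasDerivAt (fun s => α s (w s))
      ((α' - insertion Γ (α t)) (w t) + ∑ j, α t (Function.update (w t) j (w' j + Γ (w t j))))
      t := by
  have h := (hα.hasFDerivAt.continuousAlternatingMap_apply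
    (g := fun i s => w s i) fun i => (hw i).hasFDerivAt).hasDerivAt
  refine h.congr_deriv ?_
  simp [insertion_apply, Finset.sum_add_distrib]

/-- Expansion in a basis writes the value as a polynomial in the coordinates of the vectors whose
coefficients are the values of the form on fixed vectors. -/
theorem contDiffAt_form_apply [FiniteDimensional ℝ E] {W : Type*} [NormedAddCommGroup W]
    [NormedSpace ℝ W] {m : WithTop ℕ∞} {α : W → E [⋀^Fin k]→L[ℝ] ℝ} {v : W → Fin k → E} {p : W}
    (hα : ContDiffAt ℝ m α p) (hv : ∀ j, ContDiffAt ℝ m (fun q => v q j) p) :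
    ContDiffAt ℝ m (fun q => α q (v q)) p := by
  let b := Module.finBasis ℝ E
  have h : (fun q => α q (v q)) = fun q => ∑ r : Fin k → Fin (Module.finrank ℝ E),
      (∏ i, b.coord (r i) (v q i)) * α q (fun i => b (r i)) := by
    funext q
    have h1 : v q = fun i => ∑ j, b.repr (v q i) j • b j := by
      funext i
      exact (b.sum_repr _).symm
    conv_lhs => rw [h1]
    have h2 := (α q).toMultilinearMap.map_sum
      (fun i (j : Fin (Module.finrank ℝ E)) => b.repr (v q i) j • b j)
    refine h2.trans (Finset.sum_congr rfl fun r _ => ?_)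
    exact (α q).toMultilinearMap.map_smul_univ _ _
  rw [h]
  refine ContDiffAt.sum fun r _ => (contDiffAt_prod fun i _ => ?_).mul ?_
  · exact (LinearMap.toContinuousLinearMap (b.coord (r i))).contDiff.contDiffAt.comp p (hv i)
  · exact (ContinuousAlternatingMap.apply ℝ E ℝ
      (fun i => b (r i))).contDiff.contDiffAt.comp p hα

theorem contDiffAt_det_gram {W : Type*} [NormedAddCommGroup W]
    [NormedSpace ℝ W] {m : WithTop ℕ∞} {h : W → E →L[ℝ] E →L[ℝ] ℝ} {v : W → Fin k → E} {p : W}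
    (hh : ContDiffAt ℝ m h p) (hv : ∀ j, ContDiffAt ℝ m (fun q => v q j) p) :
    ContDiffAt ℝ m (fun q => (gram (h q) (v q)).det) p :=
  contDiffAt_det fun i j => (hh.clm_apply (hv i)).clm_apply (hv j)

end FormCalculus

/-! ### Inverting positive bilinear forms -/

section Inverse

variable {E : Type*} [NormedAddCommGroup E] [NormedSpace ℝ E] [FiniteDimensional ℝ E]

/-- Positivity gives injectivity, and the dual has the same finite dimension. This ensures that
`inverse` is a true inverse and not its default value zero. -/
theorem exists_equiv_of_pos {B : E →L[ℝ] E →L[ℝ] ℝ} (hp : ∀ u, u ≠ 0 → 0 < B u u) :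
    ∃ e : E ≃L[ℝ] (E →L[ℝ] ℝ), (e : E →L[ℝ] (E →L[ℝ] ℝ)) = B := by
  have hinj : Function.Injective (B : E →ₗ[ℝ] (E →L[ℝ] ℝ)) := by
    rw [injective_iff_map_eq_zero]
    intro u hu
    by_contra hne
    have h1 := hp u hne
    have h2 : B u = 0 := hu
    simp [h2] at h1
  have hfin : Module.finrank ℝ E = Module.finrank ℝ (E →L[ℝ] ℝ) := by
    rw [← (LinearMap.toContinuousLinearMap (𝕜 := ℝ) (E := E) (F' := ℝ)).finrank_eq]
    exact Subspace.dual_finrank_eq.symm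
  let e := LinearEquiv.ofInjectiveOfFinrankEq (B : E →ₗ[ℝ] (E →L[ℝ] ℝ)) hinj hfin
  refine ⟨e.toContinuousLinearEquiv, ?_⟩
  ext u v
  rfl

theorem apply_inverse_of_pos {B : E →L[ℝ] E →L[ℝ] ℝ} (hp : ∀ u, u ≠ 0 → 0 < B u u)
    (f : E →L[ℝ] ℝ) : B (B.inverse f) = f := by
  obtain ⟨e, rfl⟩ := exists_equiv_of_pos hp
  simp

theorem inverse_apply_of_pos {B : E →L[ℝ] E →L[ℝ] ℝ} (hp : ∀ u, u ≠ 0 → 0 < B u u)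
    (u : E) : B.inverse (B u) = u := by
  obtain ⟨e, rfl⟩ := exists_equiv_of_pos hp
  simp

theorem contDiffAt_inverse_of_pos {W : Type*} [NormedAddCommGroup W] [NormedSpace ℝ W]
    {m : WithTop ℕ∞} {h : W → E →L[ℝ] E →L[ℝ] ℝ} {p : W} (hp : ∀ u, u ≠ 0 → 0 < h p u u)
    (hh : ContDiffAt ℝ m h p) : ContDiffAt ℝ m (fun q => (h q).inverse) p := by
  obtain ⟨e, he⟩ := exists_equiv_of_pos hp
  exact ContDiffAt.comp p (g := ContinuousLinearMap.inverse) (he ▸ contDiffAt_map_inverse e) hh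

end Inverse

/-! ## The Levi-Civita connection of a metric on a vector space -/

section LeviCivita

variable {E : Type*} [NormedAddCommGroup E] [NormedSpace ℝ E]

theorem fderiv_symm {h : E → E →L[ℝ] E →L[ℝ] ℝ} {y : E}
    (hs : ∀ᶠ z in 𝓝 y, ∀ u v, h z u v = h z v u) (hd : DifferentiableAt ℝ h y) (u v w : E) :
    fderiv ℝ h y u v w = fderiv ℝ h y u w v := by
  have h1 : ∀ v w, HasFDerivAt (fun z => h z v w) _ y := fun v w =>
    (hd.hasFDerivAt.clm_apply (hasFDerivAt_const v y)).clm_apply (hasFDerivAt_const w y)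
  have h2 : (fun z => h z v w) =ᶠ[𝓝 y] fun z => h z w v := hs.mono fun z hz => hz v w
  have h3 := (h1 v w).unique ((h1 w v).congr_of_eventuallyEq h2)
  simpa using congrArg (fun L => L u) h3

variable [FiniteDimensional ℝ E]

/-- The Christoffel symbols of a metric on an open subset of a vector space. -/
def leviCivita (h : E → E →L[ℝ] E →L[ℝ] ℝ) (y u : E) : E →L[ℝ] E :=
  (h y).inverse ∘L ((1 / 2 : ℝ) • (fderiv ℝ h y u + (fderiv ℝ h y).flip u
      - ((fderiv ℝ h y).flip u).flip))

theorem leviCivita_apply {h : E → E →L[ℝ] E →L[ℝ] ℝ} {y : E} (hp : ∀ u, u ≠ 0 → 0 < h y u u)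
    (u v w : E) : h y (leviCivita h y u v) w
      = 1 / 2 * (fderiv ℝ h y u v w + fderiv ℝ h y v u w - fderiv ℝ h y w u v) := by
  rw [leviCivita, ContinuousLinearMap.comp_apply, apply_inverse_of_pos hp]
  simp

/-- Adding the two Koszul expressions cancels the derivatives in the directions `v` and `w`. -/
theorem leviCivita_compat {h : E → E →L[ℝ] E →L[ℝ] ℝ} {y : E}
    (hp : ∀ u, u ≠ 0 → 0 < h y u u) (hs : ∀ᶠ z in 𝓝 y, ∀ u v, h z u v = h z v u)
    (hd : DifferentiableAt ℝ h y) (u v w : E) :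
    h y (leviCivita h y u v) w + h y v (leviCivita h y u w) = fderiv ℝ h y u v w := by
  rw [hs.self_of_nhds v, leviCivita_apply hp, leviCivita_apply hp,
    fderiv_symm hs hd u w v, fderiv_symm hs hd w u v, fderiv_symm hs hd v u w]
  ring

set_option maxSynthPendingDepth 4 in
theorem hasDerivAt_metric_apply {h : E → E →L[ℝ] E →L[ℝ] ℝ} {y : ℝ → E} {y' : E} {t : ℝ}
    (hp : ∀ u, u ≠ 0 → 0 < h (y t) u u) (hs : ∀ᶠ z in 𝓝 (y t), ∀ u v, h z u v = h z v u)
    (hd : DifferentiableAt ℝ h (y t)) (hy : HasDerivAt y y' t) {v w : ℝ → E} {v' w' : E}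
    (hv : HasDerivAt v v' t) (hw : HasDerivAt w w' t) :
    HasDerivAt (fun s => h (y s) (v s) (w s))
      (h (y t) (v' + leviCivita h (y t) y' (v t)) (w t)
        + h (y t) (v t) (w' + leviCivita h (y t) y' (w t))) t := by
  have h0 : HasDerivAt (fun s => h (y s)) (fderiv ℝ h (y t) y') t :=
    hd.hasFDerivAt.comp_hasDerivAt t hy
  have h1 := (h0.clm_apply hv).clm_apply hw
  refine h1.congr_deriv ?_
  have h2 := leviCivita_compat hp hs hd y' (v t) (w t)
  simp only [map_add, add_apply]
  linarith

set_option maxSynthPendingDepth 4 in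
theorem contDiffAt_leviCivita {W : Type*} [NormedAddCommGroup W] [NormedSpace ℝ W]
    {h : E → E →L[ℝ] E →L[ℝ] ℝ} {y u : W → E} {q : W}
    (hp : ∀ u, u ≠ 0 → 0 < h (y q) u u) (hh : ContDiffAt ℝ ∞ h (y q)) (hy : ContDiffAt ℝ ∞ y q)
    (hu : ContDiffAt ℝ ∞ u q) : ContDiffAt ℝ ∞ (fun p => leviCivita h (y p) (u p)) q := by
  have h1 : ContDiffAt ℝ ∞ (fun p => (h (y p)).inverse) q :=
    (contDiffAt_inverse_of_pos hp hh).comp q hy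
  have h2 : ContDiffAt ℝ ∞ (fun p => fderiv ℝ h (y p)) q :=
    (hh.fderiv_right (m := ∞) (by simp)).comp q hy
  have hfl1 : ContDiffAt ℝ ∞ (fun p => (fderiv ℝ h (y p)).flip) q :=
    (ContinuousLinearMap.flipₗᵢ ℝ E E (E →L[ℝ] ℝ)).contDiff.contDiffAt.comp q h2
  have hfl2 : ContDiffAt ℝ ∞ (fun p => ((fderiv ℝ h (y p)).flip (u p)).flip) q :=
    (ContinuousLinearMap.flipₗᵢ ℝ E E ℝ).contDiff.contDiffAt.comp q (hfl1.clm_apply hu)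
  exact h1.clm_comp ((((h2.clm_apply hu).add (hfl1.clm_apply hu)).sub hfl2).const_smul _)

end LeviCivita

/-! ## Frames along a curve with prescribed covariant derivatives -/

section ModelFrame

variable {k : ℕ} {E : Type*} [NormedAddCommGroup E] [NormedSpace ℝ E]

/-- There is a frame `w` along a curve with `w(0) = v`, `Dw/dt(0) = A v` and `D²w/dt²(0) = 0`,
where `D/dt = d/dt + Γ(t)`. -/
theorem exists_model_frame {Γ : ℝ → E →L[ℝ] E} (hΓ : DifferentiableAt ℝ Γ 0) (A : E →L[ℝ] E)
    (v : Fin k → E) : ∃ w w' : ℝ → Fin k → E, (∀ t j, HasDerivAt (fun s => w s j) (w' t j) t) ∧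
      (∀ j, ContDiff ℝ ∞ fun s => w s j) ∧ w 0 = v ∧ (∀ j, w' 0 j + Γ 0 (v j) = A (v j)) ∧
      ∀ j, HasDerivAt (fun t => w' t j + Γ t (w t j)) (-(Γ 0 (A (v j)))) 0 := by
  -- A quadratic curve suffices: the velocity `b` is forced by `Dw/dt(0) = A v`, and the
  -- acceleration `c` by the vanishing of the second covariant derivative.
  let b : Fin k → E := fun j => A (v j) - Γ 0 (v j)
  let c : Fin k → E := fun j => -(Γ 0 (A (v j))) - (deriv Γ 0 (v j) + Γ 0 (b j))
  have hw : ∀ t j, HasDerivAt (fun s : ℝ => v j + s • b j + (s ^ 2 / 2) • c j)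
      (b j + t • c j) t := by
    intro t j
    have h1 : HasDerivAt (fun s : ℝ => s • b j) ((1 : ℝ) • b j) t := (hasDerivAt_id t).smul_const _
    have h2 : HasDerivAt (fun s : ℝ => (s ^ 2 / 2) • c j) (t • c j) t := by
      have h3 : HasDerivAt (fun s : ℝ => s ^ 2 / 2) t t := by
        have := (hasDerivAt_pow 2 t).div_const 2
        simpa using this
      exact h3.smul_const _
    have h4 := (h1.const_add (v j)).add h2
    rw [one_smul] at h4
    exact h4
  refine ⟨fun t j => v j + t • b j + (t ^ 2 / 2) • c j, fun t j => b j + t • c j, hw,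
    ?_, ?_, ?_, ?_⟩
  · intro j
    fun_prop
  · funext j
    simp
  · intro j
    simp [b]
  · intro j
    have h1 : HasDerivAt (fun t : ℝ => b j + t • c j) ((1 : ℝ) • c j) 0 :=
      ((hasDerivAt_id (0 : ℝ)).smul_const _).const_add _
    have h2 := h1.add (hΓ.hasDerivAt.clm_apply (hw 0 j))
    refine h2.congr_deriv ?_
    simp [c]

/-- Each of the two differentiations acts covariantly either on the form or on a vector. Both on the
form give the second covariant derivative, one on each gives a mixed term twice, and both on vectors
in different slots give `i_A i_A`; on the same slot they give the second covariant derivative of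
`w`, which is zero. -/
theorem deriv_deriv_form_of_model {α : ℝ → E [⋀^Fin k]→L[ℝ] ℝ} {Γ : ℝ → E →L[ℝ] E}
    (hα : ContDiffAt ℝ 2 α 0) (hΓ : DifferentiableAt ℝ Γ 0) {A : E →L[ℝ] E} {v : Fin k → E}
    (hA : ∀ j, A (A (v j)) = 0) {w w' : ℝ → Fin k → E}
    (hw : ∀ t j, HasDerivAt (fun s => w s j) (w' t j) t) (h0 : w 0 = v)
    (h1 : ∀ j, w' 0 j + Γ 0 (v j) = A (v j))
    (h2 : ∀ j, HasDerivAt (fun t => w' t j + Γ t (w t j)) (-(Γ 0 (A (v j)))) 0)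
    {Dα : ℝ → E [⋀^Fin k]→L[ℝ] ℝ} (hD : ∀ t, Dα t = deriv α t - insertion (Γ t) (α t)) :
    deriv (deriv fun t => α t (w t)) 0
      = (deriv Dα 0 - insertion (Γ 0) (Dα 0)) v + insertion A (insertion A (α 0)) v
        + 2 * insertion A (Dα 0) v := by
  have e1 : ∀ᶠ t in 𝓝 (0 : ℝ), HasDerivAt α (deriv α t) t :=
    (hα.eventually (by simp)).mono fun t ht => (ht.differentiableAt (by simp)).hasDerivAt
  have e2 : deriv (fun t => α t (w t)) =ᶠ[𝓝 0] fun t => Dα t (w t)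
      + ∑ j, α t (Function.update (w t) j (w' t j + Γ t (w t j))) := by
    filter_upwards [e1] with t ht
    rw [(hasDerivAt_form_apply ht (hw t) (Γ t)).deriv, hD]
  have hα1 := e1.self_of_nhds
  have hDα : HasDerivAt Dα (deriv Dα 0) 0 := by
    rw [funext hD]
    have h3 : DifferentiableAt ℝ (deriv α) 0 :=
      ((hα.fderiv_right (m := 1) (by norm_num)).differentiableAt (by simp)).clm_apply
        (differentiableAt_const (1 : ℝ))
    exact (h3.sub (differentiableAt_insertion hΓ hα1.differentiableAt)).hasDerivAt
  have h3 := hasDerivAt_form_apply hDα (hw 0) (Γ 0)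
  have h4 : ∀ j, HasDerivAt (fun t => α t (Function.update (w t) j (w' t j + Γ t (w t j))))
      (Dα 0 (Function.update v j (A (v j)))
        + ∑ i, α 0 (Function.update (Function.update v j (A (v j))) i
            (A (Function.update v j (A (v j)) i)))) 0 := by
    intro j
    have h5 : ∀ i, HasDerivAt (fun t => Function.update (w t) j (w' t j + Γ t (w t j)) i)
        (Function.update (w' 0) j (-(Γ 0 (A (v j)))) i) 0 := by
      intro i
      by_cases hij : i = j
      · subst hij
        simpa using h2 i
      · simpa [hij] using hw 0 i
    have h6 := hasDerivAt_form_apply hα1 h5 (Γ 0)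
    simp only [h0, h1, ← hD] at h6
    refine h6.congr_deriv ?_
    congr 1
    refine Finset.sum_congr rfl fun i _ => ?_
    congr 2
    -- In the slot `j` itself the second covariant derivative of `w` is zero, while `i_A i_A`
    -- contributes `A (A v_j)`; the two agree because `A ∘ A` vanishes on the frame.
    by_cases hij : i = j
    · subst hij
      simp [hA]
    · simp [hij, h1]
  rw [e2.deriv_eq, (h3.fun_add (HasDerivAt.fun_sum (u := Finset.univ) fun j _ => h4 j)).deriv]
  simp only [h0, h1, insertion_apply, Finset.sum_add_distrib]
  ring

end ModelFrame

/-! ## Second variation of the calibration defect in a chart -/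

section Defect

variable {k : ℕ} {E : Type*} [NormedAddCommGroup E] [NormedSpace ℝ E]

/-- The difference of the volume and `σ α` on frames. -/
def defect (h : E → E →L[ℝ] E →L[ℝ] ℝ) (α : E → E [⋀^Fin k]→L[ℝ] ℝ) (σ : ℝ)
    (p : E × (Fin k → E)) : ℝ :=
  Real.sqrt (gram (h p.1) p.2).det - σ * α p.1 p.2

/-- The covariant derivative of a form along a curve, for the Levi-Civita connection of `h`. -/
def covD (h : E → E →L[ℝ] E →L[ℝ] ℝ) (y : ℝ → E) (β : ℝ → E [⋀^Fin k]→L[ℝ] ℝ) (t : ℝ) :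
    E [⋀^Fin k]→L[ℝ] ℝ :=
  deriv β t - insertion (leviCivita h (y t) (deriv y t)) (β t)

theorem deriv_deriv_sub_const_mul {f₁ f₂ : ℝ → ℝ} {σ t : ℝ} (h₁ : ContDiffAt ℝ 2 f₁ t)
    (h₂ : ContDiffAt ℝ 2 f₂ t) : deriv (deriv fun s => f₁ s - σ * f₂ s) t
      = deriv (deriv f₁) t - σ * deriv (deriv f₂) t := by
  have e : ∀ {f : ℝ → ℝ}, ContDiffAt ℝ 2 f t → ∀ᶠ s in 𝓝 t, DifferentiableAt ℝ f s := fun hf =>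
    (hf.eventually (by simp)).mono fun s hs => hs.differentiableAt (by simp)
  have e' : ∀ {f : ℝ → ℝ}, ContDiffAt ℝ 2 f t → DifferentiableAt ℝ (deriv f) t := fun hf =>
    ((hf.fderiv_right (m := 1) (by norm_num)).differentiableAt (by simp)).clm_apply
      (differentiableAt_const (1 : ℝ))
  have h3 : deriv (fun s => f₁ s - σ * f₂ s) =ᶠ[𝓝 t] fun s => deriv f₁ s - σ * deriv f₂ s := by
    filter_upwards [e h₁, e h₂] with s hs₁ hs₂
    exact (hs₁.hasDerivAt.sub (hs₂.hasDerivAt.const_mul σ)).deriv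
  rw [h3.deriv_eq]
  exact ((e' h₁).hasDerivAt.sub ((e' h₂).hasDerivAt.const_mul σ)).deriv

theorem contDiffAt_defect [FiniteDimensional ℝ E] {h : E → E →L[ℝ] E →L[ℝ] ℝ}
    {α : E → E [⋀^Fin k]→L[ℝ] ℝ} {σ : ℝ} {W : Type*} [NormedAddCommGroup W] [NormedSpace ℝ W]
    {m : WithTop ℕ∞} {y : W → E} {v : W → Fin k → E} {q : W}
    (hh : ContDiffAt ℝ m h (y q)) (hα : ContDiffAt ℝ m α (y q)) (hy : ContDiffAt ℝ m y q)
    (hv : ∀ j, ContDiffAt ℝ m (fun p => v p j) q) (hpos : 0 < (gram (h (y q)) (v q)).det) :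
    ContDiffAt ℝ m (fun p => defect h α σ (y p, v p)) q :=
  ((contDiffAt_det_gram (hh.comp q hy) hv).sqrt hpos.ne').sub
    (contDiffAt_const.mul (contDiffAt_form_apply (hα.comp q hy) hv))

/-- Volume and form both scale by `S.det` when it is nonnegative. This is the source of the null
directions of the Hessian. -/
theorem defect_matrix {h : E → E →L[ℝ] E →L[ℝ] ℝ} {α : E → E [⋀^Fin k]→L[ℝ] ℝ} {σ : ℝ} {y : E}
    {S : Matrix (Fin k) (Fin k) ℝ} (hS : 0 ≤ S.det) (v : Fin k → E) :
    defect h α σ (y, fun i => ∑ j, S i j • v j) = S.det * defect h α σ (y, v) := by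
  have h1 : α y (fun i => ∑ j, S i j • v j) = S.det * α y v :=
    alternatingMap_apply_matrix (α y).toAlternatingMap S v
  simp only [defect, gram_matrix, Matrix.det_mul, Matrix.det_transpose, h1]
  rw [show S.det * (gram (h y) v).det * S.det = S.det ^ 2 * (gram (h y) v).det by ring,
    Real.sqrt_mul (sq_nonneg _), Real.sqrt_sq hS]
  ring

variable [FiniteDimensional ℝ E]

theorem exists_model_curve {h : E → E →L[ℝ] E →L[ℝ] ℝ} {α : E → E [⋀^Fin k]→L[ℝ] ℝ} {y : ℝ → E}
    (hh : ContDiffAt ℝ ∞ h (y 0)) (hα : ContDiffAt ℝ ∞ α (y 0)) (hy : ContDiffAt ℝ ∞ y 0)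
    (hs : ∀ᶠ z in 𝓝 (y 0), ∀ u v, h z u v = h z v u)
    (hp : ∀ᶠ z in 𝓝 (y 0), ∀ u, u ≠ 0 → 0 < h z u u)
    {A : E →L[ℝ] E} {v : Fin k → E} (hv : LinearIndependent ℝ v) (hA : ∀ j, A (A (v j)) = 0)
    (hN : ∀ i j, h (y 0) (A (v i)) (v j) = 0) (σ : ℝ) :
    ∃ w : ℝ → Fin k → E, (∀ j, ContDiff ℝ ∞ fun s => w s j) ∧ w 0 = v ∧
      (∀ j, HasDerivAt (fun s => w s j)
        (A (v j) - leviCivita h (y 0) (deriv y 0) (v j)) 0) ∧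
      deriv (deriv fun t => defect h α σ (y t, w t)) 0
        = Real.sqrt (gram (h (y 0)) v).det *
            ((gram (h (y 0)) v)⁻¹ * gram (h (y 0)) (fun j => A (v j))).trace
          - σ * (covD h y (covD h y fun t => α (y t)) 0 v + insertion A (insertion A (α (y 0))) v
              + 2 * insertion A (covD h y (fun t => α (y t)) 0) v) := by
  let Γ : ℝ → E →L[ℝ] E := fun t => leviCivita h (y t) (deriv y t)
  have hy' : ContDiffAt ℝ ∞ (deriv y) 0 :=
    (hy.fderiv_right (m := ∞) (by simp)).clm_apply contDiffAt_const
  have hΓ : DifferentiableAt ℝ Γ 0 :=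
    (contDiffAt_leviCivita hp.self_of_nhds hh hy hy').differentiableAt (by simp)
  obtain ⟨w, w', hw, hwc, h0, h1, h2⟩ := exists_model_frame hΓ A v
  have hpos : 0 < (gram (h (y 0)) v).det :=
    (gram_posDef hs.self_of_nhds hp.self_of_nhds hv).det_pos
  have hαy : ContDiffAt ℝ ∞ (fun t => α (y t)) 0 := hα.comp 0 hy
  refine ⟨w, hwc, h0, fun j => (hw 0 j).congr_deriv (eq_sub_of_add_eq (h1 j)), ?_⟩
  have hf₁ : ContDiffAt ℝ 2 (fun t => Real.sqrt (gram (h (y t)) (w t)).det) 0 :=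
    ((contDiffAt_det_gram (hh.comp 0 hy) fun j => (hwc j).contDiffAt).sqrt
      (by rw [h0]; exact hpos.ne')).of_le ENat.LEInfty.out
  have hf₂ : ContDiffAt ℝ 2 (fun t => α (y t) (w t)) 0 :=
    (contDiffAt_form_apply hαy fun j => (hwc j).contDiffAt).of_le ENat.LEInfty.out
  have e1 : deriv (deriv fun t => defect h α σ (y t, w t)) 0
      = deriv (deriv fun t => Real.sqrt (gram (h (y t)) (w t)).det) 0
        - σ * deriv (deriv fun t => α (y t) (w t)) 0 := deriv_deriv_sub_const_mul hf₁ hf₂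
  rw [e1]
  congr 1
  · have hnear : ∀ᶠ t in 𝓝 (0 : ℝ), HasDerivAt y (deriv y t) t ∧ DifferentiableAt ℝ h (y t) ∧
        (∀ u, u ≠ 0 → 0 < h (y t) u u) ∧ ∀ᶠ z in 𝓝 (y t), ∀ u v, h z u v = h z v u := by
      have a1 := (hy.of_le (show (1 : WithTop ℕ∞) ≤ ∞ by exact_mod_cast le_top)).eventually
        (by simp)
      have a2 := hy.continuousAt.eventually ((hh.of_le
        (show (1 : WithTop ℕ∞) ≤ ∞ by exact_mod_cast le_top)).eventually (by simp))
      have a3 := hy.continuousAt.eventually hp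
      have a4 := hy.continuousAt.eventually (eventually_eventually_nhds.2 hs)
      filter_upwards [a1, a2, a3, a4] with t b1 b2 b3 b4
      exact ⟨(b1.differentiableAt (by simp)).hasDerivAt, b2.differentiableAt (by simp), b3, b4⟩
    have hG' : ∀ᶠ t in 𝓝 (0 : ℝ), ∀ i j, HasDerivAt (fun s => gram (h (y s)) (w s) i j)
        ((Matrix.of fun i j => h (y t) (w' t i + Γ t (w t i)) (w t j)
          + h (y t) (w t i) (w' t j + Γ t (w t j)) : Matrix (Fin k) (Fin k) ℝ) i j) t := by
      filter_upwards [hnear] with t ht i j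
      exact hasDerivAt_metric_apply ht.2.2.1 ht.2.2.2 ht.2.1 ht.1 (hw t i) (hw t j)
    have hN' : ∀ i j, h (y 0) (v i) (A (v j)) = 0 := fun i j => by
      rw [hs.self_of_nhds]; exact hN j i
    have ht := hnear.self_of_nhds
    -- With vanishing second covariant derivative of `w`, only the products of first derivatives
    -- remain; each of the two summands contributes `h(A v_i, A v_j)`.
    have hG'' : ∀ i j, HasDerivAt (fun t => (Matrix.of fun i j =>
        h (y t) (w' t i + Γ t (w t i)) (w t j) + h (y t) (w t i) (w' t j + Γ t (w t j)) :
          Matrix (Fin k) (Fin k) ℝ) i j)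
        (((2 : ℝ) • gram (h (y 0)) (fun j => A (v j))) i j) 0 := by
      intro i j
      have b1 := hasDerivAt_metric_apply ht.2.2.1 ht.2.2.2 ht.2.1 ht.1 (h2 i) (hw 0 j)
      have b2 := hasDerivAt_metric_apply ht.2.2.1 ht.2.2.2 ht.2.1 ht.1 (hw 0 i) (h2 j)
      refine (b1.add b2).congr_deriv ?_
      have c1 : ∀ j, leviCivita h (y 0) (deriv y 0) (A (v j)) = Γ 0 (A (v j)) := fun _ => rfl
      have c2 : ∀ j, leviCivita h (y 0) (deriv y 0) (v j) = Γ 0 (v j) := fun _ => rfl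
      simp only [h0, h1, c1, c2, neg_add_cancel, map_zero, zero_apply, Matrix.smul_apply,
        gram_apply, smul_eq_mul]
      ring
    have h3 := deriv_deriv_sqrt_det hG' (fun i j => by
      simp only [Matrix.of_apply, h0, h1, hN, hN', add_zero]) hG'' (by rw [h0]; exact hpos)
    rw [h3, h0, Matrix.mul_smul, Matrix.trace_smul, smul_eq_mul]
    ring
  · congr 1
    exact deriv_deriv_form_of_model (hαy.of_le ENat.LEInfty.out) hΓ hA hw h0 h1 h2
      (Dα := covD h y fun t => α (y t)) (fun t => rfl)

/-- Second variation formula for the calibration defect along a curve of frames. -/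
theorem deriv_deriv_defect {h : E → E →L[ℝ] E →L[ℝ] ℝ} {α : E → E [⋀^Fin k]→L[ℝ] ℝ} {y : ℝ → E}
    (hh : ContDiffAt ℝ ∞ h (y 0)) (hα : ContDiffAt ℝ ∞ α (y 0)) (hy : ContDiffAt ℝ ∞ y 0)
    (hs : ∀ᶠ z in 𝓝 (y 0), ∀ u v, h z u v = h z v u)
    (hp : ∀ᶠ z in 𝓝 (y 0), ∀ u, u ≠ 0 → 0 < h z u u)
    {A : E →L[ℝ] E} {v : Fin k → E} (hv : LinearIndependent ℝ v) (hA : ∀ j, A (A (v j)) = 0)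
    (hN : ∀ i j, h (y 0) (A (v i)) (v j) = 0) (σ : ℝ)
    (hmin : ∀ᶠ p in 𝓝 (y 0, v), 0 ≤ defect h α σ p) (hzero : defect h α σ (y 0, v) = 0)
    {Y : ℝ → E} {U : ℝ → Fin k → E} (hY : ContDiffAt ℝ ∞ Y 0)
    (hU : ∀ j, ContDiffAt ℝ ∞ (fun t => U t j) 0) (hY0 : Y 0 = y 0) (hU0 : U 0 = v)
    (hY' : deriv Y 0 = deriv y 0) (S : Matrix (Fin k) (Fin k) ℝ)
    (hU' : ∀ j, deriv (fun t => U t j) 0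
      = A (v j) - leviCivita h (y 0) (deriv y 0) (v j) + ∑ i, S j i • v i) :
    deriv (deriv fun t => defect h α σ (Y t, U t)) 0
      = Real.sqrt (gram (h (y 0)) v).det *
          ((gram (h (y 0)) v)⁻¹ * gram (h (y 0)) (fun j => A (v j))).trace
        - σ * (covD h y (covD h y fun t => α (y t)) 0 v + insertion A (insertion A (α (y 0))) v
            + 2 * insertion A (covD h y (fun t => α (y t)) 0) v) := by
  obtain ⟨w, hwc, h0, hw', hmodel⟩ := exists_model_curve hh hα hy hs hp hv hA hN σ
  rw [← hmodel]
  have hpos : 0 < (gram (h (y 0)) v).det :=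
    (gram_posDef hs.self_of_nhds hp.self_of_nhds hv).det_pos
  have h2 : (2 : WithTop ℕ∞) ≤ ∞ := ENat.LEInfty.out
  have hΦ : ContDiffAt ℝ 2 (defect h α σ) (y 0, v) :=
    (contDiffAt_defect (q := (y 0, v)) (y := Prod.fst) (v := Prod.snd) hh hα contDiffAt_fst
      (fun j => (contDiff_apply ℝ E j).contDiffAt.comp _ contDiffAt_snd) hpos).of_le h2
  -- The point is fixed and the frame moves inside its span as `(1 + t S) v`. For small `t` the
  -- determinant of `1 + t S` is positive, so the defect stays zero along `z`.
  let z : ℝ → E × (Fin k → E) := fun t => (y 0, fun j => v j + t • ∑ i, S j i • v i)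
  have hz : HasDerivAt z (0, fun j => ∑ i, S j i • v i) 0 := by
    refine (hasDerivAt_const 0 (y 0)).prodMk (hasDerivAt_pi.2 fun j => ?_)
    have : HasDerivAt (fun t : ℝ => t • ∑ i, S j i • v i) ((1 : ℝ) • ∑ i, S j i • v i) 0 :=
      (hasDerivAt_id (0 : ℝ)).smul_const _
    rw [one_smul] at this
    exact this.const_add _
  have hzc : ContDiff ℝ 2 z :=
    contDiff_const.prodMk (contDiff_pi.2 fun j => contDiff_const.add
      (contDiff_id.smul contDiff_const))
  have hc1 : HasDerivAt (fun t => (Y t, U t)) (deriv Y 0, fun j => deriv (fun t => U t j) 0) 0 :=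
    ((hY.differentiableAt (by simp)).hasDerivAt).prodMk (hasDerivAt_pi.2 fun j =>
      ((hU j).differentiableAt (by simp)).hasDerivAt)
  have hc2 : HasDerivAt (fun t => (y t, w t)) (deriv y 0, fun j =>
      A (v j) - leviCivita h (y 0) (deriv y 0) (v j)) 0 :=
    ((hy.differentiableAt (by simp)).hasDerivAt).prodMk (hasDerivAt_pi.2 hw')
  refine deriv_deriv_comp_eq_of_null (c₁ := fun t => (Y t, U t)) (c₂ := fun t => (y t, w t))
    (c₃ := z) hΦ ?_ ?_ ?_ hzc.contDiffAt ?_ ?_ ?_ ?_ ?_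
  · exact hmin.mono fun p hp => by rw [hzero]; exact hp
  · exact (hY.prodMk (contDiffAt_pi.2 hU)).of_le h2
  · exact (hy.prodMk (contDiffAt_pi.2 fun j => (hwc j).contDiffAt)).of_le h2
  · simp [hY0, hU0]
  · simp [h0]
  · simp [z]
  · rw [hc1.deriv, hc2.deriv, hz.deriv]
    simp only [hU', hY', Prod.mk_add_mk, add_zero, Prod.mk.injEq, true_and]
    rfl
  · have hdet : ContinuousAt (fun t : ℝ => (1 + t • S).det) 0 := by
      have : Continuous fun t : ℝ => (1 + t • S).det :=
        (continuous_const.add (continuous_id.smul continuous_const)).matrix_det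
      exact this.continuousAt
    have hev := hdet.eventually (lt_mem_nhds (show (0 : ℝ) < _ by simp))
    filter_upwards [hev] with t ht
    have : z t = (y 0, fun i => ∑ j, (1 + t • S) i j • v j) := by
      simp only [z]
      congr 1
      funext i
      simp [add_smul, Finset.sum_add_distrib, Matrix.one_apply, Finset.smul_sum, smul_smul]
    rw [this, defect_matrix ht.le, hzero, mul_zero]

end Defect

/-! ## Metrics and forms in charts -/

section ChartExpressions

variable {n k : ℕ} {M : Type*} [TopologicalSpace M] [ChartedSpace (EuclideanSpace ℝ (Fin n)) M]

local notation "𝔼" => EuclideanSpace ℝ (Fin n)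

theorem contDiffAt_chartForm {φ : KForm n k M} (hφ : IsSmoothForm φ) (c : M) {y : 𝔼}
    (hy : y ∈ (extChartAt (𝓡 n) c).target) : ContDiffAt ℝ ∞ (chartForm φ c) y :=
  (hφ c).contDiffAt ((isOpen_extChartAt_target c).mem_nhds hy)

variable [IsManifold (𝓡 n) ∞ M]

theorem isManifold_one : IsManifold (𝓡 n) 1 M := IsManifold.of_le (n := ∞) ENat.LEInfty.out

theorem chartDeriv_comp_chartInvDeriv (c : M) {y : 𝔼} (hy : y ∈ (extChartAt (𝓡 n) c).target) :
    chartDeriv c ((extChartAt (𝓡 n) c).symm y) ∘L chartInvDeriv c y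
      = ContinuousLinearMap.id ℝ 𝔼 := by
  have := isManifold_one (n := n) (M := M)
  have h := mfderiv_extChartAt_comp_mfderivWithin_extChartAt_symm (I := 𝓡 n) hy
  simp only [ModelWithCorners.range_eq_univ, mfderivWithin_univ] at h
  exact h

theorem chartInvDeriv_comp_chartDeriv (c : M) {y : 𝔼} (hy : y ∈ (extChartAt (𝓡 n) c).target) :
    chartInvDeriv c y ∘L chartDeriv c ((extChartAt (𝓡 n) c).symm y)
      = ContinuousLinearMap.id ℝ _ := by
  have := isManifold_one (n := n) (M := M)
  have h := mfderivWithin_extChartAt_symm_comp_mfderiv_extChartAt (I := 𝓡 n) hy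
  simp only [ModelWithCorners.range_eq_univ, mfderivWithin_univ] at h
  exact h

theorem chartDeriv_chartInvDeriv (c : M) {y : 𝔼} (hy : y ∈ (extChartAt (𝓡 n) c).target) (u : 𝔼) :
    chartDeriv c ((extChartAt (𝓡 n) c).symm y) (chartInvDeriv c y u) = u :=
  congrArg (fun L : 𝔼 →L[ℝ] 𝔼 => L u) (chartDeriv_comp_chartInvDeriv c hy)

theorem chartInvDeriv_chartDeriv (c : M) {y : 𝔼} (hy : y ∈ (extChartAt (𝓡 n) c).target)
    (u : TangentSpace (𝓡 n) ((extChartAt (𝓡 n) c).symm y)) :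
    chartInvDeriv c y (chartDeriv c ((extChartAt (𝓡 n) c).symm y) u) = u :=
  congrArg (fun L : TangentSpace (𝓡 n) ((extChartAt (𝓡 n) c).symm y) →L[ℝ]
    TangentSpace (𝓡 n) ((extChartAt (𝓡 n) c).symm y) => L u) (chartInvDeriv_comp_chartDeriv c hy)

theorem chartInvDeriv_injective (c : M) {y : 𝔼} (hy : y ∈ (extChartAt (𝓡 n) c).target) :
    Function.Injective (chartInvDeriv c y) :=
  Function.LeftInverse.injective (chartDeriv_chartInvDeriv c hy)

/-- The tangent space at `m` is the model space read in the preferred chart at `m`, so this chart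
has the identity as derivative there. Coordinate formulas in the chart around `m` thus apply at `m`
without conversion. -/
theorem chartDeriv_self (m : M) (u : TangentSpace (𝓡 n) m) : chartDeriv m m u = u := by
  have := isManifold_one (n := n) (M := M)
  have h := mfderiv_extChartAt_self (I := 𝓡 n) (x := m)
  exact congrArg (fun L : 𝔼 →L[ℝ] 𝔼 => L u) h

theorem chartInvDerivAt_apply (m : M) (u : 𝔼) : chartInvDerivAt m u = u := by
  have := isManifold_one (n := n) (M := M)
  have h := mfderiv_extChartAt_comp_mfderivWithin_extChartAt_symm' (I := 𝓡 n)
    (mem_extChartAt_source (I := 𝓡 n) m)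
  simp only [ModelWithCorners.range_eq_univ, mfderivWithin_univ] at h
  have h1 := congrArg (fun L : 𝔼 →L[ℝ] 𝔼 => L u) h
  exact (chartDeriv_self m (chartInvDerivAt m u)).symm.trans h1

theorem inner_eq_chartMetric (g : Metric n M) (c : M) {m : M}
    (hm : m ∈ (extChartAt (𝓡 n) c).source) (u v : TangentSpace (𝓡 n) m) :
    g.inner m u v
      = chartMetric g c (extChartAt (𝓡 n) c m) (chartDeriv c m u) (chartDeriv c m v) := by
  obtain ⟨y, hy, rfl⟩ : ∃ y ∈ (extChartAt (𝓡 n) c).target, (extChartAt (𝓡 n) c).symm y = m :=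
    ⟨_, (extChartAt (𝓡 n) c).map_source hm, (extChartAt (𝓡 n) c).left_inv hm⟩
  rw [(extChartAt (𝓡 n) c).right_inv hy]
  change _ = g.inner _ (chartInvDeriv c y (chartDeriv c _ u)) (chartInvDeriv c y (chartDeriv c _ v))
  rw [chartInvDeriv_chartDeriv c hy, chartInvDeriv_chartDeriv c hy]

theorem form_eq_chartForm (φ : KForm n k M) (c : M) {m : M}
    (hm : m ∈ (extChartAt (𝓡 n) c).source) (v : Fin k → TangentSpace (𝓡 n) m) :
    φ m v = chartForm φ c (extChartAt (𝓡 n) c m) (fun j => chartDeriv c m (v j)) := by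
  obtain ⟨y, hy, rfl⟩ : ∃ y ∈ (extChartAt (𝓡 n) c).target, (extChartAt (𝓡 n) c).symm y = m :=
    ⟨_, (extChartAt (𝓡 n) c).map_source hm, (extChartAt (𝓡 n) c).left_inv hm⟩
  rw [(extChartAt (𝓡 n) c).right_inv hy]
  change _ = φ _ fun j => chartInvDeriv c y (chartDeriv c _ (v j))
  simp only [chartInvDeriv_chartDeriv c hy]

theorem chartMetric_symm (g : Metric n M) (c : M) (y u v : 𝔼) :
    chartMetric g c y u v = chartMetric g c y v u := g.symm _ _ _

theorem chartMetric_pos (g : Metric n M) (c : M) {y : 𝔼} (hy : y ∈ (extChartAt (𝓡 n) c).target)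
    (u : 𝔼) (hu : u ≠ 0) : 0 < chartMetric g c y u u :=
  g.pos _ _ fun h => hu (chartInvDeriv_injective c hy (h.trans (map_zero _).symm))

/-- A coordinate vector field is constant in the trivialization given by the chart, hence smooth. -/
theorem contMDiffAt_chartInvDeriv_section (c : M) {m : M} (hm : m ∈ (extChartAt (𝓡 n) c).source)
    (u : 𝔼) : ContMDiffAt (𝓡 n) ((𝓡 n).prod 𝓘(ℝ, 𝔼)) ∞
      (fun m : M => (Bundle.TotalSpace.mk' 𝔼 m
        ((trivializationAt 𝔼 (TangentSpace (𝓡 n)) c).symm m u) : TangentBundle (𝓡 n) M)) m := by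
  have hb : m ∈ (trivializationAt 𝔼 (TangentSpace (𝓡 n) (M := M)) c).baseSet := by
    simpa using hm
  rw [(trivializationAt 𝔼 (TangentSpace (𝓡 n)) c).contMDiffAt_section_iff hb]
  refine (contMDiffAt_const (c := u)).congr_of_eventuallyEq ?_
  filter_upwards [(trivializationAt 𝔼 (TangentSpace (𝓡 n)) c).open_baseSet.mem_nhds hb] with z hz
  rw [Bundle.Trivialization.apply_mk_symm _ hz]

theorem chartInvDeriv_eq_symm (c : M) {y : 𝔼} (hy : y ∈ (extChartAt (𝓡 n) c).target) (u : 𝔼) :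
    chartInvDeriv c y u = (trivializationAt 𝔼 (TangentSpace (𝓡 n)) c).symm
      ((extChartAt (𝓡 n) c).symm y) u := by
  have := isManifold_one (n := n) (M := M)
  have hs : (extChartAt (𝓡 n) c).symm y ∈ (chartAt 𝔼 c).source := by
    rw [← extChartAt_source (𝓡 n)]
    exact (extChartAt (𝓡 n) c).map_target hy
  have h := TangentBundle.symmL_trivializationAt (I := 𝓡 n) hs
  simp only [ModelWithCorners.range_eq_univ, mfderivWithin_univ] at h
  have h1 : ∀ z, z = y → (mfderiv 𝓘(ℝ, 𝔼) (𝓡 n) (extChartAt (𝓡 n) c).symm z : 𝔼 →L[ℝ] 𝔼) u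
      = (chartInvDeriv c y : 𝔼 →L[ℝ] 𝔼) u := by
    rintro z rfl
    rfl
  exact (h1 _ ((extChartAt (𝓡 n) c).right_inv hy)).symm.trans
    ((congrArg (fun L : 𝔼 →L[ℝ] 𝔼 => L u) h).symm.trans
      (Bundle.Trivialization.symmL_apply _ (by simpa using hs) u))

/-- The coefficients are the smooth metric evaluated on coordinate vector fields, composed with the
inverse chart. -/
theorem contDiffOn_chartMetric (g : Metric n M) (c : M) :
    ContDiffOn ℝ ∞ (chartMetric g c) (extChartAt (𝓡 n) c).target := by
  rw [contDiffOn_clm_apply]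
  intro u
  rw [contDiffOn_clm_apply]
  intro v
  have hsec : ∀ m ∈ (extChartAt (𝓡 n) c).source, ContMDiffAt (𝓡 n) 𝓘(ℝ, ℝ) ∞ (fun m : M =>
      g.inner m ((trivializationAt 𝔼 (TangentSpace (𝓡 n)) c).symm m u)
        ((trivializationAt 𝔼 (TangentSpace (𝓡 n)) c).symm m v)) m := by
    intro m hm
    have : ContMDiffAt (𝓡 n) ((𝓡 n).prod 𝓘(ℝ, ℝ)) ∞ (fun m : M =>
        Bundle.TotalSpace.mk' ℝ (E := Bundle.Trivial M ℝ) m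
          (g.inner m ((trivializationAt 𝔼 (TangentSpace (𝓡 n)) c).symm m u)
            ((trivializationAt 𝔼 (TangentSpace (𝓡 n)) c).symm m v))) m := by
      apply ContMDiffAt.clm_bundle_apply₂ (F₁ := 𝔼) (F₂ := 𝔼)
      · exact g.contMDiff.contMDiffAt
      · exact contMDiffAt_chartInvDeriv_section c hm u
      · exact contMDiffAt_chartInvDeriv_section c hm v
    rw [Bundle.contMDiffAt_totalSpace] at this
    exact this.2
  intro y hy
  have h1 := hsec _ ((extChartAt (𝓡 n) c).map_target hy)
  have h2 := (contMDiffOn_extChartAt_symm (I := 𝓡 n) (n := ∞) c).contMDiffAt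
    ((isOpen_extChartAt_target c).mem_nhds hy)
  have h3 := (h1.comp y h2).contDiffAt
  refine (h3.congr_of_eventuallyEq ?_).contDiffWithinAt
  filter_upwards [(isOpen_extChartAt_target c).mem_nhds hy] with z hz
  simp only [Function.comp_apply]
  rw [← chartInvDeriv_eq_symm c hz, ← chartInvDeriv_eq_symm c hz]
  rfl

theorem contDiffAt_chartMetric (g : Metric n M) (c : M) {y : 𝔼}
    (hy : y ∈ (extChartAt (𝓡 n) c).target) : ContDiffAt ℝ ∞ (chartMetric g c) y :=
  (contDiffOn_chartMetric g c).contDiffAt ((isOpen_extChartAt_target c).mem_nhds hy)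

theorem abs_form_le {g : Metric n M} {φ : KForm n k M} (hφ : IsGeneralizedCalibration g φ) (m : M)
    (v : Fin k → TangentSpace (𝓡 n) m) : |φ m v| ≤ Real.sqrt (gram (g.inner m) v).det :=
  abs_le_sqrt_det_gram (g.symm m) (g.pos m) (φ m).toAlternatingMap (hφ.2 m) v

/-- The comass bound is applied to the images of the vectors under `chartInvDeriv`, which may be
dependent; so no condition on `p` is needed. -/
theorem defect_chart_nonneg {g : Metric n M} {φ : KForm n k M}
    (hφ : IsGeneralizedCalibration g φ) (c : M) {σ : ℝ} (hσ : |σ| = 1) (p : 𝔼 × (Fin k → 𝔼)) :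
    0 ≤ defect (chartMetric g c) (chartForm φ c) σ p := by
  have h := abs_form_le hφ _ (fun j => chartInvDeriv c p.1 (p.2 j))
  have h1 : σ * chartForm φ c p.1 p.2 ≤ Real.sqrt (gram (chartMetric g c p.1) p.2).det :=
    (le_abs_self _).trans (by rw [abs_mul, hσ, one_mul]; exact h)
  exact sub_nonneg.2 h1

end ChartExpressions

/-! ## Families of maps in charts -/

section Families

variable {n k : ℕ} {M : Type*} [TopologicalSpace M] [ChartedSpace (EuclideanSpace ℝ (Fin n)) M]
  {X : Type*} [TopologicalSpace X] [ChartedSpace (EuclideanSpace ℝ (Fin k)) X]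

local notation "𝔼" => EuclideanSpace ℝ (Fin n)
local notation "𝕂" => EuclideanSpace ℝ (Fin k)

variable (n) in
/-- The expression of a family of maps in the charts around `m` and `c`. -/
def famChart (F : ℝ → X → M) (m : M) (c : X) (p : ℝ × 𝕂) : 𝔼 :=
  extChartAt (𝓡 n) m (F p.1 ((extChartAt (𝓡 k) c).symm p.2))

/-- The coordinate frame of the chart around `c`. -/
def chartFrame (c : X) (y : 𝕂) (j : Fin k) : TangentSpace (𝓡 k) ((extChartAt (𝓡 k) c).symm y) :=
  chartInvDeriv c y (coordFrame k j)

variable (n) in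
/-- The point `(t, y)` of a chart of `ℝ × X` is mapped to the chart domain around `m`, and `F` is
smooth near it. -/
structure InFamChart (F : ℝ → X → M) (m : M) (c : X) (p : ℝ × 𝕂) : Prop where
  mem_target : p.2 ∈ (extChartAt (𝓡 k) c).target
  mem_source : F p.1 ((extChartAt (𝓡 k) c).symm p.2) ∈ (extChartAt (𝓡 n) m).source
  eventually_smooth : ∀ᶠ z in 𝓝 (p.1, (extChartAt (𝓡 k) c).symm p.2),
    ContMDiffAt (𝓘(ℝ, ℝ).prod (𝓡 k)) (𝓡 n) ∞ (fun q : ℝ × X => F q.1 q.2) z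

variable {F : ℝ → X → M} {m : M} {c : X} {p : ℝ × EuclideanSpace ℝ (Fin k)}

theorem InFamChart.mdifferentiableAt (h : InFamChart n F m c p) :
    MDifferentiableAt (𝓡 k) (𝓡 n) (F p.1) ((extChartAt (𝓡 k) c).symm p.2) := by
  have h1 : ContMDiffAt (𝓡 k) (𝓘(ℝ, ℝ).prod (𝓡 k)) ∞ (fun x : X => (p.1, x))
      ((extChartAt (𝓡 k) c).symm p.2) := contMDiffAt_const.prodMk contMDiffAt_id
  exact (ContMDiffAt.comp (g := fun q : ℝ × X => F q.1 q.2) _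
    h.eventually_smooth.self_of_nhds h1).mdifferentiableAt (by simp)

theorem InFamChart.mdifferentiableAt_time (h : InFamChart n F m c p) :
    MDifferentiableAt 𝓘(ℝ, ℝ) (𝓡 n) (fun t => F t ((extChartAt (𝓡 k) c).symm p.2)) p.1 := by
  have h1 : ContMDiffAt 𝓘(ℝ, ℝ) (𝓘(ℝ, ℝ).prod (𝓡 k)) ∞
      (fun t : ℝ => (t, (extChartAt (𝓡 k) c).symm p.2)) p.1 :=
    contMDiffAt_id.prodMk contMDiffAt_const
  exact (ContMDiffAt.comp (g := fun q : ℝ × X => F q.1 q.2)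
    (f := fun t : ℝ => (t, (extChartAt (𝓡 k) c).symm p.2)) p.1
    h.eventually_smooth.self_of_nhds h1).mdifferentiableAt (by simp)

theorem InFamChart.mdifferentiableAt_chart [IsManifold (𝓡 n) ∞ M] (h : InFamChart n F m c p) :
    MDifferentiableAt (𝓡 n) 𝓘(ℝ, 𝔼) (extChartAt (𝓡 n) m)
      (F p.1 ((extChartAt (𝓡 k) c).symm p.2)) :=
  (contMDiffAt_extChartAt' (I := 𝓡 n) (n := ∞)
    (by rw [← extChartAt_source (𝓡 n)]; exact h.mem_source)).mdifferentiableAt (by simp)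

variable [IsManifold (𝓡 k) ∞ X]

theorem contMDiffAt_chart_symm {y : 𝕂} (h : y ∈ (extChartAt (𝓡 k) c).target) :
    ContMDiffAt 𝓘(ℝ, 𝕂) (𝓡 k) ∞ (extChartAt (𝓡 k) c).symm y :=
  (contMDiffOn_extChartAt_symm (I := 𝓡 k) (n := ∞) c).contMDiffAt
    ((isOpen_extChartAt_target c).mem_nhds h)

theorem InFamChart.contMDiffAt (h : InFamChart n F m c p) :
    ContMDiffAt 𝓘(ℝ, ℝ × 𝕂) (𝓡 n) ∞
      (fun q : ℝ × 𝕂 => F q.1 ((extChartAt (𝓡 k) c).symm q.2)) p := by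
  have h1 : ContMDiffAt 𝓘(ℝ, ℝ × 𝕂) 𝓘(ℝ, ℝ) ∞ (fun q : ℝ × 𝕂 => q.1) p :=
    contDiffAt_fst.contMDiffAt
  have h2 : ContMDiffAt 𝓘(ℝ, ℝ × 𝕂) 𝓘(ℝ, 𝕂) ∞ (fun q : ℝ × 𝕂 => q.2) p :=
    contDiffAt_snd.contMDiffAt
  have h3 := (contMDiffAt_chart_symm h.mem_target).comp p h2
  exact ContMDiffAt.comp p h.eventually_smooth.self_of_nhds (h1.prodMk h3)

theorem InFamChart.eventually (h : InFamChart n F m c p) : ∀ᶠ q in 𝓝 p, InFamChart n F m c q := by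
  have h1 : ∀ᶠ q in 𝓝 p, q.2 ∈ (extChartAt (𝓡 k) c).target :=
    continuousAt_snd.eventually ((isOpen_extChartAt_target c).mem_nhds h.mem_target)
  have h2 : ∀ᶠ q in 𝓝 p, F q.1 ((extChartAt (𝓡 k) c).symm q.2) ∈ (extChartAt (𝓡 n) m).source :=
    h.contMDiffAt.continuousAt.eventually
      ((isOpen_extChartAt_source m).mem_nhds h.mem_source)
  have h3 : ContinuousAt (fun q : ℝ × 𝕂 => (q.1, (extChartAt (𝓡 k) c).symm q.2)) p :=
    continuousAt_fst.prodMk ((contMDiffAt_chart_symm h.mem_target).continuousAt.comp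
      continuousAt_snd)
  filter_upwards [h1, h2,
    h3.eventually (eventually_eventually_nhds.2 h.eventually_smooth)] with q a b d
  exact ⟨a, b, d⟩

variable [IsManifold (𝓡 n) ∞ M]

theorem InFamChart.contDiffAt (h : InFamChart n F m c p) : ContDiffAt ℝ ∞ (famChart n F m c) p :=
  (ContMDiffAt.comp p (contMDiffAt_extChartAt' (I := 𝓡 n) (n := ∞)
    (by rw [← extChartAt_source (𝓡 n)]; exact h.mem_source)) h.contMDiffAt).contDiffAt

theorem InFamChart.fderiv_space (h : InFamChart n F m c p) (u : 𝕂) :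
    fderiv ℝ (famChart n F m c) p (0, u)
      = chartDeriv m (F p.1 ((extChartAt (𝓡 k) c).symm p.2))
          (mfderiv (𝓡 k) (𝓡 n) (F p.1) ((extChartAt (𝓡 k) c).symm p.2)
            (chartInvDeriv c p.2 u)) := by
  have h1 : HasFDerivAt (fun y : 𝕂 => famChart n F m c (p.1, y))
      (fderiv ℝ (famChart n F m c) p ∘L (ContinuousLinearMap.inr ℝ ℝ 𝕂)) p.2 := by
    have := (h.contDiffAt.differentiableAt (by simp)).hasFDerivAt
    exact HasFDerivAt.comp (g := famChart n F m c) p.2 this (hasFDerivAt_prodMk_right p.1 p.2)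
  have h2 := ((h.mdifferentiableAt_chart.hasMFDerivAt).comp _
    (h.mdifferentiableAt.hasMFDerivAt)).comp p.2
      ((contMDiffAt_chart_symm h.mem_target).mdifferentiableAt (by simp)).hasMFDerivAt
  have h3 := h1.unique h2.hasFDerivAt
  exact congrArg (fun L : 𝕂 →L[ℝ] 𝔼 => L u) h3

theorem InFamChart.fderiv_time (h : InFamChart n F m c p) :
    fderiv ℝ (famChart n F m c) p (1, 0)
      = chartDeriv m (F p.1 ((extChartAt (𝓡 k) c).symm p.2))
          (mfderiv 𝓘(ℝ, ℝ) (𝓡 n) (fun t => F t ((extChartAt (𝓡 k) c).symm p.2)) p.1 (1 : ℝ)) := by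
  have h1 : HasFDerivAt (fun t : ℝ => famChart n F m c (t, p.2))
      (fderiv ℝ (famChart n F m c) p ∘L (ContinuousLinearMap.inl ℝ ℝ 𝕂)) p.1 := by
    have := (h.contDiffAt.differentiableAt (by simp)).hasFDerivAt
    exact HasFDerivAt.comp (g := famChart n F m c) p.1 this (hasFDerivAt_prodMk_left p.1 p.2)
  have h2 := HasMFDerivAt.comp p.1 (h.mdifferentiableAt_chart.hasMFDerivAt)
    h.mdifferentiableAt_time.hasMFDerivAt
  have h3 := h1.unique h2.hasFDerivAt
  exact congrArg (fun L : ℝ →L[ℝ] 𝔼 => L 1) h3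

end Families

/-! ## Tangential and normal parts -/

section NormalPart

variable {k : ℕ} {K E : Type*} [NormedAddCommGroup K] [NormedSpace ℝ K]
  [NormedAddCommGroup E] [NormedSpace ℝ E]

theorem pullBilin_pos {B : E →L[ℝ] E →L[ℝ] ℝ} (hp : ∀ u, u ≠ 0 → 0 < B u u) {T : K →L[ℝ] E}
    (hT : Function.Injective T) (u : K) (hu : u ≠ 0) : 0 < pullBilin B T T u u :=
  hp _ fun h => hu (hT (h.trans (map_zero T).symm))

/-- The tangential component of a vector with respect to an injective linear map. -/
def tangential (B : E →L[ℝ] E →L[ℝ] ℝ) (T : K →L[ℝ] E) : E →L[ℝ] K :=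
  (pullBilin B T T).inverse ∘L pullBilin B (.id ℝ E) T

variable {B : E →L[ℝ] E →L[ℝ] ℝ} {T : K →L[ℝ] E}

theorem tangential_eq_zero {w : E} (hw : ∀ u, B w (T u) = 0) : tangential B T w = 0 := by
  have h : pullBilin B (.id ℝ E) T w = 0 := by
    ext u
    exact hw u
  rw [tangential, ContinuousLinearMap.comp_apply, h, map_zero]

/-- The normal part `u ↦ (D u)^⊥` of a linear map `D : K → E`. -/
def normalPart (B : E →L[ℝ] E →L[ℝ] ℝ) (T D : K →L[ℝ] E) : K →L[ℝ] E :=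
  (.id ℝ E - T ∘L tangential B T) ∘L D

theorem normalPart_apply (D : K →L[ℝ] E) (u : K) :
    normalPart B T D u = D u - T (tangential B T (D u)) := rfl

variable [FiniteDimensional ℝ K]

theorem tangential_spec (hp : ∀ u, u ≠ 0 → 0 < B u u) (hT : Function.Injective T) (w : E) (u : K) :
    B (T (tangential B T w)) (T u) = B w (T u) := by
  have h := apply_inverse_of_pos (pullBilin_pos hp hT) (pullBilin B (.id ℝ E) T w)
  exact congrArg (fun L : K →L[ℝ] ℝ => L u) h

theorem tangential_apply (hp : ∀ u, u ≠ 0 → 0 < B u u) (hT : Function.Injective T) (u : K) :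
    tangential B T (T u) = u :=
  inverse_apply_of_pos (pullBilin_pos hp hT) u

theorem normalPart_orthogonal (hp : ∀ u, u ≠ 0 → 0 < B u u) (hT : Function.Injective T)
    (D : K →L[ℝ] E) (u u' : K) : B (normalPart B T D u) (T u') = 0 := by
  rw [normalPart_apply, map_sub, sub_apply, tangential_spec hp hT, sub_self]

/-- In the basis `e`, the matrix of the endomorphism times the Gram matrix of `T e` on the left is
the Gram matrix of `P e`. -/
theorem trace_inverse_comp_pullBilin (hs : ∀ u v, B u v = B v u) (hp : ∀ u, u ≠ 0 → 0 < B u u)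
    (hT : Function.Injective T) (P : K →L[ℝ] E) (e : Module.Basis (Fin k) ℝ K) :
    LinearMap.trace ℝ K ((pullBilin B T T).inverse ∘L pullBilin B P P : K →L[ℝ] K)
      = ((gram B fun j => T (e j))⁻¹ * gram B fun j => P (e j)).trace := by
  set L : K →ₗ[ℝ] K := (((pullBilin B T T).inverse ∘L pullBilin B P P : K →L[ℝ] K) : K →ₗ[ℝ] K)
  have hpos : (gram B fun j => T (e j)).PosDef :=
    gram_posDef hs hp (e.linearIndependent.map' (T : K →ₗ[ℝ] E) (LinearMap.ker_eq_bot.2 hT))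
  have hu : IsUnit (gram B fun j => T (e j)).det := hpos.det_pos.ne'.isUnit
  have h1 : (gram B fun j => T (e j)) * LinearMap.toMatrix e e L = gram B fun j => P (e j) := by
    ext i j
    rw [Matrix.mul_apply]
    have h2 : T (L (e j)) = ∑ l, LinearMap.toMatrix e e L l j • T (e l) := by
      conv_lhs => rw [← e.sum_repr (L (e j))]
      simp only [map_sum, map_smul, LinearMap.toMatrix_apply]
    have h3 : B (T (L (e j))) (T (e i)) = B (P (e j)) (P (e i)) := by
      have h := apply_inverse_of_pos (pullBilin_pos hp hT) (pullBilin B P P (e j))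
      exact congrArg (fun f : K →L[ℝ] ℝ => f (e i)) h
    rw [gram_apply, hs, ← h3, hs, h2]
    simp [gram_apply, mul_comm]
  rw [LinearMap.trace_eq_matrix_trace ℝ e, ← h1, ← mul_assoc, Matrix.nonsing_inv_mul _ hu, one_mul]

end NormalPart

/-! ### Exchange of time and space derivatives -/

section MixedDerivative

variable {K E : Type*} [NormedAddCommGroup K] [NormedSpace ℝ K]
  [NormedAddCommGroup E] [NormedSpace ℝ E]

theorem mixed_derivative {H : ℝ × K → E} {p : ℝ × K} (hH : ContDiffAt ℝ ∞ H p) (u : K) :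
    DifferentiableAt ℝ (fun z => fderiv ℝ H (p.1, z) (1, 0)) p.2 ∧
    deriv (fun t => fderiv ℝ H (t, p.2) (0, u)) p.1
      = fderiv ℝ (fun z => fderiv ℝ H (p.1, z) (1, 0)) p.2 u := by
  have h1 : DifferentiableAt ℝ (fderiv ℝ H) p :=
    (hH.fderiv_right (m := ∞) (by simp)).differentiableAt (by simp)
  have hsymm : IsSymmSndFDerivAt ℝ H p := hH.isSymmSndFDerivAt (by simpa using ENat.LEInfty.out)
  have h2 : HasFDerivAt (fun z => fderiv ℝ H (p.1, z))
      (fderiv ℝ (fderiv ℝ H) p ∘L ContinuousLinearMap.inr ℝ ℝ K) p.2 :=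
    HasFDerivAt.comp (g := fderiv ℝ H) p.2 h1.hasFDerivAt (hasFDerivAt_prodMk_right p.1 p.2)
  have h3 : HasFDerivAt (fun t => fderiv ℝ H (t, p.2))
      (fderiv ℝ (fderiv ℝ H) p ∘L ContinuousLinearMap.inl ℝ ℝ K) p.1 :=
    HasFDerivAt.comp (g := fderiv ℝ H) p.1 h1.hasFDerivAt (hasFDerivAt_prodMk_left p.1 p.2)
  have h4 := h2.clm_apply (hasFDerivAt_const ((1 : ℝ), (0 : K)) p.2)
  have h5 := (h3.clm_apply (hasFDerivAt_const ((0 : ℝ), u) p.1)).hasDerivAt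
  refine ⟨h4.differentiableAt, ?_⟩
  rw [h4.fderiv, h5.deriv]
  simpa using hsymm.eq (1, 0) (0, u)

end MixedDerivative

/-! ## Top degree forms on the tangent space -/

section TopForms

variable {k : ℕ}

theorem exists_matrix_coordFrame (e : Fin k → EuclideanSpace ℝ (Fin k)) :
    ∃ S : Matrix (Fin k) (Fin k) ℝ, e = fun i => ∑ j, S i j • coordFrame k j := by
  refine ⟨Matrix.of fun i j => e i j, ?_⟩
  funext i
  ext a
  simp [coordFrame, Pi.single_apply]

theorem linearIndependent_coordFrame : LinearIndependent ℝ (coordFrame k) := by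
  have h := (EuclideanSpace.basisFun (Fin k) ℝ).toBasis.linearIndependent
  have h1 : ((EuclideanSpace.basisFun (Fin k) ℝ).toBasis : Fin k → EuclideanSpace ℝ (Fin k))
      = coordFrame k := by
    funext j
    simp [coordFrame]
  rwa [h1] at h

theorem topForm_ne_zero {β : EuclideanSpace ℝ (Fin k) [⋀^Fin k]→L[ℝ] ℝ} (hβ : β ≠ 0)
    {e : Fin k → EuclideanSpace ℝ (Fin k)} (he : LinearIndependent ℝ e) : β e ≠ 0 := by
  intro h0
  let b := Module.Basis.mk he (he.span_eq_top_of_card_eq_finrank' (by simp)).ge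
  have hb : (b : Fin k → EuclideanSpace ℝ (Fin k)) = e := Module.Basis.coe_mk he _
  have h1 := β.toAlternatingMap.eq_smul_basis_det b
  refine hβ (ContinuousAlternatingMap.ext fun v => ?_)
  have h2 := congrArg (fun η => η v) h1
  have h3 : β.toAlternatingMap b = 0 := by rw [hb]; exact h0
  rw [h3, zero_smul] at h2
  exact h2

theorem topForm_ext {β η : EuclideanSpace ℝ (Fin k) [⋀^Fin k]→L[ℝ] ℝ}
    (h : β (coordFrame k) = η (coordFrame k)) : β = η := by
  by_contra hne
  have := topForm_ne_zero (sub_ne_zero.2 hne) linearIndependent_coordFrame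
  simp [h] at this

theorem sign_mul_abs (a : ℝ) : Real.sign a * |a| = a := by
  rcases lt_trichotomy a 0 with h | h | h
  · simp [Real.sign_of_neg h, abs_of_neg h]
  · simp [h]
  · simp [Real.sign_of_pos h, abs_of_pos h]

theorem sign_mul_self {a : ℝ} (ha : a ≠ 0) : Real.sign a * Real.sign a = 1 := by
  rcases Real.sign_apply_eq_of_ne_zero a ha with h | h <;> simp [h]

theorem abs_sign {a : ℝ} (ha : a ≠ 0) : |Real.sign a| = 1 := by
  rcases Real.sign_apply_eq_of_ne_zero a ha with h | h <;> simp [h]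

theorem sign_pos_mul {r : ℝ} (hr : 0 < r) (a : ℝ) : Real.sign (r * a) = Real.sign a := by
  rcases lt_trichotomy a 0 with h | h | h
  · rw [Real.sign_of_neg h, Real.sign_of_neg (mul_neg_of_pos_of_neg hr h)]
  · simp [h]
  · rw [Real.sign_of_pos h, Real.sign_of_pos (mul_pos hr h)]

/-- Writing `e` as a matrix `S` times the coordinate frame, the root of the Gram determinant scales
by `|det S|` and `β` by `det S`, so the normalized form differs from the density by the sign of `β
e`. -/
theorem topForm_density (B : EuclideanSpace ℝ (Fin k) →L[ℝ] EuclideanSpace ℝ (Fin k) →L[ℝ] ℝ)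
    {β : EuclideanSpace ℝ (Fin k) [⋀^Fin k]→L[ℝ] ℝ} (hβ : β ≠ 0)
    (e : Fin k → EuclideanSpace ℝ (Fin k)) :
    Real.sqrt (gram B (coordFrame k)).det / |β (coordFrame k)| * β e
      = Real.sign (β e) * Real.sqrt (gram B e).det := by
  obtain ⟨S, rfl⟩ := exists_matrix_coordFrame e
  have h0 : |β (coordFrame k)| ≠ 0 :=
    abs_ne_zero.2 (topForm_ne_zero hβ linearIndependent_coordFrame)
  have h1 : β (fun i => ∑ j, S i j • coordFrame k j) = S.det * β (coordFrame k) :=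
    alternatingMap_apply_matrix β.toAlternatingMap S (coordFrame k)
  rw [gram_matrix, Matrix.det_mul, Matrix.det_mul, Matrix.det_transpose,
    show S.det * (gram B (coordFrame k)).det * S.det
      = S.det ^ 2 * (gram B (coordFrame k)).det by ring,
    Real.sqrt_mul (sq_nonneg _), Real.sqrt_sq_eq_abs, h1]
  have h2 := sign_mul_abs (S.det * β (coordFrame k))
  rw [abs_mul] at h2
  field_simp
  linear_combination (-Real.sqrt (gram B (coordFrame k)).det) * h2

end TopForms

/-! ## Volume form, ratio and densities in charts -/

section Densities

variable {n k : ℕ} {M : Type*} [TopologicalSpace M] [ChartedSpace (EuclideanSpace ℝ (Fin n)) M]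
  {X : Type*} [TopologicalSpace X] [ChartedSpace (EuclideanSpace ℝ (Fin k)) X]
  [IsManifold (𝓡 n) ∞ M]

theorem volForm_apply (g : Metric n M) {o : KForm k k X} {x : X} (ho : o x ≠ 0) (f : X → M)
    (e : Fin k → TangentSpace (𝓡 k) x) :
    volForm g o f x e = Real.sign (o x e) * Real.sqrt (gram (inducedMetric g f x) e).det :=
  topForm_density (inducedMetric g f x) (β := o x) ho e

theorem abs_pullback_le {g : Metric n M} {φ : KForm n k M} (hφ : IsGeneralizedCalibration g φ)
    (f : X → M) (x : X) (e : Fin k → TangentSpace (𝓡 k) x) :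
    |pullback φ f x e| ≤ Real.sqrt (gram (inducedMetric g f x) e).det :=
  abs_form_le hφ (f x) fun j => mfderiv (𝓡 k) (𝓡 n) f x (e j)

/-- No immersion is needed: where the volume form vanishes, the comass bound makes the pullback
vanish too, and the default value of the division by zero does no harm. -/
theorem pullback_eq_ratio_smul {g : Metric n M} {φ : KForm n k M}
    (hφ : IsGeneralizedCalibration g φ) {o : KForm k k X} {x : X} (ho : o x ≠ 0) (f : X → M) :
    pullback φ f x = ratio g φ o f x • volForm g o f x := by
  refine topForm_ext ?_
  change pullback φ f x (coordFrame k) = pullback φ f x (coordFrame k) /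
    volForm g o f x (coordFrame k) * volForm g o f x (coordFrame k)
  by_cases h : volForm g o f x (coordFrame k) = 0
  · have h1 := abs_pullback_le hφ f x (coordFrame k)
    replace h := (volForm_apply g ho f (coordFrame k)).symm.trans h
    have h2 : Real.sign (o x (coordFrame k)) ≠ 0 := fun h3 =>
      topForm_ne_zero (β := o x) ho linearIndependent_coordFrame (Real.sign_eq_zero_iff.1 h3)
    rw [(mul_eq_zero.1 h).resolve_left h2] at h1
    rw [abs_nonpos_iff.1 h1, zero_div, zero_mul]
  · rw [div_mul_cancel₀ _ h]

theorem inducedMetric_symm (g : Metric n M) (f : X → M) (x : X) (u v : TangentSpace (𝓡 k) x) :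
    inducedMetric g f x u v = inducedMetric g f x v u := g.symm _ _ _

theorem inducedMetric_pos (g : Metric n M) {f : X → M} {x : X}
    (hf : Function.Injective (mfderiv (𝓡 k) (𝓡 n) f x)) (u : TangentSpace (𝓡 k) x) (hu : u ≠ 0) :
    0 < inducedMetric g f x u u :=
  g.pos _ _ fun h => hu (hf (h.trans (map_zero _).symm))

/-- The factor relating `e` to an orthonormal frame is positive, so the orientation sign is the same
on both. -/
theorem IsCalibrated.pullback_apply {g : Metric n M} {φ : KForm n k M} {o : KForm k k X}
    {f : X → M} (h : IsCalibrated g φ o f) {x : X}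
    (hf : Function.Injective (mfderiv (𝓡 k) (𝓡 n) f x)) {e : Fin k → TangentSpace (𝓡 k) x}
    (he : LinearIndependent ℝ e) : pullback φ f x e
      = Real.sign (o x e) * Real.sqrt (gram (inducedMetric g f x) e).det := by
  obtain ⟨u, hu, hα⟩ := exists_orthonormal_frame (inducedMetric_symm g f x)
    (inducedMetric_pos g hf) he
  have h1 := hα (pullback φ f x).toAlternatingMap
  have h2 := hα (o x).toAlternatingMap
  have hpos := Real.sqrt_pos.2
    (gram_posDef (inducedMetric_symm g f x) (inducedMetric_pos g hf) he).det_pos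
  have h3 : o x e = Real.sqrt (gram (inducedMetric g f x) e).det * o x u := h2
  have h4 : pullback φ f x e
      = Real.sqrt (gram (inducedMetric g f x) e).det * pullback φ f x u := h1
  rw [h4, h x u hu, h3, sign_pos_mul hpos, mul_comm]

end Densities

/-! ### Densities of a family of maps in coordinates -/

section FamilyDensities

variable {n k : ℕ} {M : Type*} [TopologicalSpace M] [ChartedSpace (EuclideanSpace ℝ (Fin n)) M]
  {X : Type*} [TopologicalSpace X] [ChartedSpace (EuclideanSpace ℝ (Fin k)) X]

/-- The Gram determinant of the coordinate frame of a chart for the metrics induced by a family. -/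
def gramDet [IsManifold (𝓡 n) ∞ M] (g : Metric n M) (F : ℝ → X → M) (c : X)
    (p : ℝ × EuclideanSpace ℝ (Fin k)) : ℝ :=
  (gram (inducedMetric g (F p.1) ((extChartAt (𝓡 k) c).symm p.2)) (chartFrame c p.2)).det

/-- The coefficient in a chart of the pullbacks of a form by a family. -/
def formCoeff (φ : KForm n k M) (F : ℝ → X → M) (c : X) (p : ℝ × EuclideanSpace ℝ (Fin k)) : ℝ :=
  pullback φ (F p.1) ((extChartAt (𝓡 k) c).symm p.2) (chartFrame c p.2)

variable (n) in
/-- The image of the coordinate frame of a chart under a family, in the chart around `m`. -/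
def famFrame (F : ℝ → X → M) (m : M) (c : X) (p : ℝ × EuclideanSpace ℝ (Fin k)) (j : Fin k) :
    EuclideanSpace ℝ (Fin n) :=
  fderiv ℝ (famChart n F m c) p (0, coordFrame k j)

variable {F : ℝ → X → M} {m : M} {c : X} {p : ℝ × EuclideanSpace ℝ (Fin k)}

theorem InFamChart.famChart_mem (h : InFamChart n F m c p) :
    famChart n F m c p ∈ (extChartAt (𝓡 n) m).target :=
  (extChartAt (𝓡 n) m).map_source h.mem_source

variable [IsManifold (𝓡 k) ∞ X]

theorem linearIndependent_chartFrame {y : EuclideanSpace ℝ (Fin k)}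
    (hy : y ∈ (extChartAt (𝓡 k) c).target) : LinearIndependent ℝ (chartFrame c y) :=
  linearIndependent_coordFrame.map' (chartInvDeriv c y).toLinearMap
    (LinearMap.ker_eq_bot.2 (chartInvDeriv_injective c hy))

theorem vecDeriv_chartInvDeriv {N : ℕ} {q : X → EuclideanSpace ℝ (Fin N)}
    {y : EuclideanSpace ℝ (Fin k)} {r : EuclideanSpace ℝ (Fin k) → EuclideanSpace ℝ (Fin N)}
    (hy : y ∈ (extChartAt (𝓡 k) c).target)
    (hr : (fun z => q ((extChartAt (𝓡 k) c).symm z)) =ᶠ[𝓝 y] r) (hd : DifferentiableAt ℝ r y)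
    (u : EuclideanSpace ℝ (Fin k)) :
    vecDeriv N q ((extChartAt (𝓡 k) c).symm y) (chartInvDeriv c y u) = fderiv ℝ r y u := by
  set x := (extChartAt (𝓡 k) c).symm y with hx
  have hxs : x ∈ (extChartAt (𝓡 k) c).source := (extChartAt (𝓡 k) c).map_target hy
  have hxy : extChartAt (𝓡 k) c x = y := (extChartAt (𝓡 k) c).right_inv hy
  have hext : ContMDiffAt (𝓡 k) 𝓘(ℝ, EuclideanSpace ℝ (Fin k)) ∞ (extChartAt (𝓡 k) c) x :=
    contMDiffAt_extChartAt' (by rw [← extChartAt_source (𝓡 k)]; exact hxs)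
  have h1 : MDifferentiableAt (𝓡 k) 𝓘(ℝ, EuclideanSpace ℝ (Fin N))
      (fun z => r (extChartAt (𝓡 k) c z)) x :=
    MDifferentiableAt.comp x (g := r) (by rw [hxy]; exact hd.mdifferentiableAt)
      (hext.mdifferentiableAt (by simp))
  have h2 : q =ᶠ[𝓝 x] fun z => r (extChartAt (𝓡 k) c z) := by
    have h3 : Tendsto (extChartAt (𝓡 k) c) (𝓝 x) (𝓝 y) := by
      have := hext.continuousAt
      rwa [ContinuousAt, hxy] at this
    filter_upwards [h3.eventually hr, (isOpen_extChartAt_source c).mem_nhds hxs] with z hz hzs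
    rw [← hz, (extChartAt (𝓡 k) c).left_inv hzs]
  have h3 : MDifferentiableAt (𝓡 k) 𝓘(ℝ, EuclideanSpace ℝ (Fin N)) q x :=
    h1.congr_of_eventuallyEq h2
  have h4 := HasMFDerivAt.comp y h3.hasMFDerivAt
    ((contMDiffAt_chart_symm hy).mdifferentiableAt (by simp)).hasMFDerivAt
  have h5 : HasFDerivAt (fun z => q ((extChartAt (𝓡 k) c).symm z)) _ y := h4.hasFDerivAt
  have h6 := (hd.hasFDerivAt.congr_of_eventuallyEq hr).unique h5
  exact (congrArg (fun L : EuclideanSpace ℝ (Fin k) →L[ℝ] EuclideanSpace ℝ (Fin N) => L u)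
    h6).symm

variable [IsManifold (𝓡 n) ∞ M]

theorem InFamChart.contDiffAt_famFrame (h : InFamChart n F m c p) (j : Fin k) :
    ContDiffAt ℝ ∞ (fun q => famFrame n F m c q j) p :=
  (h.contDiffAt.fderiv_right (m := ∞) (by simp)).clm_apply contDiffAt_const

theorem InFamChart.gram_eq (g : Metric n M) (h : InFamChart n F m c p) :
    gram (inducedMetric g (F p.1) ((extChartAt (𝓡 k) c).symm p.2)) (chartFrame c p.2)
      = gram (chartMetric g m (famChart n F m c p)) (famFrame n F m c p) := by
  ext i j
  rw [gram_apply, gram_apply, famFrame, famFrame, h.fderiv_space, h.fderiv_space]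
  exact inner_eq_chartMetric g m h.mem_source _ _

theorem InFamChart.formCoeff_eq (φ : KForm n k M) (h : InFamChart n F m c p) :
    formCoeff φ F c p = chartForm φ m (famChart n F m c p) (famFrame n F m c p) := by
  have h1 : famFrame n F m c p = fun j => chartDeriv m (F p.1 ((extChartAt (𝓡 k) c).symm p.2))
      (mfderiv (𝓡 k) (𝓡 n) (F p.1) ((extChartAt (𝓡 k) c).symm p.2) (chartFrame c p.2 j)) :=
    funext fun j => h.fderiv_space _
  rw [h1]
  exact form_eq_chartForm φ m h.mem_source _

theorem InFamChart.contDiffAt_gramDet (g : Metric n M) (h : InFamChart n F m c p) :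
    ContDiffAt ℝ ∞ (gramDet g F c) p := by
  have h1 : ContDiffAt ℝ ∞ (fun q =>
      (gram (chartMetric g m (famChart n F m c q)) (famFrame n F m c q)).det) p :=
    contDiffAt_det_gram ((contDiffAt_chartMetric g m h.famChart_mem).comp p h.contDiffAt)
      h.contDiffAt_famFrame
  refine h1.congr_of_eventuallyEq ?_
  filter_upwards [h.eventually] with q hq
  rw [gramDet, hq.gram_eq]

theorem InFamChart.contDiffAt_formCoeff {φ : KForm n k M} (hφ : IsSmoothForm φ)
    (h : InFamChart n F m c p) : ContDiffAt ℝ ∞ (formCoeff φ F c) p := by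
  have h1 : ContDiffAt ℝ ∞ (fun q =>
      chartForm φ m (famChart n F m c q) (famFrame n F m c q)) p :=
    contDiffAt_form_apply ((contDiffAt_chartForm hφ m h.famChart_mem).comp p h.contDiffAt)
      h.contDiffAt_famFrame
  refine h1.congr_of_eventuallyEq ?_
  filter_upwards [h.eventually] with q hq
  rw [hq.formCoeff_eq]

theorem InFamChart.sub_eq_defect (g : Metric n M) (φ : KForm n k M) (σ : ℝ)
    (h : InFamChart n F m c p) :
    Real.sqrt (gramDet g F c p) - σ * formCoeff φ F c p
      = defect (chartMetric g m) (chartForm φ m) σ (famChart n F m c p, famFrame n F m c p) := by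
  rw [gramDet, h.gram_eq, h.formCoeff_eq, defect]

end FamilyDensities

/-! ## The pointwise second variation -/

section Linear

variable {k : ℕ} {K E : Type*} [NormedAddCommGroup K] [NormedSpace ℝ K] [FiniteDimensional ℝ K]
  [NormedAddCommGroup E] [NormedSpace ℝ E] [FiniteDimensional ℝ E]

/-- Second variation of the calibration defect in terms of the normal part of a covariant
derivative. -/
theorem deriv_deriv_defect_normalPart {h : E → E →L[ℝ] E →L[ℝ] ℝ} {α : E → E [⋀^Fin k]→L[ℝ] ℝ}
    {y : ℝ → E} (hh : ContDiffAt ℝ ∞ h (y 0)) (hα : ContDiffAt ℝ ∞ α (y 0))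
    (hy : ContDiffAt ℝ ∞ y 0) (hs : ∀ᶠ z in 𝓝 (y 0), ∀ u v, h z u v = h z v u)
    (hp : ∀ᶠ z in 𝓝 (y 0), ∀ u, u ≠ 0 → 0 < h z u u)
    {T : K →L[ℝ] E} (hT : Function.Injective T) (D : K →L[ℝ] E) (b : Module.Basis (Fin k) ℝ K)
    (σ : ℝ) (hmin : ∀ᶠ p in 𝓝 (y 0, fun j => T (b j)), 0 ≤ defect h α σ p)
    (hzero : defect h α σ (y 0, fun j => T (b j)) = 0)
    {Y : ℝ → E} {U : ℝ → Fin k → E} (hY : ContDiffAt ℝ ∞ Y 0)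
    (hU : ∀ j, ContDiffAt ℝ ∞ (fun t => U t j) 0) (hY0 : Y 0 = y 0) (hU0 : U 0 = fun j => T (b j))
    (hY' : deriv Y 0 = deriv y 0)
    (hU' : ∀ j, D (b j) = deriv (fun t => U t j) 0 + leviCivita h (y 0) (deriv y 0) (T (b j)))
    {B : E →L[ℝ] E →L[ℝ] ℝ} (hB : h (y 0) = B) {P : K →L[ℝ] E} (hP : P = normalPart B T D)
    {A : E →L[ℝ] E} (hA : A = P ∘L tangential B T) :
    deriv (deriv fun t => defect h α σ (Y t, U t)) 0
      = Real.sqrt (gram B fun j => T (b j)).det *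
          LinearMap.trace ℝ K ((pullBilin B T T).inverse ∘L pullBilin B P P : K →L[ℝ] K)
        - σ * (covD h y (covD h y fun t => α (y t)) 0 (fun j => T (b j))
            + insertion A (insertion A (α (y 0))) (fun j => T (b j))
            + 2 * insertion A (covD h y (fun t => α (y t)) 0) (fun j => T (b j))) := by
  have hs0 : ∀ u w, B u w = B w u := hB ▸ hs.self_of_nhds
  have hp0 : ∀ u, u ≠ 0 → 0 < B u u := hB ▸ hp.self_of_nhds
  have hAT : ∀ u, A (T u) = P u := fun u => by
    rw [hA, ContinuousLinearMap.comp_apply, tangential_apply hp0 hT]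
  have horth : ∀ u u', B (A (T u)) (T u') = 0 := fun u u' => by
    rw [hAT, hP]; exact normalPart_orthogonal hp0 hT D u u'
  -- `A` sends tangent vectors to normal ones, and these have no tangential component.
  have hAA : ∀ j, A (A (T (b j))) = 0 := fun j => by
    conv_lhs => rw [hA]
    rw [ContinuousLinearMap.comp_apply, tangential_eq_zero fun u => by
      rw [← hA]; exact horth _ u, map_zero]
  have hmain := deriv_deriv_defect hh hα hy hs hp (A := A) (v := fun j => T (b j))
    (b.linearIndependent.map' (T : K →ₗ[ℝ] E) (LinearMap.ker_eq_bot.2 hT)) hAA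
    (fun i j => by rw [hB]; exact horth _ _) σ hmin hzero hY hU hY0 hU0 hY'
    -- The actual frame velocity is `D b_j` minus the Christoffel term, that of the model is the
    -- normal part of `D b_j` minus the same term. They differ by the tangential part of `D b_j`,
    -- whose coordinates form the matrix.
    (Matrix.of fun j i => b.repr (tangential B T (D (b j))) i) (fun j => by
      have h1 : ∑ i, b.repr (tangential B T (D (b j))) i • T (b i)
          = T (tangential B T (D (b j))) := by
        conv_rhs => rw [← b.sum_repr (tangential B T (D (b j)))]
        simp only [map_sum, map_smul]
      simp only [Matrix.of_apply]
      rw [h1, hAT, hP, normalPart_apply, hU' j]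
      abel)
  rw [hmain, hB, trace_inverse_comp_pullBilin hs0 hp0 hT P b]
  simp only [hAT]

end Linear

/-! ### From coordinates back to the geometric second variation form -/

section Pointwise

variable {n k : ℕ} {M : Type*} [TopologicalSpace M] [ChartedSpace (EuclideanSpace ℝ (Fin n)) M]
  {X : Type*} [TopologicalSpace X] [ChartedSpace (EuclideanSpace ℝ (Fin k)) X]
  [IsManifold (𝓡 n) ∞ M]

theorem chartMetric_self (g : Metric n M) (m : M) :
    chartMetric g m (extChartAt (𝓡 n) m m) = g.inner m := by
  refine ContinuousLinearMap.ext fun u => ContinuousLinearMap.ext fun v => ?_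
  have h := inner_eq_chartMetric g m (mem_extChartAt_source (I := 𝓡 n) m) u v
  have h1 := congrArg₂ (fun a b : EuclideanSpace ℝ (Fin n) =>
    chartMetric g m (extChartAt (𝓡 n) m m) a b) (chartDeriv_self m u) (chartDeriv_self m v)
  exact (h.trans h1).symm

theorem chartForm_self (φ : KForm n k M) (m : M) :
    chartForm φ m (extChartAt (𝓡 n) m m) = φ m := by
  refine ContinuousAlternatingMap.ext fun v => ?_
  have h := form_eq_chartForm φ m (mem_extChartAt_source (I := 𝓡 n) m) v
  have h1 : (fun j => chartDeriv m m (v j)) = v := funext fun j => chartDeriv_self m (v j)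
  exact (h.trans (congrArg (chartForm φ m (extChartAt (𝓡 n) m m)) h1)).symm

theorem nablaForm_apply (g : Metric n M) (φ : KForm n k M) (m : M) (γ : ℝ → M)
    (v : Fin k → TangentSpace (𝓡 n) m) : nablaForm g φ m γ v
      = covD (chartMetric g m) (fun t => extChartAt (𝓡 n) m (γ t))
          (fun t => chartForm φ m (extChartAt (𝓡 n) m (γ t))) 0 v := by
  have h : (fun j => chartDeriv m m (v j)) = v := funext fun j => chartDeriv_self m (v j)
  exact congrArg (covD (chartMetric g m) (fun t => extChartAt (𝓡 n) m (γ t))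
          (fun t => chartForm φ m (extChartAt (𝓡 n) m (γ t))) 0) h

theorem nablaNablaForm_apply (g : Metric n M) (φ : KForm n k M) (m : M) (γ : ℝ → M)
    (v : Fin k → TangentSpace (𝓡 n) m) : nablaNablaForm g φ m γ v
      = covD (chartMetric g m) (fun t => extChartAt (𝓡 n) m (γ t))
          (covD (chartMetric g m) (fun t => extChartAt (𝓡 n) m (γ t))
            (fun t => chartForm φ m (extChartAt (𝓡 n) m (γ t)))) 0 v := by
  have h : (fun j => chartDeriv m m (v j)) = v := funext fun j => chartDeriv_self m (v j)
  exact congrArg (covD (chartMetric g m) (fun t => extChartAt (𝓡 n) m (γ t))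
          (covD (chartMetric g m) (fun t => extChartAt (𝓡 n) m (γ t))
            (fun t => chartForm φ m (extChartAt (𝓡 n) m (γ t)))) 0) h

/-- Base point and velocity are prescribed together as a point of the tangent bundle, because `γ 0 =
m` is only a propositional equality and the velocity lives over `γ 0`. -/
theorem curve_chart {γ : ℝ → M} (hγ : ContMDiffAt 𝓘(ℝ, ℝ) (𝓡 n) ∞ γ 0) {m : M}
    {V : TangentSpace (𝓡 n) m}
    (h : (⟨γ 0, mfderiv 𝓘(ℝ, ℝ) (𝓡 n) γ 0 (1 : ℝ)⟩ : TangentBundle (𝓡 n) M) = ⟨m, V⟩) :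
    ContDiffAt ℝ ∞ (fun t => extChartAt (𝓡 n) m (γ t)) 0 ∧
      extChartAt (𝓡 n) m (γ 0) = extChartAt (𝓡 n) m m ∧
      deriv (fun t => extChartAt (𝓡 n) m (γ t)) 0 = V := by
  have h0 : γ 0 = m := congrArg Bundle.TotalSpace.proj h
  have h1 : chartDeriv m (γ 0) (mfderiv 𝓘(ℝ, ℝ) (𝓡 n) γ 0 (1 : ℝ)) = chartDeriv m m V :=
    congrArg (fun p : TangentBundle (𝓡 n) M => chartDeriv m p.1 p.2) h
  have hext : ContMDiffAt (𝓡 n) 𝓘(ℝ, EuclideanSpace ℝ (Fin n)) ∞ (extChartAt (𝓡 n) m) (γ 0) :=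
    contMDiffAt_extChartAt' (by rw [h0]; exact mem_chart_source _ m)
  refine ⟨(ContMDiffAt.comp 0 hext hγ).contDiffAt, by rw [h0], ?_⟩
  have h2 := HasMFDerivAt.comp 0 (hext.mdifferentiableAt (by simp)).hasMFDerivAt
    (hγ.mdifferentiableAt (by simp)).hasMFDerivAt
  have h3 : HasFDerivAt (fun t => extChartAt (𝓡 n) m (γ t))
    (chartDeriv m (γ 0) ∘L mfderiv 𝓘(ℝ, ℝ) (𝓡 n) γ 0 : ℝ →L[ℝ] EuclideanSpace ℝ (Fin n)) 0 :=
      h2.hasFDerivAt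
  exact h3.hasDerivAt.deriv.trans (h1.trans (chartDeriv_self m V))

theorem secondVariationForm_apply (g : Metric n M) (φ : KForm n k M) {o : KForm k k X} {x : X}
    (ho : o x ≠ 0) (f : X → M) (V : ∀ x, TangentSpace (𝓡 n) (f x)) (γ : X → ℝ → M)
    (e : Fin k → TangentSpace (𝓡 k) x) :
    secondVariationForm g φ o f V γ x e
      = nablaPerpNormSq (k := k) g f V x
          * (Real.sign (o x e) * Real.sqrt (gram (inducedMetric g f x) e).det)
        - (covD (chartMetric g (f x)) (fun t => extChartAt (𝓡 n) (f x) (γ x t))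
            (covD (chartMetric g (f x)) (fun t => extChartAt (𝓡 n) (f x) (γ x t)) fun t =>
              chartForm φ (f x) (extChartAt (𝓡 n) (f x) (γ x t))) 0
              (fun j => mfderiv (𝓡 k) (𝓡 n) f x (e j))
          + insertion (nablaPerpEnd (k := k) g f V x)
              (insertion (nablaPerpEnd (k := k) g f V x) (φ (f x)))
              (fun j => mfderiv (𝓡 k) (𝓡 n) f x (e j))
          + 2 * insertion (nablaPerpEnd (k := k) g f V x)
              (covD (chartMetric g (f x)) (fun t => extChartAt (𝓡 n) (f x) (γ x t))
                (fun t => chartForm φ (f x) (extChartAt (𝓡 n) (f x) (γ x t))) 0)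
              (fun j => mfderiv (𝓡 k) (𝓡 n) f x (e j))) := by
  have h1 := volForm_apply g ho f e
  have h2 := nablaNablaForm_apply g φ (f x) (γ x) fun j => mfderiv (𝓡 k) (𝓡 n) f x (e j)
  have h3 : nablaForm g φ (f x) (γ x)
      = covD (chartMetric g (f x)) (fun t => extChartAt (𝓡 n) (f x) (γ x t))
          (fun t => chartForm φ (f x) (extChartAt (𝓡 n) (f x) (γ x t))) 0 :=
    ContinuousAlternatingMap.ext fun v => nablaForm_apply g φ (f x) (γ x) v
  have h4 : secondVariationForm g φ o f V γ x e
      = nablaPerpNormSq (k := k) g f V x * volForm g o f x e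
        - (nablaNablaForm g φ (f x) (γ x) (fun j => mfderiv (𝓡 k) (𝓡 n) f x (e j))
          + insertion (nablaPerpEnd (k := k) g f V x)
              (insertion (nablaPerpEnd (k := k) g f V x) (φ (f x)))
              (fun j => mfderiv (𝓡 k) (𝓡 n) f x (e j))
          + 2 * insertion (nablaPerpEnd (k := k) g f V x) (nablaForm g φ (f x) (γ x))
              (fun j => mfderiv (𝓡 k) (𝓡 n) f x (e j))) := rfl
  rw [h4, h1, h2, h3]

variable [IsManifold (𝓡 k) ∞ X] {F : ℝ → X → M} {c : X} {y : EuclideanSpace ℝ (Fin k)}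

/-- The coordinate form of `∇_{e_j} ∂_t F = ∇_t dF(e_j)`: the Christoffel terms are the same, and
the remaining partial derivatives commute. -/
theorem nablaVec_chartFrame (g : Metric n M)
    (h : InFamChart n F (F 0 ((extChartAt (𝓡 k) c).symm y)) c (0, y)) (j : Fin k) :
    nablaVec g (F 0) (velocity F) ((extChartAt (𝓡 k) c).symm y) (chartFrame c y j)
      = deriv (fun t => famFrame n F (F 0 ((extChartAt (𝓡 k) c).symm y)) c (t, y) j) 0
        + christoffel g (F 0 ((extChartAt (𝓡 k) c).symm y))
            (extChartAt (𝓡 n) (F 0 ((extChartAt (𝓡 k) c).symm y))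
              (F 0 ((extChartAt (𝓡 k) c).symm y)))
            (velocity F ((extChartAt (𝓡 k) c).symm y))
            (mfderiv (𝓡 k) (𝓡 n) (F 0) ((extChartAt (𝓡 k) c).symm y) (chartFrame c y j)) := by
  set x := (extChartAt (𝓡 k) c).symm y
  set m := F 0 x
  obtain ⟨hd, hmix⟩ := mixed_derivative h.contDiffAt (coordFrame k j)
  have hr : (fun z => (fun x' : X => chartDeriv m (F 0 x') (velocity F x'))
      ((extChartAt (𝓡 k) c).symm z)) =ᶠ[𝓝 y]
        fun z => fderiv ℝ (famChart n F m c) (0, z) (1, 0) := by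
    have hc : ContinuousAt (fun z : EuclideanSpace ℝ (Fin k) => ((0 : ℝ), z)) y :=
      (Continuous.prodMk_right 0).continuousAt
    filter_upwards [hc.eventually h.eventually] with z hz
    exact hz.fderiv_time.symm
  have h1 := vecDeriv_chartInvDeriv (c := c) (y := y)
    (q := fun x' : X => chartDeriv m (F 0 x') (velocity F x')) h.mem_target hr hd (coordFrame k j)
  have h2 : nablaVec g (F 0) (velocity F) x (chartFrame c y j)
      = vecDeriv n (fun x' : X => chartDeriv m (F 0 x') (velocity F x')) x (chartFrame c y j)
        + christoffel g m (extChartAt (𝓡 n) m m) (chartDeriv m m (velocity F x))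
          (chartDeriv m m (mfderiv (𝓡 k) (𝓡 n) (F 0) x (chartFrame c y j))) :=
    chartInvDerivAt_apply m _
  refine h2.trans (congrArg₂ (· + ·) (h1.trans hmix.symm) ?_)
  exact congrArg₂ (fun a b : EuclideanSpace ℝ (Fin n) =>
    christoffel g m (extChartAt (𝓡 n) m m) a b) (chartDeriv_self m _) (chartDeriv_self m _)

/-- The second derivative of the calibration defect of a family of immersions, in the coordinate
frame of a chart. -/
theorem second_variation_pointwise {g : Metric n M} {φ : KForm n k M}
    (hφ : IsGeneralizedCalibration g φ) {o : KForm k k X}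
    (ho : o ((extChartAt (𝓡 k) c).symm y) ≠ 0)
    (h : InFamChart n F (F 0 ((extChartAt (𝓡 k) c).symm y)) c (0, y))
    (himm : Function.Injective (mfderiv (𝓡 k) (𝓡 n) (F 0) ((extChartAt (𝓡 k) c).symm y)))
    (hX : IsCalibrated g φ o (F 0)) {γ : X → ℝ → M}
    (hγ : ContMDiffAt 𝓘(ℝ, ℝ) (𝓡 n) ∞ (γ ((extChartAt (𝓡 k) c).symm y)) 0)
    (hγV : (⟨γ ((extChartAt (𝓡 k) c).symm y) 0,
        mfderiv 𝓘(ℝ, ℝ) (𝓡 n) (γ ((extChartAt (𝓡 k) c).symm y)) 0 (1 : ℝ)⟩ :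
          TangentBundle (𝓡 n) M)
      = ⟨F 0 ((extChartAt (𝓡 k) c).symm y), velocity F ((extChartAt (𝓡 k) c).symm y)⟩) :
    deriv (deriv fun t => Real.sqrt (gramDet g F c (t, y))
        - Real.sign (o ((extChartAt (𝓡 k) c).symm y) (chartFrame c y)) * formCoeff φ F c (t, y)) 0
      = Real.sign (o ((extChartAt (𝓡 k) c).symm y) (chartFrame c y))
        * secondVariationForm g φ o (F 0) (velocity F) γ ((extChartAt (𝓡 k) c).symm y)
            (chartFrame c y) := by
  have hyt : y ∈ (extChartAt (𝓡 k) c).target := h.mem_target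
  have hlin := linearIndependent_chartFrame (c := c) hyt
  have hnab := nablaVec_chartFrame g h
  set x := (extChartAt (𝓡 k) c).symm y with hx
  set m := F 0 x with hm
  have hoe : o x (chartFrame c y) ≠ 0 := topForm_ne_zero (β := o x) ho hlin
  obtain ⟨hyc, hy0, hyV⟩ := curve_chart hγ hγV
  have hsecond := secondVariationForm_apply g φ ho (F 0) (velocity F) γ (chartFrame c y)
  have hU0 : famFrame n F m c (0, y) = fun j => mfderiv (𝓡 k) (𝓡 n) (F 0) x (chartFrame c y j) :=
    funext fun j => (h.fderiv_space (coordFrame k j)).trans (chartDeriv_self m _)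
  let yγ : ℝ → EuclideanSpace ℝ (Fin n) := fun t => extChartAt (𝓡 n) m (γ x t)
  let T : EuclideanSpace ℝ (Fin k) →L[ℝ] EuclideanSpace ℝ (Fin n) := mfderiv (𝓡 k) (𝓡 n) (F 0) x
  let Dv : EuclideanSpace ℝ (Fin k) →L[ℝ] EuclideanSpace ℝ (Fin n) :=
    nablaVec g (F 0) (velocity F) x
  let e : Fin k → EuclideanSpace ℝ (Fin k) := chartFrame c y
  have hlin' : LinearIndependent ℝ e := hlin
  let b : Module.Basis (Fin k) ℝ (EuclideanSpace ℝ (Fin k)) :=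
    Module.Basis.mk hlin' (hlin'.span_eq_top_of_card_eq_finrank' (by simp)).ge
  have hbe : (b : Fin k → EuclideanSpace ℝ (Fin k)) = e := Module.Basis.coe_mk _ _
  have hbe' : (fun j => T (b j)) = fun j => T (e j) := by rw [hbe]
  have hyγ : yγ 0 = extChartAt (𝓡 n) m m := hy0
  have hmem : yγ 0 ∈ (extChartAt (𝓡 n) m).target := by
    rw [hyγ]; exact mem_extChartAt_target m
  have hB : chartMetric g m (yγ 0) = g.inner m := by
    rw [hyγ]; exact chartMetric_self g m
  have hα0 : chartForm φ m (yγ 0) = φ m := by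
    rw [hyγ]; exact chartForm_self φ m
  have hY0 : famChart n F m c (0, y) = yγ 0 := hy0.symm
  have hU0' : famFrame n F m c (0, y) = fun j => T (b j) := hU0.trans hbe'.symm
  have hcurve : ContDiff ℝ ∞ fun t : ℝ => (t, y) := contDiff_id.prodMk contDiff_const
  have hYd : deriv (fun t => famChart n F m c (t, y)) 0 = deriv yγ 0 := by
    have h1 : HasDerivAt (fun t : ℝ => (t, y)) (1, 0) 0 :=
      (hasDerivAt_id _).prodMk (hasDerivAt_const _ _)
    have h2 : HasDerivAt (fun t => famChart n F m c (t, y))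
        (fderiv ℝ (famChart n F m c) (0, y) (1, 0)) 0 :=
      HasFDerivAt.comp_hasDerivAt (l := famChart n F m c) 0
        (h.contDiffAt.differentiableAt (by simp)).hasFDerivAt h1
    exact h2.deriv.trans ((h.fderiv_time.trans (chartDeriv_self m _)).trans hyV.symm)
  have hzero : defect (chartMetric g m) (chartForm φ m)
      (Real.sign (o x (chartFrame c y))) (yγ 0, fun j => T (b j)) = 0 := by
    rw [← hY0, ← hU0', ← h.sub_eq_defect]
    have h2 : formCoeff φ F c (0, y)
        = Real.sign (o x (chartFrame c y)) * Real.sqrt (gramDet g F c (0, y)) :=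
      hX.pullback_apply himm hlin
    rw [h2, ← mul_assoc, sign_mul_self hoe, one_mul, sub_self]
  have hev : (fun t => Real.sqrt (gramDet g F c (t, y))
        - Real.sign (o x (chartFrame c y)) * formCoeff φ F c (t, y))
      =ᶠ[𝓝 0] fun t => defect (chartMetric g m) (chartForm φ m)
        (Real.sign (o x (chartFrame c y)))
        (famChart n F m c (t, y), famFrame n F m c (t, y)) := by
    have hc : ContinuousAt (fun t : ℝ => (t, y)) 0 := (Continuous.prodMk_left y).continuousAt
    filter_upwards [hc.eventually h.eventually] with t ht
    exact ht.sub_eq_defect g φ _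
  have hU' : ∀ j, Dv (b j) = deriv (fun t => famFrame n F m c (t, y) j) 0
      + leviCivita (chartMetric g m) (yγ 0) (deriv yγ 0) (T (b j)) := fun j => by
    rw [hbe, hyγ, show deriv yγ 0 = _ from hyV]
    exact hnab j
  have hmain := deriv_deriv_defect_normalPart (h := chartMetric g m) (α := chartForm φ m)
    (y := yγ) (contDiffAt_chartMetric g m hmem) (contDiffAt_chartForm hφ.1 m hmem) hyc
    (Eventually.of_forall fun z => chartMetric_symm g m z)
    (Filter.eventually_of_mem ((isOpen_extChartAt_target m).mem_nhds hmem) fun z hz =>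
      chartMetric_pos g m hz)
    (T := T) himm Dv b (Real.sign (o x (chartFrame c y)))
    (Eventually.of_forall fun p => defect_chart_nonneg hφ m (abs_sign hoe) p) hzero
    (Y := fun t => famChart n F m c (t, y)) (U := fun t => famFrame n F m c (t, y))
    (ContDiffAt.comp (0 : ℝ) (g := famChart n F m c) h.contDiffAt hcurve.contDiffAt)
    (fun j => ContDiffAt.comp (0 : ℝ) (g := fun q => famFrame n F m c q j)
      (h.contDiffAt_famFrame j) hcurve.contDiffAt)
    hY0 hU0' hYd hU' hB (P := nablaPerp g (F 0) (velocity F) x) rfl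
    (A := nablaPerpEnd (k := k) g (F 0) (velocity F) x) rfl
  rw [hbe', hα0] at hmain
  refine (hev.deriv.deriv_eq.trans hmain).trans ?_
  have h2 := sign_mul_self hoe
  -- Since `σ² = 1`, the sign can be factored out of the whole expression; the volume form on the
  -- frame is `σ` times the root of the Gram determinant.
  have h3 : ∀ {σ : ℝ} (r N Q : ℝ), σ * σ = 1 → r * N - σ * Q = σ * (N * (σ * r) - Q) :=
    fun r N Q hσ => by linear_combination (-(r * N)) * hσ
  exact (h3 _ _ _ h2).trans
    (congrArg (fun r => Real.sign (o x (chartFrame c y)) * r) hsecond).symm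

end Pointwise

/-! ## The energy density in a chart -/

/-- `d` has a minimum of value zero at `t`, so both `d` and its derivative vanish there. Applied
with `d` the energy density and `r` the volume density, it gives `λ'(0) = 0`. -/
theorem hasDerivAt_one_sub_div_of_nonneg {d r : ℝ → ℝ} {t : ℝ} (hd : DifferentiableAt ℝ d t)
    (hr : DifferentiableAt ℝ r t) (hd0 : d t = 0) (hr0 : r t ≠ 0) (hnonneg : ∀ s, 0 ≤ d s) :
    HasDerivAt (fun s => 1 - d s / r s) 0 t := by
  have hmin : IsLocalMin d t := Eventually.of_forall fun s => by rw [hd0]; exact hnonneg s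
  have hd' : HasDerivAt d 0 t := by
    have := hd.hasDerivAt
    rwa [hmin.deriv_eq_zero] at this
  exact ((hd'.div hr.hasDerivAt hr0).const_sub 1).congr_deriv (by simp [hd0])

section EnergyDensity

variable {n k : ℕ} {M : Type*} [TopologicalSpace M] [ChartedSpace (EuclideanSpace ℝ (Fin n)) M]
  {X : Type*} [TopologicalSpace X] [ChartedSpace (EuclideanSpace ℝ (Fin k)) X]

/-- The sign of the coordinate frame of a chart relative to an orientation. -/
def chartSign (o : KForm k k X) (c : X) (y : EuclideanSpace ℝ (Fin k)) : ℝ :=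
  Real.sign (chartForm o c y (coordFrame k))

/-- The coefficient in a chart of the energy density `dvol - φ` of a family of maps. -/
def energyDensity [IsManifold (𝓡 n) ∞ M] (g : Metric n M) (φ : KForm n k M) (o : KForm k k X)
    (F : ℝ → X → M) (c : X) (p : ℝ × EuclideanSpace ℝ (Fin k)) : ℝ :=
  Real.sqrt (gramDet g F c p) - chartSign o c p.2 * formCoeff φ F c p

variable {F : ℝ → X → M} {c : X} {y : EuclideanSpace ℝ (Fin k)}

theorem inFamChart_of_contMDiffOn {ε : ℝ}
    (hF : ContMDiffOn (𝓘(ℝ, ℝ).prod (𝓡 k)) (𝓡 n) ∞ (fun p : ℝ × X => F p.1 p.2)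
      (Ioo (-ε) ε ×ˢ univ)) {t : ℝ} (ht : t ∈ Ioo (-ε) ε)
    (hy : y ∈ (extChartAt (𝓡 k) c).target) :
    InFamChart n F (F t ((extChartAt (𝓡 k) c).symm y)) c (t, y) := by
  refine ⟨hy, mem_extChartAt_source _, ?_⟩
  have hopen : IsOpen (Ioo (-ε) ε ×ˢ (univ : Set X)) := isOpen_Ioo.prod isOpen_univ
  filter_upwards [hopen.mem_nhds
    (show (t, (extChartAt (𝓡 k) c).symm y) ∈ Ioo (-ε) ε ×ˢ univ from ⟨ht, mem_univ _⟩)] with z hz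
  exact hF.contMDiffAt (hopen.mem_nhds hz)

variable [IsManifold (𝓡 k) ∞ X]

theorem IsOrientation.chartForm_ne_zero {o : KForm k k X} (ho : IsOrientation o)
    (hy : y ∈ (extChartAt (𝓡 k) c).target) : chartForm o c y (coordFrame k) ≠ 0 :=
  topForm_ne_zero (β := o ((extChartAt (𝓡 k) c).symm y)) (ho.2 _) (linearIndependent_chartFrame hy)

/-- The coefficient of the orientation is continuous without zeros. Locally constant signs do not
disturb the smoothness of the energy density. -/
theorem IsOrientation.eventually_chartSign {o : KForm k k X} (ho : IsOrientation o)
    (hy : y ∈ (extChartAt (𝓡 k) c).target) :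
    ∀ᶠ z in 𝓝 y, chartSign o c z = chartSign o c y := by
  have hc : ContinuousAt (fun z => chartForm o c z (coordFrame k)) y :=
    (contDiffAt_form_apply (v := fun _ => coordFrame k) (contDiffAt_chartForm ho.1 c hy) fun _ =>
      contDiffAt_const).continuousAt
  rcases (ho.chartForm_ne_zero hy).lt_or_gt with h | h
  · filter_upwards [hc.eventually (gt_mem_nhds h)] with z hz
    rw [chartSign, chartSign, Real.sign_of_neg h, Real.sign_of_neg hz]
  · filter_upwards [hc.eventually (lt_mem_nhds h)] with z hz
    rw [chartSign, chartSign, Real.sign_of_pos h, Real.sign_of_pos hz]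

theorem IsOrientation.contDiffAt_chartSign {o : KForm k k X} (ho : IsOrientation o)
    (hy : y ∈ (extChartAt (𝓡 k) c).target) : ContDiffAt ℝ ∞ (chartSign o c) y :=
  contDiffAt_const.congr_of_eventuallyEq (ho.eventually_chartSign hy)

variable [IsManifold (𝓡 n) ∞ M] {g : Metric n M} {φ : KForm n k M} {o : KForm k k X}

theorem gramDet_pos (g : Metric n M) {t : ℝ} (hy : y ∈ (extChartAt (𝓡 k) c).target)
    (hf : Function.Injective (mfderiv (𝓡 k) (𝓡 n) (F t) ((extChartAt (𝓡 k) c).symm y))) :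
    0 < gramDet g F c (t, y) :=
  (gram_posDef (inducedMetric_symm g (F t) ((extChartAt (𝓡 k) c).symm y)) (inducedMetric_pos g hf)
    (linearIndependent_chartFrame hy)).det_pos

theorem contDiffAt_energyDensity (hφ : IsSmoothForm φ) (ho : IsOrientation o) {m : M}
    {p : ℝ × EuclideanSpace ℝ (Fin k)} (h : InFamChart n F m c p) (hpos : 0 < gramDet g F c p) :
    ContDiffAt ℝ ∞ (energyDensity g φ o F c) p :=
  ((h.contDiffAt_gramDet g).sqrt hpos.ne').sub
    (((ho.contDiffAt_chartSign h.mem_target).comp p contDiffAt_snd).mul (h.contDiffAt_formCoeff hφ))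

theorem energyDensity_nonneg (hφ : IsGeneralizedCalibration g φ) (ho : IsOrientation o) {t : ℝ}
    (hy : y ∈ (extChartAt (𝓡 k) c).target) : 0 ≤ energyDensity g φ o F c (t, y) := by
  have h := abs_pullback_le hφ (F t) ((extChartAt (𝓡 k) c).symm y) (chartFrame c y)
  have h1 : chartSign o c y * formCoeff φ F c (t, y) ≤ Real.sqrt (gramDet g F c (t, y)) :=
    (le_abs_self _).trans (by
      rw [abs_mul, chartSign, abs_sign (ho.chartForm_ne_zero hy), one_mul]; exact h)
  exact sub_nonneg.2 h1

theorem IsCalibrated.energyDensity_eq_zero (hX : IsCalibrated g φ o (F 0)) (ho : IsOrientation o)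
    (hy : y ∈ (extChartAt (𝓡 k) c).target)
    (hf : Function.Injective (mfderiv (𝓡 k) (𝓡 n) (F 0) ((extChartAt (𝓡 k) c).symm y))) :
    energyDensity g φ o F c (0, y) = 0 := by
  have h : formCoeff φ F c (0, y) = chartSign o c y * Real.sqrt (gramDet g F c (0, y)) :=
    hX.pullback_apply hf (linearIndependent_chartFrame hy)
  rw [energyDensity, h, ← mul_assoc, chartSign, sign_mul_self (ho.chartForm_ne_zero hy), one_mul,
    sub_self]

theorem ratio_eq (hφ : IsGeneralizedCalibration g φ) (ho : IsOrientation o) {t : ℝ}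
    (hy : y ∈ (extChartAt (𝓡 k) c).target) (hpos : 0 < gramDet g F c (t, y)) :
    ratio g φ o (F t) ((extChartAt (𝓡 k) c).symm y)
      = 1 - energyDensity g φ o F c (t, y) / Real.sqrt (gramDet g F c (t, y)) := by
  have h1 := congrArg (fun β => β (chartFrame c y))
    (pullback_eq_ratio_smul hφ (ho.2 ((extChartAt (𝓡 k) c).symm y)) (F t))
  have h2 := volForm_apply g (ho.2 ((extChartAt (𝓡 k) c).symm y)) (F t) (chartFrame c y)
  have h3 : formCoeff φ F c (t, y) = ratio g φ o (F t) ((extChartAt (𝓡 k) c).symm y)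
      * (chartSign o c y * Real.sqrt (gramDet g F c (t, y))) :=
    h1.trans (congrArg (fun r => ratio g φ o (F t) ((extChartAt (𝓡 k) c).symm y) * r) h2)
  have h4 : chartSign o c y * chartSign o c y = 1 := sign_mul_self (ho.chartForm_ne_zero hy)
  have h5 := (Real.sqrt_pos.2 hpos).ne'
  rw [energyDensity, h3]
  field_simp
  linear_combination (-(ratio g φ o (F t) ((extChartAt (𝓡 k) c).symm y))) * h4

theorem hasDerivAt_ratio (hφ : IsGeneralizedCalibration g φ) (ho : IsOrientation o)
    (hX : IsCalibrated g φ o (F 0))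
    (h : InFamChart n F (F 0 ((extChartAt (𝓡 k) c).symm y)) c (0, y))
    (hf : Function.Injective (mfderiv (𝓡 k) (𝓡 n) (F 0) ((extChartAt (𝓡 k) c).symm y))) :
    HasDerivAt (fun t => ratio g φ o (F t) ((extChartAt (𝓡 k) c).symm y)) 0 0 := by
  have hy : y ∈ (extChartAt (𝓡 k) c).target := h.mem_target
  have hpos := gramDet_pos g (F := F) (t := 0) hy hf
  have hcurve : ContDiffAt ℝ ∞ (fun t : ℝ => (t, y)) 0 := contDiffAt_id.prodMk contDiffAt_const
  have hr : ContDiffAt ℝ ∞ (fun t => gramDet g F c (t, y)) 0 :=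
    ContDiffAt.comp (0 : ℝ) (g := gramDet g F c) (h.contDiffAt_gramDet g) hcurve
  have he : ContDiffAt ℝ ∞ (energyDensity g φ o F c) (0, y) :=
    contDiffAt_energyDensity hφ.1 ho h hpos
  have hd : DifferentiableAt ℝ (fun t => energyDensity g φ o F c (t, y)) 0 :=
    (ContDiffAt.comp (0 : ℝ) (g := energyDensity g φ o F c) he hcurve).differentiableAt (by simp)
  have hs : DifferentiableAt ℝ (fun t => Real.sqrt (gramDet g F c (t, y))) 0 :=
    (hr.sqrt hpos.ne').differentiableAt (by simp)
  have hev : (fun t => ratio g φ o (F t) ((extChartAt (𝓡 k) c).symm y)) =ᶠ[𝓝 0]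
      fun t => 1 - energyDensity g φ o F c (t, y) / Real.sqrt (gramDet g F c (t, y)) := by
    filter_upwards [hr.continuousAt.eventually (lt_mem_nhds hpos)] with t ht
    exact ratio_eq hφ ho hy ht
  exact (hasDerivAt_one_sub_div_of_nonneg hd hs (hX.energyDensity_eq_zero ho hy hf)
    (Real.sqrt_pos.2 hpos).ne' fun t => energyDensity_nonneg hφ ho hy).congr_of_eventuallyEq hev

end EnergyDensity

/-! ## Differentiation under the integral sign -/

section ParametricIntegral

theorem deriv_deriv_slice {E : Type*} [NormedAddCommGroup E] [NormedSpace ℝ E] {q : ℝ × E → ℝ}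
    {y : E} (hq : ContDiffAt ℝ 2 q (0, y)) : deriv (deriv fun t => q (t, y)) 0
      = fderiv ℝ (fun p => fderiv ℝ q p (1, 0)) (0, y) (1, 0) := by
  have hcurve : ∀ s, HasDerivAt (fun t : ℝ => (t, y)) (1, 0) s := fun s =>
    (hasDerivAt_id _).prodMk (hasDerivAt_const _ _)
  have h3 : deriv (fun t => q (t, y)) =ᶠ[𝓝 0] fun t => fderiv ℝ q (t, y) (1, 0) := by
    have hc : ContinuousAt (fun t : ℝ => (t, y)) 0 := (Continuous.prodMk_left y).continuousAt
    filter_upwards [hc.eventually (hq.eventually (by simp))] with t ht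
    exact (HasFDerivAt.comp_hasDerivAt (l := q) t
      (ht.differentiableAt (by simp)).hasFDerivAt (hcurve t)).deriv
  have hq' : ContDiffAt ℝ 1 (fun p => fderiv ℝ q p (1, 0)) (0, y) :=
    (hq.fderiv_right (m := 1) (by norm_num)).clm_apply contDiffAt_const
  exact h3.deriv_eq.trans (HasFDerivAt.comp_hasDerivAt (l := fun p => fderiv ℝ q p (1, 0)) 0
    (hq'.differentiableAt (by simp)).hasFDerivAt (hcurve 0)).deriv

theorem continuousOn_deriv_deriv_slice {E : Type*} [NormedAddCommGroup E] [NormedSpace ℝ E]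
    {q : ℝ × E → ℝ} {K : Set E} (hq : ∀ y ∈ K, ContDiffAt ℝ 2 q (0, y)) :
    ContinuousOn (fun y => deriv (deriv fun t => q (t, y)) 0) K := by
  refine ContinuousOn.congr (fun y hy => ?_) fun y hy => deriv_deriv_slice (hq y hy)
  have h1 : ContDiffAt ℝ 1 (fun p => fderiv ℝ q p (1, 0)) (0, y) :=
    ((hq y hy).fderiv_right (m := 1) (by norm_num)).clm_apply contDiffAt_const
  have h2 : ContDiffAt ℝ 0 (fun p => fderiv ℝ (fun p => fderiv ℝ q p (1, 0)) p (1, 0)) (0, y) :=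
    (h1.fderiv_right (m := 0) (by norm_num)).clm_apply contDiffAt_const
  exact (ContinuousAt.comp (f := fun y : E => ((0 : ℝ), y)) h2.continuousAt
    (Continuous.prodMk_right (0 : ℝ)).continuousAt).continuousWithinAt

variable {E : Type*} [NormedAddCommGroup E] [NormedSpace ℝ E] [MeasurableSpace E] [BorelSpace E]
  {μ : Measure E} [IsFiniteMeasureOnCompacts μ]

theorem eventually_hasDerivAt_integral {K A : Set E} (hK : IsCompact K) (hA : MeasurableSet A)
    (hAK : A ⊆ K) {w : E → ℝ} (hw : ContinuousOn w K) {q : ℝ × E → ℝ}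
    (hq : ∀ y ∈ K, ContDiffAt ℝ 1 q (0, y)) :
    ∀ᶠ t in 𝓝 (0 : ℝ), HasDerivAt (fun s => ∫ y in A, w y * q (s, y) ∂μ)
      (∫ y in A, w y * fderiv ℝ q (t, y) (1, 0) ∂μ) t := by
  -- By compactness of `K`, smoothness near `{0} × K` extends to a uniform time interval. The time
  -- derivative is then bounded on a compact product, and the constant bound is integrable since `A`
  -- has finite measure.
  have htube : ∀ᶠ t in 𝓝 (0 : ℝ), ∀ y ∈ K, ContDiffAt ℝ 1 q (t, y) :=
    hK.eventually_forall_of_forall_eventually fun y hy => (hq y hy).eventually (by simp)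
  obtain ⟨δ, hδ, hball⟩ := Metric.nhds_basis_closedBall.mem_iff.1 htube
  have hc : ∀ t ∈ Metric.closedBall (0 : ℝ) δ, ∀ y ∈ K, ContDiffAt ℝ 1 q (t, y) :=
    fun t ht => hball ht
  have hd : ∀ t ∈ Metric.closedBall (0 : ℝ) δ, ∀ y ∈ K,
      ContinuousAt (fun p => fderiv ℝ q p (1, 0)) (t, y) := fun t ht y hy =>
    (((hc t ht y hy).fderiv_right (m := 0) (by simp)).clm_apply contDiffAt_const).continuousAt
  have hcont : ContinuousOn (fun p : ℝ × E => w p.2 * fderiv ℝ q p (1, 0))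
      (Metric.closedBall (0 : ℝ) δ ×ˢ K) :=
    (hw.comp continuousOn_snd fun p hp => hp.2).mul fun p hp =>
      (hd p.1 hp.1 p.2 hp.2).continuousWithinAt
  obtain ⟨C, hC⟩ := ((isCompact_closedBall (0 : ℝ) δ).prod hK).exists_bound_of_continuousOn hcont
  have hslice : ∀ t : ℝ, Continuous fun y : E => (t, y) := fun t => Continuous.prodMk_right t
  have hF : ∀ t ∈ Metric.closedBall (0 : ℝ) δ, ContinuousOn (fun y => w y * q (t, y)) K :=
    fun t ht => hw.mul fun y hy => ((hc t ht y hy).continuousAt.comp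
      (f := fun y : E => (t, y)) (hslice t).continuousAt).continuousWithinAt
  have hF' : ∀ t ∈ Metric.closedBall (0 : ℝ) δ,
      ContinuousOn (fun y => w y * fderiv ℝ q (t, y) (1, 0)) K := fun t ht =>
    hw.mul fun y hy => (ContinuousAt.comp (g := fun p => fderiv ℝ q p (1, 0))
      (f := fun y : E => (t, y)) (hd t ht y hy) (hslice t).continuousAt).continuousWithinAt
  have hfin : μ A < ⊤ := (measure_mono hAK).trans_lt hK.measure_lt_top
  have hint : ∀ {f : E → ℝ}, ContinuousOn f K → IntegrableOn f A μ := fun hf =>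
    (hf.integrableOn_compact hK).mono_set hAK
  filter_upwards [Metric.ball_mem_nhds (0 : ℝ) hδ] with t ht
  have htc := Metric.ball_subset_closedBall ht
  refine (hasDerivAt_integral_of_dominated_loc_of_deriv_le (μ := μ.restrict A)
    (F := fun s y => w y * q (s, y)) (F' := fun s y => w y * fderiv ℝ q (s, y) (1, 0))
    (bound := fun _ => C) (Metric.isOpen_ball.mem_nhds ht) ?_ (hint (hF t htc))
    (hint (hF' t htc)).aestronglyMeasurable ?_ ?_ ?_).2
  · filter_upwards [Metric.isOpen_ball.mem_nhds ht] with s hs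
    exact (hint (hF s (Metric.ball_subset_closedBall hs))).aestronglyMeasurable
  · exact (ae_restrict_mem hA).mono fun y hy s hs =>
      hC (s, y) ⟨Metric.ball_subset_closedBall hs, hAK hy⟩
  · exact integrableOn_const hfin.ne
  · refine (ae_restrict_mem hA).mono fun y hy s hs => ?_
    have h1 : HasDerivAt (fun t : ℝ => (t, y)) (1, 0) s :=
      (hasDerivAt_id _).prodMk (hasDerivAt_const _ _)
    exact (HasFDerivAt.comp_hasDerivAt (l := q) s
      ((hc s (Metric.ball_subset_closedBall hs) y (hAK hy)).differentiableAt
        (by simp)).hasFDerivAt h1).const_mul (w y)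

/-- The preceding result is used twice, for `q` and for its time derivative. -/
theorem hasDerivAt_deriv_integral {K A : Set E} (hK : IsCompact K) (hA : MeasurableSet A)
    (hAK : A ⊆ K) {w : E → ℝ} (hw : ContinuousOn w K) {q : ℝ × E → ℝ}
    (hq : ∀ y ∈ K, ContDiffAt ℝ 2 q (0, y)) :
    HasDerivAt (deriv fun s => ∫ y in A, w y * q (s, y) ∂μ)
      (∫ y in A, w y * deriv (deriv fun t => q (t, y)) 0 ∂μ) 0 := by
  have h1 := eventually_hasDerivAt_integral (μ := μ) hK hA hAK hw fun y hy =>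
    (hq y hy).of_le (by norm_num)
  have hq' : ∀ y ∈ K, ContDiffAt ℝ 1 (fun p => fderiv ℝ q p (1, 0)) (0, y) := fun y hy =>
    ((hq y hy).fderiv_right (m := 1) (by norm_num)).clm_apply contDiffAt_const
  have h2 := (eventually_hasDerivAt_integral (μ := μ) hK hA hAK hw hq').self_of_nhds
  refine (h2.congr_of_eventuallyEq (h1.mono fun t ht => ht.deriv)).congr_deriv ?_
  exact setIntegral_congr_fun hA fun y hy =>
    congrArg (fun r => w y * r) (deriv_deriv_slice (hq y (hAK hy))).symm

end ParametricIntegral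

/-! ## Reduction of integrals of forms to compact sets in charts -/

section Integrals

variable {k : ℕ} {X : Type*} [TopologicalSpace X] [ChartedSpace (EuclideanSpace ℝ (Fin k)) X]

/-- The inverse chart is continuous only on the target, so the preimage is taken in the subtype and
then pushed back into the model space. -/
theorem measurableSet_chartDomain [MeasurableSpace X] [BorelSpace X] {D : Set X}
    (hD : MeasurableSet D) (c : X) : MeasurableSet (chartDomain (k := k) D c) := by
  have h1 : MeasurableSet (extChartAt (𝓡 k) c).target := (isOpen_extChartAt_target c).measurableSet
  have h2 : Measurable ((extChartAt (𝓡 k) c).target.domRestrict (extChartAt (𝓡 k) c).symm) :=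
    (continuousOn_iff_continuous_domRestrict.1 (continuousOn_extChartAt_symm c)).measurable
  have h3 : chartDomain D c = Subtype.val ''
      ((extChartAt (𝓡 k) c).target.domRestrict (extChartAt (𝓡 k) c).symm ⁻¹' D) := by
    ext y
    exact ⟨fun h => ⟨⟨y, h.1⟩, h.2, rfl⟩, fun ⟨z, hz, hzy⟩ => hzy ▸ ⟨z.2, hz⟩⟩
  rw [h3]
  exact h1.subtype_image (h2 hD)

variable [IsManifold (𝓡 k) ∞ X] [T2Space X] [SigmaCompactSpace X]

/-- The weight of the partition of unity in a chart. -/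
def chartWeight (c : X) (y : EuclideanSpace ℝ (Fin k)) : ℝ :=
  partition k X c ((extChartAt (𝓡 k) c).symm y)

theorem tsupport_partition_subset (c : X) :
    tsupport (partition k X c) ⊆ (extChartAt (𝓡 k) c).source := by
  rw [extChartAt_source]
  exact (SmoothPartitionOfUnity.exists_isSubordinate_chartAt_source (𝓡 k) X).choose_spec c

theorem continuousOn_chartWeight (c : X) :
    ContinuousOn (chartWeight c) (extChartAt (𝓡 k) c).target :=
  (partition k X c).contMDiff.continuous.comp_continuousOn (continuousOn_extChartAt_symm c)

/-- The part of a chart that is relevant for integration over `D`. -/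
def chartSupport (D : Set X) (c : X) : Set (EuclideanSpace ℝ (Fin k)) :=
  extChartAt (𝓡 k) c '' (closure D ∩ tsupport (partition k X c))

theorem isCompact_chartSupport {D : Set X} (hD : IsCompact (closure D)) (c : X) :
    IsCompact (chartSupport (k := k) D c) :=
  (hD.inter_right (isClosed_tsupport _)).image_of_continuousOn
    ((continuousOn_extChartAt c).mono (inter_subset_right.trans (tsupport_partition_subset c)))

theorem chartSupport_subset (D : Set X) (c : X) :
    chartSupport D c ⊆ (extChartAt (𝓡 k) c).target := by
  rintro _ ⟨x, hx, rfl⟩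
  exact (extChartAt (𝓡 k) c).map_source (tsupport_partition_subset c hx.2)

theorem chartWeight_eq_zero {D : Set X} {c : X} {y : EuclideanSpace ℝ (Fin k)}
    (hy : y ∈ chartDomain D c \ (chartDomain D c ∩ chartSupport D c)) : chartWeight c y = 0 := by
  by_contra h
  refine hy.2 ⟨hy.1, (extChartAt (𝓡 k) c).symm y, ⟨subset_closure hy.1.2, ?_⟩,
    (extChartAt (𝓡 k) c).right_inv hy.1.1⟩
  exact subset_closure h

theorem chartIntegrand_eq (o η : KForm k k X) (c : X) (y : EuclideanSpace ℝ (Fin k)) :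
    chartIntegrand o η c y = chartWeight c y
      * (chartSign o c y * η ((extChartAt (𝓡 k) c).symm y) (chartFrame c y)) := rfl

theorem finite_partition_inter {D : Set X} (hD : IsCompact (closure D)) :
    {c : X | ∃ x ∈ D, partition k X c x ≠ 0}.Finite := by
  refine ((partition k X).locallyFinite.finite_nonempty_inter_compact hD).subset ?_
  rintro c ⟨x, hx, hc⟩
  exact ⟨x, hc, subset_closure hx⟩

variable [MeasurableSpace X] [BorelSpace X] {D : Set X} {o η : KForm k k X}

/-- `f c` may be unbounded near the edge of the chart. The weight confines the integrand to a
compact subset of the target, where continuity suffices. -/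
theorem formIntegrableOn_of_continuousOn (hD : MeasurableSet D) (hDc : IsCompact (closure D))
    {f : X → EuclideanSpace ℝ (Fin k) → ℝ}
    (hf : ∀ c, ContinuousOn (f c) (extChartAt (𝓡 k) c).target)
    (hη : ∀ c, ∀ y ∈ (extChartAt (𝓡 k) c).target,
      chartSign o c y * η ((extChartAt (𝓡 k) c).symm y) (chartFrame c y) = f c y) :
    FormIntegrableOn o η D := by
  refine ⟨finite_partition_inter hDc, fun c => ?_⟩
  have h1 : IntegrableOn (fun y => chartWeight c y * f c y)
      (chartDomain D c ∩ chartSupport D c) :=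
    ((((continuousOn_chartWeight c).mul (hf c)).mono
      (chartSupport_subset D c)).integrableOn_compact (isCompact_chartSupport hDc c)).mono_set
        inter_subset_right
  have h2 : IntegrableOn (chartIntegrand o η c) (chartDomain D c ∩ chartSupport D c) :=
    h1.congr_fun (fun y hy => by rw [chartIntegrand_eq, hη c y hy.1.1])
      ((measurableSet_chartDomain hD c).inter (isCompact_chartSupport hDc c).measurableSet)
  exact h2.of_forall_sdiff_eq_zero (measurableSet_chartDomain hD c) fun y hy => by
    rw [chartIntegrand_eq, chartWeight_eq_zero hy, zero_mul]

theorem integral_chartIntegrand (hD : MeasurableSet D) (c : X)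
    {f : EuclideanSpace ℝ (Fin k) → ℝ} (hη : ∀ y ∈ (extChartAt (𝓡 k) c).target,
      chartSign o c y * η ((extChartAt (𝓡 k) c).symm y) (chartFrame c y) = f y) :
    ∫ y in chartDomain (k := k) D c, chartIntegrand o η c y
      = ∫ y in chartDomain (k := k) D c ∩ chartSupport D c, chartWeight c y * f y := by
  rw [← setIntegral_eq_of_subset_of_forall_sdiff_eq_zero (measurableSet_chartDomain hD c)
    (inter_subset_left (t := chartSupport D c)) fun y hy => by
      rw [chartWeight_eq_zero hy, zero_mul]]
  exact setIntegral_congr_fun (measurableSet_chartDomain hD c) fun y hy =>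
    (chartIntegrand_eq o η c y).trans (by rw [hη y hy.1])

theorem formIntegral_eq_sum (hD : MeasurableSet D) (hDc : IsCompact (closure D))
    {f : X → EuclideanSpace ℝ (Fin k) → ℝ}
    (hη : ∀ c, ∀ y ∈ (extChartAt (𝓡 k) c).target,
      chartSign o c y * η ((extChartAt (𝓡 k) c).symm y) (chartFrame c y) = f c y) :
    formIntegral o η D = ∑ c ∈ (finite_partition_inter (k := k) hDc).toFinset,
      ∫ y in chartDomain (k := k) D c ∩ chartSupport D c, chartWeight c y * f c y := by
  -- A `finsum` with infinite support would be zero by default; the support lies among the finitely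
  -- many charts whose weight is nonzero somewhere on `D`.
  rw [formIntegral, finsum_eq_sum_of_support_subset]
  · exact Finset.sum_congr rfl fun c _ => integral_chartIntegrand hD c (hη c)
  · intro c hc
    by_contra hcn
    refine hc (setIntegral_eq_zero_of_forall_eq_zero fun y hy => ?_)
    have h0 : chartWeight c y = 0 := by
      by_contra h
      exact hcn (by simpa using ⟨_, hy.2, h⟩)
    rw [chartIntegrand_eq, h0, zero_mul]

end Integrals

/-! ## The second variation of the energy -/

section SecondVariation

variable {n k : ℕ} {M : Type*} [TopologicalSpace M] [ChartedSpace (EuclideanSpace ℝ (Fin n)) M]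
  [IsManifold (𝓡 n) ∞ M]
  {X : Type*} [TopologicalSpace X] [ChartedSpace (EuclideanSpace ℝ (Fin k)) X]
  [IsManifold (𝓡 k) ∞ X] {g : Metric n M} {φ : KForm n k M} {o : KForm k k X} {F : ℝ → X → M}
  {ε : ℝ}

theorem chartSign_mul_volForm (g : Metric n M) (ho : IsOrientation o) {t : ℝ} {c : X}
    {y : EuclideanSpace ℝ (Fin k)} (hy : y ∈ (extChartAt (𝓡 k) c).target) :
    chartSign o c y * volForm g o (F t) ((extChartAt (𝓡 k) c).symm y) (chartFrame c y)
      = Real.sqrt (gramDet g F c (t, y)) := by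
  have h1 := volForm_apply g (ho.2 ((extChartAt (𝓡 k) c).symm y)) (F t) (chartFrame c y)
  have h2 : chartSign o c y * chartSign o c y = 1 := sign_mul_self (ho.chartForm_ne_zero hy)
  have h3 : volForm g o (F t) ((extChartAt (𝓡 k) c).symm y) (chartFrame c y)
      = chartSign o c y * Real.sqrt (gramDet g F c (t, y)) := h1
  rw [h3, ← mul_assoc, h2, one_mul]

theorem continuousOn_sqrt_gramDet (g : Metric n M)
    (hF : ContMDiffOn (𝓘(ℝ, ℝ).prod (𝓡 k)) (𝓡 n) ∞ (fun p : ℝ × X => F p.1 p.2)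
      (Ioo (-ε) ε ×ˢ univ)) {t : ℝ} (ht : t ∈ Ioo (-ε) ε) (c : X) :
    ContinuousOn (fun y => Real.sqrt (gramDet g F c (t, y))) (extChartAt (𝓡 k) c).target :=
  fun y hy => by
    have h1 := ((inFamChart_of_contMDiffOn hF ht hy).contDiffAt_gramDet g).continuousAt
    have h2 : ContinuousAt (fun z : EuclideanSpace ℝ (Fin k) => (t, z)) y :=
      (Continuous.prodMk_right t).continuousAt
    exact (ContinuousAt.comp (g := gramDet g F c) (f := fun z => (t, z)) h1
      h2).sqrt.continuousWithinAt

theorem continuousOn_formCoeff (hφ : IsSmoothForm φ) (ho : IsOrientation o)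
    (hF : ContMDiffOn (𝓘(ℝ, ℝ).prod (𝓡 k)) (𝓡 n) ∞ (fun p : ℝ × X => F p.1 p.2)
      (Ioo (-ε) ε ×ˢ univ)) {t : ℝ} (ht : t ∈ Ioo (-ε) ε) (c : X) :
    ContinuousOn (fun y => chartSign o c y * formCoeff φ F c (t, y)) (extChartAt (𝓡 k) c).target :=
  fun y hy => by
    have h1 := ((inFamChart_of_contMDiffOn hF ht hy).contDiffAt_formCoeff hφ).continuousAt
    have h2 : ContinuousAt (fun z : EuclideanSpace ℝ (Fin k) => (t, z)) y :=
      (Continuous.prodMk_right t).continuousAt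
    exact ((ho.contDiffAt_chartSign hy).continuousAt.mul (ContinuousAt.comp (g := formCoeff φ F c)
      (f := fun z => (t, z)) h1 h2)).continuousWithinAt

theorem contDiffAt_energyDensity_zero (hφ : IsSmoothForm φ) (ho : IsOrientation o)
    (hF : ContMDiffOn (𝓘(ℝ, ℝ).prod (𝓡 k)) (𝓡 n) ∞ (fun p : ℝ × X => F p.1 p.2)
      (Ioo (-ε) ε ×ˢ univ)) (hε : 0 < ε)
    (himm : ∀ x, Function.Injective (mfderiv (𝓡 k) (𝓡 n) (F 0) x)) {c : X}
    {y : EuclideanSpace ℝ (Fin k)} (hy : y ∈ (extChartAt (𝓡 k) c).target) :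
    ContDiffAt ℝ ∞ (energyDensity g φ o F c) (0, y) :=
  contDiffAt_energyDensity hφ ho
    (inFamChart_of_contMDiffOn hF (show (0 : ℝ) ∈ Ioo (-ε) ε by simp [hε]) hy)
    (gramDet_pos g hy (himm _))

variable [T2Space X] [SigmaCompactSpace X] [MeasurableSpace X] [BorelSpace X] {D : Set X}

theorem energy_eq_sum (hφ : IsSmoothForm φ) (ho : IsOrientation o)
    (hF : ContMDiffOn (𝓘(ℝ, ℝ).prod (𝓡 k)) (𝓡 n) ∞ (fun p : ℝ × X => F p.1 p.2)
      (Ioo (-ε) ε ×ˢ univ)) {t : ℝ} (ht : t ∈ Ioo (-ε) ε)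
    (hD : MeasurableSet D) (hDc : IsCompact (closure D)) :
    energy g φ o D (F t) = ∑ c ∈ (finite_partition_inter (k := k) hDc).toFinset,
      ∫ y in chartDomain (k := k) D c ∩ chartSupport D c,
        chartWeight c y * energyDensity g φ o F c (t, y) := by
  rw [energy, formIntegral_eq_sum hD hDc (η := volForm g o (F t))
      (f := fun c y => Real.sqrt (gramDet g F c (t, y))) fun c y hy =>
        chartSign_mul_volForm g ho hy,
    formIntegral_eq_sum hD hDc (η := pullback φ (F t))
      (f := fun c y => chartSign o c y * formCoeff φ F c (t, y)) fun c y hy => rfl,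
    ← Finset.sum_sub_distrib]
  refine Finset.sum_congr rfl fun c _ => ?_
  have hint : ∀ {f : EuclideanSpace ℝ (Fin k) → ℝ}, ContinuousOn f (extChartAt (𝓡 k) c).target →
      IntegrableOn (fun y => chartWeight c y * f y) (chartDomain D c ∩ chartSupport D c) :=
    fun hf => ((((continuousOn_chartWeight c).mul hf).mono
      (chartSupport_subset D c)).integrableOn_compact (isCompact_chartSupport hDc c)).mono_set
        inter_subset_right
  rw [← integral_sub (hint (continuousOn_sqrt_gramDet g hF ht c))
    (hint (continuousOn_formCoeff hφ ho hF ht c))]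
  simp only [energyDensity, mul_sub]

end SecondVariation

end GenCal

end

/-! ### The second variation theorem -/

theorem mainTheorem12 {n k : ℕ}
    {M : Type*} [TopologicalSpace M] [ChartedSpace (EuclideanSpace ℝ (Fin n)) M]
    [IsManifold (𝓡 n) ∞ M]
    {X : Type*} [TopologicalSpace X] [ChartedSpace (EuclideanSpace ℝ (Fin k)) X]
    [IsManifold (𝓡 k) ∞ X] [T2Space X] [SigmaCompactSpace X] [MeasurableSpace X] [BorelSpace X]
    (g : GenCal.Metric n M) (φ : GenCal.KForm n k M) (hφ : GenCal.IsGeneralizedCalibration g φ)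
    (o : GenCal.KForm k k X) (ho : GenCal.IsOrientation o)
    -- the one-parameter family of submanifolds `X(t)`, `|t| < ε`, with `X(0)` calibrated
    (ε : ℝ) (hε : 0 < ε) (F : ℝ → X → M)
    (hF : ContMDiffOn (𝓘(ℝ, ℝ).prod (𝓡 k)) (𝓡 n) ∞ (fun p : ℝ × X => F p.1 p.2)
      (Ioo (-ε) ε ×ˢ univ))
    (himm : ∀ x, Function.Injective (mfderiv (𝓡 k) (𝓡 n) (F 0) x))
    (hX : GenCal.IsCalibrated g φ o (F 0))
    -- the velocity `V` of the family at `t = 0` is normal to `X`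
    (hV : ∀ x (u : TangentSpace (𝓡 k) x),
      g.inner (F 0 x) (GenCal.velocity F x) (mfderiv (𝓡 k) (𝓡 n) (F 0) x u) = 0)
    -- curves with velocity `V` at time `0`, along which `∇_V` acts on `φ`
    (γ : X → ℝ → M) (hγ : ∀ x, ContMDiffAt 𝓘(ℝ, ℝ) (𝓡 n) ∞ (γ x) 0)
    (hγV : ∀ x, (⟨γ x 0, mfderiv 𝓘(ℝ, ℝ) (𝓡 n) (γ x) 0 (1 : ℝ)⟩ : TangentBundle (𝓡 n) M)
      = ⟨F 0 x, GenCal.velocity F x⟩)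
    -- the part of `X` over which the energy is taken; for compact `X` it can be all of `X`
    (D : Set X) (hD : MeasurableSet D) (hDc : IsCompact (closure D)) :
    -- `φ(t) = λ(t) dvol(t)`, and the first derivative of `λ(t)` vanishes at `t = 0`
    (∀ t ∈ Ioo (-ε) ε, ∀ x, GenCal.pullback φ (F t) x
      = GenCal.ratio g φ o (F t) x • GenCal.volForm g o (F t) x) ∧
    (∀ x, HasDerivAt (fun t => GenCal.ratio g φ o (F t) x) 0 0) ∧
    -- all integrals converge
    (∀ t ∈ Ioo (-ε) ε, GenCal.FormIntegrableOn o (GenCal.volForm g o (F t)) D ∧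
      GenCal.FormIntegrableOn o (GenCal.pullback φ (F t)) D) ∧
    GenCal.FormIntegrableOn o
      (GenCal.secondVariationForm g φ o (F 0) (GenCal.velocity F) γ) D ∧
    -- the energy `E(t)` is twice differentiable at `t = 0`, with the stated second derivative
    (∀ᶠ t in 𝓝 (0 : ℝ), DifferentiableAt ℝ (fun s => GenCal.energy g φ o D (F s)) t) ∧
    HasDerivAt (deriv fun s => GenCal.energy g φ o D (F s))
      (GenCal.formIntegral o
        (GenCal.secondVariationForm g φ o (F 0) (GenCal.velocity F) γ) D) 0 := by
  have h0 : (0 : ℝ) ∈ Ioo (-ε) ε := by simp [hε]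
  -- In every chart the second variation form is the second time derivative of the energy density.
  -- Its continuity and integrability are then read off from the smooth density.
  have hsv : ∀ c, ∀ y ∈ (extChartAt (𝓡 k) c).target,
      GenCal.chartSign o c y * GenCal.secondVariationForm g φ o (F 0) (GenCal.velocity F) γ
        ((extChartAt (𝓡 k) c).symm y) (GenCal.chartFrame c y)
      = deriv (deriv fun t => GenCal.energyDensity g φ o F c (t, y)) 0 := fun c y hy =>
    (GenCal.second_variation_pointwise hφ (ho.2 _) (GenCal.inFamChart_of_contMDiffOn hF h0 hy)
      (himm _) hX (hγ _) (hγV _)).symm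
  have hq : ∀ c, ∀ y ∈ (extChartAt (𝓡 k) c).target,
      ContDiffAt ℝ 2 (GenCal.energyDensity g φ o F c) (0, y) := fun c y hy =>
    (GenCal.contDiffAt_energyDensity_zero hφ.1 ho hF hε himm hy).of_le ENat.LEInfty.out
  -- The set of charts in this finite sum depends on `D` only, not on `t`, so the sum can be
  -- differentiated term by term.
  have hE : (fun t => GenCal.energy g φ o D (F t)) =ᶠ[𝓝 0] fun t =>
      ∑ c ∈ (GenCal.finite_partition_inter (k := k) hDc).toFinset,
        ∫ y in GenCal.chartDomain (k := k) D c ∩ GenCal.chartSupport D c,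
          GenCal.chartWeight c y * GenCal.energyDensity g φ o F c (t, y) := by
    filter_upwards [isOpen_Ioo.mem_nhds h0] with t ht
    exact GenCal.energy_eq_sum hφ.1 ho hF ht hD hDc
  have hK := fun c => GenCal.isCompact_chartSupport (k := k) hDc c
  have hA := fun c => (GenCal.measurableSet_chartDomain (k := k) hD c).inter (hK c).measurableSet
  have hw := fun c => (GenCal.continuousOn_chartWeight (k := k) c).mono
    (GenCal.chartSupport_subset D c)
  have hd1 : ∀ c, ∀ᶠ t in 𝓝 (0 : ℝ), DifferentiableAt ℝ (fun t =>
      ∫ y in GenCal.chartDomain (k := k) D c ∩ GenCal.chartSupport D c,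
          GenCal.chartWeight c y * GenCal.energyDensity g φ o F c (t, y)) t := fun c =>
    (GenCal.eventually_hasDerivAt_integral (hK c) (hA c) inter_subset_right (hw c) fun y hy =>
      (hq c y (GenCal.chartSupport_subset D c hy)).of_le (by norm_num)).mono fun t ht =>
        ht.differentiableAt
  have hd2 := fun c => GenCal.hasDerivAt_deriv_integral (μ := volume) (hK c) (hA c)
    inter_subset_right (hw c) fun y hy => hq c y (GenCal.chartSupport_subset D c hy)
  have hd1' : ∀ᶠ t in 𝓝 (0 : ℝ), ∀ c ∈ (GenCal.finite_partition_inter (k := k) hDc).toFinset,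
      DifferentiableAt ℝ (fun t =>
        ∫ y in GenCal.chartDomain (k := k) D c ∩ GenCal.chartSupport D c,
          GenCal.chartWeight c y * GenCal.energyDensity g φ o F c (t, y)) t :=
    (Filter.eventually_all_finset _).2 fun c _ => hd1 c
  refine ⟨fun t _ x => GenCal.pullback_eq_ratio_smul hφ (ho.2 x) (F t), fun x => ?_,
    fun t ht => ⟨?_, ?_⟩, ?_, ?_, ?_⟩
  · have hy := mem_extChartAt_target (I := 𝓡 k) x
    have h1 := GenCal.hasDerivAt_ratio hφ ho hX (GenCal.inFamChart_of_contMDiffOn hF h0 hy)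
      (himm _)
    rwa [(extChartAt (𝓡 k) x).left_inv (mem_extChartAt_source x)] at h1
  · exact GenCal.formIntegrableOn_of_continuousOn hD hDc
      (f := fun c y => Real.sqrt (GenCal.gramDet g F c (t, y)))
      (GenCal.continuousOn_sqrt_gramDet g hF ht) fun c y hy => GenCal.chartSign_mul_volForm g ho hy
  · exact GenCal.formIntegrableOn_of_continuousOn hD hDc
      (f := fun c y => GenCal.chartSign o c y * GenCal.formCoeff φ F c (t, y))
      (GenCal.continuousOn_formCoeff hφ.1 ho hF ht) fun c y hy => rfl
  · exact GenCal.formIntegrableOn_of_continuousOn hD hDc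
      (f := fun c y => deriv (deriv fun t => GenCal.energyDensity g φ o F c (t, y)) 0)
      (fun c => GenCal.continuousOn_deriv_deriv_slice (hq c)) hsv
  · filter_upwards [hE.eventuallyEq_nhds, hd1'] with t ht hdt
    exact (DifferentiableAt.fun_sum hdt).congr_of_eventuallyEq ht
  · have h1 : (deriv fun t => GenCal.energy g φ o D (F t)) =ᶠ[𝓝 0] fun t =>
        ∑ c ∈ (GenCal.finite_partition_inter (k := k) hDc).toFinset,
          deriv (fun t => ∫ y in GenCal.chartDomain (k := k) D c ∩ GenCal.chartSupport D c,
            GenCal.chartWeight c y * GenCal.energyDensity g φ o F c (t, y)) t := by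
      filter_upwards [hE.deriv, hd1'] with t ht hdt
      rw [ht, deriv_fun_sum hdt]
    rw [GenCal.formIntegral_eq_sum hD hDc hsv]
    exact (HasDerivAt.fun_sum fun c _ => hd2 c).congr_of_eventuallyEq h1
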